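/- Let $L_1,L_2>0$, let $\mathscr D=[0,L_1]\times[0,L_2]$ with periodic boundary conditions, and let all functions be $\mathscr D$-periodic. Write $|\cdot|$ and $(\cdot,\cdot)$ for the norm and inner product of $L^2(\mathscr D)$, and, for functions of zero mean, $|g|_{H^s}^2=L_1L_2\sum_{\kappa\in\mathbb Z^2\setminus 0}|k_\kappa|^{2s}|\hat g_\kappa|^2$ with $k_\kappa=(2\pi\kappa_1/L_1,2\pi\kappa_2/L_2)$ and $\hat g_\kappa$ the Fourier coefficients; thus $|g|_{H^1}=|\nabla g|$ and $|g|_{H^2}=|\Delta g|$. A zero-mean distribution $f$ has $|f|_{H^{-1}}\le F$ if $|\langle f,\varphi\rangle|\le F|\nabla\varphi|$ for all smooth periodic $\varphi$. Put $\partial(g,h)=\partial_xg\,\partial_yh-\partial_xh\,\partial_yg$. Let $\mu,k>0$, let $f^n$ ($n\ge 0$) be zero-mean elements of $H^{-1}$ with $|f^n|_{H^{-1}}\le F$ for all $n$, and let $\omega^n\in L^2$ ($n\ge0$) have zero mean and satisfy, in the sense of distributions, $$\frac{3\omega^{n+1}-4\omega^n+\omega^{n-1}}{2k}+\partial(2\psi^n-\psi^{n-1},2\omega^n-\omega^{n-1})=\mu\Delta\omega^{n+1}+f^n,\qquad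 n\ge1,$$ where $\psi^n$ is the zero-mean solution of $\Delta\psi^n=\omega^n$. Suppose $\omega^0,\omega^1\in H^{1/2}$ with $|\omega^0|_{H^{1/2}},|\omega^1|_{H^{1/2}}\le R$. Let $c_0=(\max(L_1,L_2)/2\pi)^2$ be the Poincaré constant, $\nu=\mu/(2c_0)$, and $$\|u,v\|_{\nu k}^2=\tfrac12|u|^2+\tfrac{5+\nu k}2|v|^2-2(u,v).$$ There is a constant $c>0$ depending only on $L_1,L_2$, and there are, depending on $L_1,L_2,\mu$ and the indicated arguments only, a timestep bound $0<k_0(R,F)\le1/\nu$, times $t_0(R,F)$, $t_1(R,F_0)$, $t_2(R,F_1)$ and constants $M_0(F)$, $M_1'(R_1,F_0)$, $M_1(F_0)$, $\hat M_0(F_0)$, $M_\delta'(F_0,D)$, $M_2(F_1)$, $M_\delta(F_1)$ such that, whenever $k\le k_0(R,F)$, the following hold. 1. ($L^2$.) For all $n\ge0$, $\omega^{n+2}\in H^1$ and $$\|\omega^{n+1},\omega^{n+2}\|_{\nu k}^2+\mu k|\nabla\omega^{n+2}|^2\le e^{-\nu nk/2}\|\omega^0,\omega^1\|_{\nu k}^2+\frac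 c{\mu^2}F^2 .$$ Moreover $|\omega^n|\le M_0(F)$ whenever $nk\ge t_0(R,F)$. 2. ($H^1$.) Suppose $f^n\in L^2$ and $|f^n|\le F_0$ for all $n$. If $\omega^0,\omega^1\in H^1$ with $|\nabla\omega^0|,|\nabla\omega^1|\le R_1$, then $\omega^n\in H^1$ and $|\nabla\omega^n|\le M_1'(R_1,F_0)$ for all $n\ge0$. Without this extra assumption, $\omega^n\in H^1$ and $|\nabla\omega^n|\le M_1(F_0)$ whenever $nk\ge t_1(R,F_0)$. For $nk\ge t_1(R,F_0)$ also $|\omega^{n+1}-\omega^n|^2\le k\,\hat M_0(F_0)$; if in addition $|f^{n+1}-f^n|_{H^{-1}}\le Dk$ for all $n$ (for instance, with $D=0$, if $f^n$ does not depend on $n$), then $|\omega^{n+1}-\omega^n|\le k\,M_\delta'(F_0,D)$ for $nk\ge t_1(R,F_0)$. 3. ($H^2$.) Suppose $f^n\in H^1$ and $|\nabla f^n|\le F_1$ for all $n$. Then, whenever $nk\ge t_2(R,F_1)$, $\omega^n\in H^2$, $|\Delta\omega^n|\le M_2(F_1)$ and $|\omega^{n+1}-\omega^n|\le k\,M_\delta(F_1)$.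 -/

import Mathlib

open MeasureTheory

noncomputable section

namespace PeriodicNS

/-- The period cell `(0, L₁] × (0, L₂]`. -/
def cell (L₁ L₂ : ℝ) : Set (ℝ × ℝ) := Set.Ioc 0 L₁ ×ˢ Set.Ioc 0 L₂

/-- `g` is periodic with period `L₁` in the first and `L₂` in the second variable. -/
def IsPeriodic (L₁ L₂ : ℝ) (g : ℝ × ℝ → ℝ) : Prop :=
  ∀ p, g (p + (L₁, 0)) = g p ∧ g (p + (0, L₂)) = g p

/-- Integral over the period cell. -/
def cellInt (L₁ L₂ : ℝ) (g : ℝ × ℝ → ℝ) : ℝ := ∫ p in cell L₁ L₂, g p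

/-- Periodic functions that are square integrable over the period cell. -/
def PerL2 (L₁ L₂ : ℝ) (g : ℝ × ℝ → ℝ) : Prop :=
  IsPeriodic L₁ L₂ g ∧ MemLp g 2 (volume.restrict (cell L₁ L₂))

/-- The squared `L²` norm over the period cell. -/
def l2Sq (L₁ L₂ : ℝ) (g : ℝ × ℝ → ℝ) : ℝ := cellInt L₁ L₂ fun p => g p ^ 2

/-- The `L²` norm over the period cell. -/
def l2Norm (L₁ L₂ : ℝ) (g : ℝ × ℝ → ℝ) : ℝ := √(l2Sq L₁ L₂ g)

/-- Classical partial derivative in the first variable. -/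
def pdx (φ : ℝ × ℝ → ℝ) (p : ℝ × ℝ) : ℝ := fderiv ℝ φ p (1, 0)

/-- Classical partial derivative in the second variable. -/
def pdy (φ : ℝ × ℝ → ℝ) (p : ℝ × ℝ) : ℝ := fderiv ℝ φ p (0, 1)

/-- Classical Laplacian. -/
def lapl (φ : ℝ × ℝ → ℝ) (p : ℝ × ℝ) : ℝ := pdx (pdx φ) p + pdy (pdy φ) p

/-- The space of smooth periodic test functions. -/
def TestFn (L₁ L₂ : ℝ) : Submodule ℝ (ℝ × ℝ → ℝ) where
  carrier := {φ | ContDiff ℝ ((⊤ : ℕ∞) : WithTop ℕ∞) φ ∧ IsPeriodic L₁ L₂ φ}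
  add_mem' := by
    rintro a b ⟨ha, ha'⟩ ⟨hb, hb'⟩
    refine ⟨ha.add hb, fun p => ?_⟩
    simp [(ha' p).1, (ha' p).2, (hb' p).1, (hb' p).2]
  zero_mem' := ⟨contDiff_const, fun _ => ⟨rfl, rfl⟩⟩
  smul_mem' := by
    rintro r a ⟨ha, ha'⟩
    refine ⟨contDiff_const.smul ha, fun p => ?_⟩
    simp [(ha' p).1, (ha' p).2]

/-! ### Sobolev spaces of periodic functions, through Fourier series -/

/-- The Fourier coefficient
`(L₁L₂)⁻¹ ∫ g(x,y) exp(-2πi(κ₁x/L₁ + κ₂y/L₂)) dx dy` over the period cell. -/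
def fourierCf (L₁ L₂ : ℝ) (g : ℝ × ℝ → ℝ) (κ : ℤ × ℤ) : ℂ :=
  ((L₁ * L₂)⁻¹ : ℝ) * ∫ p in cell L₁ L₂, (g p : ℂ) *
    Complex.exp (-(2 * Real.pi * (κ.1 * p.1 / L₁ + κ.2 * p.2 / L₂) : ℝ) * Complex.I)

/-- The squared modulus of the wave vector `(2πκ₁/L₁, 2πκ₂/L₂)`, that is, the eigenvalue of
minus the Laplacian on the mode `κ`. -/
def waveSq (L₁ L₂ : ℝ) (κ : ℤ × ℤ) : ℝ :=
  (2 * Real.pi * κ.1 / L₁) ^ 2 + (2 * Real.pi * κ.2 / L₂) ^ 2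

/-- Membership in the periodic Sobolev space `H^s`, for `s ≥ 0`. -/
def MemH (L₁ L₂ s : ℝ) (g : ℝ × ℝ → ℝ) : Prop :=
  PerL2 L₁ L₂ g ∧ Summable fun κ : ℤ × ℤ => waveSq L₁ L₂ κ ^ s * ‖fourierCf L₁ L₂ g κ‖ ^ 2

/-- The homogeneous norm `(L₁L₂ ∑_κ |k_κ|^{2s} |ĝ_κ|²)^{1/2}`, a norm of `H^s` on functions of
zero mean; by Parseval it is `|∇g|_{L²}` for `s = 1` and `|Δg|_{L²}` for `s = 2`. -/
def hNorm (L₁ L₂ s : ℝ) (g : ℝ × ℝ → ℝ) : ℝ :=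
  √(L₁ * L₂ * ∑' κ : ℤ × ℤ, waveSq L₁ L₂ κ ^ s * ‖fourierCf L₁ L₂ g κ‖ ^ 2)

/-- `g ∈ H^s` with norm at most `B`. -/
def HBound (L₁ L₂ s : ℝ) (g : ℝ × ℝ → ℝ) (B : ℝ) : Prop :=
  MemH L₁ L₂ s g ∧ hNorm L₁ L₂ s g ≤ B

/-! ### Forcing: periodic distributions -/

/-- The distribution `f` has zero mean, lies in `H⁻¹`, and has `H⁻¹` norm at most `B`:
`|⟨f, φ⟩| ≤ B |∇φ|_{L²}` for every test function. (Zero mean is the case of constant `φ`.) -/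
def HNegBound (L₁ L₂ : ℝ) (f : TestFn L₁ L₂ →ₗ[ℝ] ℝ) (B : ℝ) : Prop :=
  ∀ φ : TestFn L₁ L₂,
    |f φ| ≤ B * √(cellInt L₁ L₂ fun p => pdx φ.1 p ^ 2 + pdy φ.1 p ^ 2)

/-- The distribution `f` is represented by the periodic `L²` function `g`. -/
def Represents (L₁ L₂ : ℝ) (g : ℝ × ℝ → ℝ) (f : TestFn L₁ L₂ →ₗ[ℝ] ℝ) : Prop :=
  PerL2 L₁ L₂ g ∧ ∀ φ : TestFn L₁ L₂, f φ = cellInt L₁ L₂ fun p => g p * φ.1 p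

/-- The distribution `f` is in `L²` with norm at most `B`. -/
def ForceL2Bound (L₁ L₂ : ℝ) (f : TestFn L₁ L₂ →ₗ[ℝ] ℝ) (B : ℝ) : Prop :=
  ∃ g, Represents L₁ L₂ g f ∧ l2Norm L₁ L₂ g ≤ B

/-- The distribution `f` is in `H¹` with `|∇f|_{L²} ≤ B`. -/
def ForceH1Bound (L₁ L₂ : ℝ) (f : TestFn L₁ L₂ →ₗ[ℝ] ℝ) (B : ℝ) : Prop :=
  ∃ g, Represents L₁ L₂ g f ∧ HBound L₁ L₂ 1 g B

/-! ### The scheme -/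

/-- `ψ` is the streamfunction of `ω`: periodic of zero mean, `Δψ = ω` in the sense of
distributions, with weak partial derivatives `ψx`, `ψy` in `L²`. -/
structure IsStreamfunction (L₁ L₂ : ℝ) (ω ψ ψx ψy : ℝ × ℝ → ℝ) : Prop where
  perL2 : PerL2 L₁ L₂ ψ
  perL2_x : PerL2 L₁ L₂ ψx
  perL2_y : PerL2 L₁ L₂ ψy
  mean_zero : cellInt L₁ L₂ ψ = 0
  weak_x : ∀ φ : TestFn L₁ L₂,
    cellInt L₁ L₂ (fun p => ψ p * pdx φ.1 p) = -cellInt L₁ L₂ fun p => ψx p * φ.1 p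
  weak_y : ∀ φ : TestFn L₁ L₂,
    cellInt L₁ L₂ (fun p => ψ p * pdy φ.1 p) = -cellInt L₁ L₂ fun p => ψy p * φ.1 p
  laplace : ∀ φ : TestFn L₁ L₂,
    cellInt L₁ L₂ (fun p => ψ p * lapl φ.1 p) = cellInt L₁ L₂ fun p => ω p * φ.1 p

/-- The pairing `⟨∂(ψ, ω), φ⟩ = -∫ ω ∂(ψ, φ)` of the Jacobian
`∂(ψ, ω) = ∂ₓψ ∂ᵧω - ∂ₓω ∂ᵧψ` with a test function; it depends on `ψ` only through its weak
partial derivatives `ψx`, `ψy`. -/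
def jacPair (L₁ L₂ : ℝ) (ψx ψy ω φ : ℝ × ℝ → ℝ) : ℝ :=
  -cellInt L₁ L₂ fun p => ω p * (ψx p * pdy φ p - pdx φ p * ψy p)

/-- The vorticities `ω⁰, ω¹, ω², …` (periodic, square integrable, of zero mean) solve, in the
sense of distributions and for every `n ≥ 1`,
`(3ωⁿ⁺¹ - 4ωⁿ + ωⁿ⁻¹)/(2k) + ∂(2ψⁿ - ψⁿ⁻¹, 2ωⁿ - ωⁿ⁻¹) = μ Δωⁿ⁺¹ + fⁿ`,
where `ψⁿ` is the streamfunction of `ωⁿ`. (Below, `n + 1` stands for the index `n ≥ 1`.) -/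
structure IsSolution (L₁ L₂ μ k : ℝ) (f : ℕ → (TestFn L₁ L₂ →ₗ[ℝ] ℝ))
    (ω : ℕ → ℝ × ℝ → ℝ) : Prop where
  perL2 : ∀ n, PerL2 L₁ L₂ (ω n)
  mean_zero : ∀ n, cellInt L₁ L₂ (ω n) = 0
  scheme : ∃ ψ ψx ψy : ℕ → ℝ × ℝ → ℝ,
    (∀ n, IsStreamfunction L₁ L₂ (ω n) (ψ n) (ψx n) (ψy n)) ∧
    ∀ (n : ℕ) (φ : TestFn L₁ L₂),
      cellInt L₁ L₂ (fun p => (3 * ω (n + 2) p - 4 * ω (n + 1) p + ω n p) / (2 * k) * φ.1 p)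
        + jacPair L₁ L₂ (fun p => 2 * ψx (n + 1) p - ψx n p)
            (fun p => 2 * ψy (n + 1) p - ψy n p) (fun p => 2 * ω (n + 1) p - ω n p) φ.1
      = μ * cellInt L₁ L₂ (fun p => ω (n + 2) p * lapl φ.1 p) + f (n + 1) φ

/-- The squared `G`-norm `|u|²/2 + (5 + a)/2 |v|² - 2 (u, v)` of a pair. -/
def gNormSq (L₁ L₂ a : ℝ) (u v : ℝ × ℝ → ℝ) : ℝ :=
  l2Sq L₁ L₂ u / 2 + (5 + a) / 2 * l2Sq L₁ L₂ v - 2 * cellInt L₁ L₂ fun p => u p * v p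

/-- The optimal constant `c₀` in the Poincaré inequality `|ω|² ≤ c₀ |∇ω|²` for periodic functions
of zero mean. -/
def poincareConst (L₁ L₂ : ℝ) : ℝ := (max L₁ L₂ / (2 * Real.pi)) ^ 2

/-- The decay rate `ν = μ / (2 c₀)`. -/
def decayRate (L₁ L₂ μ : ℝ) : ℝ := μ / (2 * poincareConst L₁ L₂)

end PeriodicNS

end

/-!
The scheme is studied through Fourier coefficients. By Parseval's identity
(`hasSum_cfourierCf`), the norms of `L²` and `H^s` are weighted `ℓ²` norms of coefficient sequences
(`sobSq`), and the weak formulation, tested with `cos (k_κ · p)` and `sin (k_κ · p)`, is one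
recursion for each wave vector (`IsSolution.isStep`), coupled by the Jacobian, which becomes a
convolution (`jac`). Testing with trigonometric polynomials shows that the `H⁻¹` norm of the
forcing, defined by duality, is a weighted `ℓ²` norm as well (`HNegBound.sum_le`). Product
estimates for the Jacobian follow from Young's inequality for convolutions: the velocity enters
through the `ℓ¹` norm of its coefficients (`velNorm`), which the `H^{1/2}` norm of the vorticity
bounds, because `∑ |k_κ|⁻³` converges in two dimensions.

The energy estimate (`energy_step`) rests on an algebraic identity for the second-order backward
difference (`energy_scalar`): tested with the new vorticity `ωⁿ⁺¹`, the difference quotient yields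
the increase of the `G`-norm and, in addition, the square of the defect
`δ = (1 + νk) ωⁿ⁺¹ - 2ωⁿ + ωⁿ⁻¹`. The advection term is explicit, and does not vanish when tested
with `ωⁿ⁺¹`. As the Jacobian is antisymmetric (`jac_antisymm`), it equals the advection of `ωⁿ⁺¹`
tested with `δ`, and is therefore absorbed by the square of the defect and by the viscosity,
provided that `k` times the square of the velocity is small compared to `μ`. This smallness is the
only place where the time step has to depend on the initial data. It is propagated by induction
(`IsTrajectory.small`): the energy estimate up to some step bounds `|ω|²` and `k |∇ω|²` at that
step, hence `k |ω|²_{H^{1/2}}` by a multiple of `k^{1/2}`, by interpolation. Since the energy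
contracts by the factor `(1 + νk)⁻¹` in each step, it forgets the initial data, up to a multiple of
the squared `H⁻¹` norm of the forcing (`IsTrajectory.energy_decay`).

All higher bounds use windows of about `1 / (νk)` steps, that is, of a fixed length in time. The
energy estimate bounds the sum of `k |∇ω|²` over a window, and the uniform Gronwall inequality
(`uniform_gronwall`) turns this into a bound of `|∇ω|` at its end (`IsStable.sob_one_window`). This
bound yields that of the sum of `k |Δω|²`, and, in the same way, that of `|Δω|`
(`exists_sob_two_le`). The increments satisfy a contraction, up to the terms of the scheme that are
multiplied by `k`, and one window reduces them to the size of those terms: this gives the order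
`k^{1/2}` if the vorticity is bounded in `H¹` (`exists_incSq_le`) and the order `k` if it is bounded
in `H²`. If the vorticity is bounded in `H¹` only, the order `k` follows from the linearised scheme,
which the increments solve (`IsStable.increment_energy`): the sum of their squares over a window is
of order `k`, so that the uniform Gronwall inequality applies once more (`exists_incSq_le_sq`).
-/

open MeasureTheory

noncomputable section

namespace PeriodicNS

/-! ### Parseval's identity on the period cell -/

/-- The parametrisation of the period cell by the unit torus. -/
def torusToCell (L₁ L₂ : ℝ) (t : UnitAddTorus (Fin 2)) : ℝ × ℝ :=
  (L₁ * (AddCircle.equivIoc 1 0 (t 0) : ℝ), L₂ * (AddCircle.equivIoc 1 0 (t 1) : ℝ))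

/-- The parametrisation of the cell carries the Haar measure of the torus to normalised Lebesgue
measure. -/
theorem measurePreserving_torusToCell {L₁ L₂ : ℝ} (hL₁ : 0 < L₁) (hL₂ : 0 < L₂) :
    MeasurePreserving (torusToCell L₁ L₂)
      (Measure.pi fun _ : Fin 2 => (AddCircle.haarAddCircle : Measure UnitAddCircle))
      ((ENNReal.ofReal L₁⁻¹ * ENNReal.ofReal L₂⁻¹) • volume.restrict (cell L₁ L₂)) := by
  have h1 := UnitAddTorus.measurePreserving_equivPiIoc (d := Fin 2) (fun _ => 0)
  have h2 : MeasurePreserving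
      (Subtype.val : {x : Fin 2 → ℝ // ∀ i, x i ∈ Set.Ioc (0:ℝ) (0 + 1)} → Fin 2 → ℝ)
      (Measure.comap Subtype.val volume)
      (volume.restrict {x : Fin 2 → ℝ | ∀ i, x i ∈ Set.Ioc (0:ℝ) (0 + 1)}) :=
    measurePreserving_subtype_coe (MeasurableSet.univ_pi' fun i => measurableSet_Ioc)
  have h3 := (volume_preserving_finTwoArrow ℝ).restrict_preimage
    (s := Set.Ioc (0:ℝ) 1 ×ˢ Set.Ioc (0:ℝ) 1) (measurableSet_Ioc.prod measurableSet_Ioc)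
  have hsc : ∀ {L : ℝ}, 0 < L → MeasurePreserving (fun x : ℝ => L * x) volume
      (ENNReal.ofReal L⁻¹ • volume) := fun {L} hL => by
    refine ⟨measurable_const_mul L, ?_⟩
    rw [Real.map_volume_mul_left hL.ne', abs_of_pos (inv_pos.mpr hL)]
  have h4 := ((hsc hL₁).prod (hsc hL₂)).restrict_preimage (s := cell L₁ L₂)
    (measurableSet_Ioc.prod measurableSet_Ioc)
  have e1 : (MeasurableEquiv.finTwoArrow : (Fin 2 → ℝ) ≃ᵐ ℝ × ℝ) ⁻¹'
      (Set.Ioc (0:ℝ) 1 ×ˢ Set.Ioc (0:ℝ) 1) =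
      {x : Fin 2 → ℝ | ∀ i, x i ∈ Set.Ioc (0:ℝ) (0 + 1)} := by
    ext x
    simp [Fin.forall_fin_two, MeasurableEquiv.finTwoArrow, Set.mem_prod]
  have e2 : Prod.map (fun x : ℝ => L₁ * x) (fun x : ℝ => L₂ * x) ⁻¹' (cell L₁ L₂) =
      Set.Ioc (0:ℝ) 1 ×ˢ Set.Ioc (0:ℝ) 1 := by
    ext ⟨x, y⟩
    simp [cell, hL₁, hL₂]
  rw [e1] at h3
  rw [e2] at h4
  rw [Measure.prod_smul_left, Measure.prod_smul_right, smul_smul, Measure.restrict_smul] at h4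
  exact h4.comp (h3.comp (h2.comp h1))

/-- The complex exponential `exp(i k_κ · p)`. -/
def expMode (L₁ L₂ : ℝ) (κ : ℤ × ℤ) (p : ℝ × ℝ) : ℂ :=
  Complex.exp ((2 * Real.pi * (κ.1 * p.1 / L₁ + κ.2 * p.2 / L₂) : ℝ) * Complex.I)

/-- Fourier coefficients of complex-valued functions. -/
def cfourierCf (L₁ L₂ : ℝ) (F : ℝ × ℝ → ℂ) (κ : ℤ × ℤ) : ℂ :=
  ((L₁ * L₂)⁻¹ : ℝ) * ∫ p in cell L₁ L₂, F p * expMode L₁ L₂ (-κ) p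

theorem fourierCf_eq_cfourierCf (L₁ L₂ : ℝ) (g : ℝ × ℝ → ℝ) (κ : ℤ × ℤ) :
    fourierCf L₁ L₂ g κ = cfourierCf L₁ L₂ (fun p => (g p : ℂ)) κ := by
  unfold fourierCf cfourierCf expMode
  congr 2
  ext p
  congr 3
  push_cast [Prod.fst_neg, Prod.snd_neg]
  ring

theorem expMode_add (L₁ L₂ : ℝ) (κ l : ℤ × ℤ) (p : ℝ × ℝ) :
    expMode L₁ L₂ (κ + l) p = expMode L₁ L₂ κ p * expMode L₁ L₂ l p := by
  unfold expMode
  rw [← Complex.exp_add]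
  congr 1
  push_cast [Prod.fst_add, Prod.snd_add]
  ring

theorem expMode_zero (L₁ L₂ : ℝ) (p : ℝ × ℝ) : expMode L₁ L₂ 0 p = 1 := by
  simp [expMode]

theorem conj_expMode (L₁ L₂ : ℝ) (κ : ℤ × ℤ) (p : ℝ × ℝ) :
    (starRingEnd ℂ) (expMode L₁ L₂ κ p) = expMode L₁ L₂ (-κ) p := by
  unfold expMode
  rw [← Complex.exp_conj]
  congr 1
  simp only [map_mul, Complex.conj_ofReal, Complex.conj_I]
  push_cast [Prod.fst_neg, Prod.snd_neg]
  ring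

theorem norm_expMode (L₁ L₂ : ℝ) (κ : ℤ × ℤ) (p : ℝ × ℝ) : ‖expMode L₁ L₂ κ p‖ = 1 :=
  Complex.norm_exp_ofReal_mul_I _

theorem contDiff_expMode (L₁ L₂ : ℝ) (κ : ℤ × ℤ) {n : WithTop ℕ∞} :
    ContDiff ℝ n (expMode L₁ L₂ κ) := by
  unfold expMode
  have h : ContDiff ℝ n fun p : ℝ × ℝ =>
      2 * Real.pi * (κ.1 * p.1 / L₁ + κ.2 * p.2 / L₂) := by fun_prop
  exact ((Complex.ofRealCLM.contDiff.comp h).mul contDiff_const).cexp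

theorem integral_torusToCell {L₁ L₂ : ℝ} (hL₁ : 0 < L₁) (hL₂ : 0 < L₂) {F : ℝ × ℝ → ℂ}
    (hF : AEStronglyMeasurable F (volume.restrict (cell L₁ L₂))) :
    ∫ t, F (torusToCell L₁ L₂ t)
      ∂(Measure.pi fun _ : Fin 2 => (AddCircle.haarAddCircle : Measure UnitAddCircle)) =
    ((L₁ * L₂)⁻¹ : ℝ) * ∫ p in cell L₁ L₂, F p := by
  have hm := measurePreserving_torusToCell hL₁ hL₂
  rw [← integral_map hm.measurable.aemeasurable
    (by rw [hm.map_eq]; exact hF.smul_measure _), hm.map_eq, integral_smul_measure]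
  rw [← ENNReal.ofReal_mul (by positivity), ENNReal.toReal_ofReal (by positivity),
    Complex.real_smul, mul_inv]

theorem mFourier_eq_expMode {L₁ L₂ : ℝ} (hL₁ : 0 < L₁) (hL₂ : 0 < L₂) (n : Fin 2 → ℤ)
    (t : UnitAddTorus (Fin 2)) :
    UnitAddTorus.mFourier n t = expMode L₁ L₂ (n 0, n 1) (torusToCell L₁ L₂ t) := by
  have key : ∀ x : UnitAddCircle, ∀ m : ℤ, fourier m x =
      Complex.exp (2 * Real.pi * Complex.I * m * ((AddCircle.equivIoc 1 0 x : ℝ) : ℂ)) := by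
    intro x m
    conv_lhs => rw [← (AddCircle.equivIoc (1:ℝ) 0).symm_apply_apply x]
    rw [show (AddCircle.equivIoc (1:ℝ) 0).symm (AddCircle.equivIoc (1:ℝ) 0 x) =
      ((AddCircle.equivIoc (1:ℝ) 0 x : ℝ) : UnitAddCircle) from rfl, fourier_coe_apply]
    simp
  simp only [UnitAddTorus.mFourier, ContinuousMap.coe_mk, Fin.prod_univ_two, key]
  rw [← Complex.exp_add]
  unfold expMode torusToCell
  congr 1
  have h1 : (L₁ : ℂ) ≠ 0 := by exact_mod_cast hL₁.ne'
  have h2 : (L₂ : ℂ) ≠ 0 := by exact_mod_cast hL₂.ne'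
  push_cast
  field_simp

/-- Parseval's identity on the period cell, in polarised form. -/
theorem hasSum_cfourierCf {L₁ L₂ : ℝ} (hL₁ : 0 < L₁) (hL₂ : 0 < L₂) {F G : ℝ × ℝ → ℂ}
    (hF : MemLp F 2 (volume.restrict (cell L₁ L₂)))
    (hG : MemLp G 2 (volume.restrict (cell L₁ L₂))) :
    HasSum (fun κ => (starRingEnd ℂ) (cfourierCf L₁ L₂ F κ) * cfourierCf L₁ L₂ G κ)
      (((L₁ * L₂)⁻¹ : ℝ) * ∫ p in cell L₁ L₂, (starRingEnd ℂ) (F p) * G p) := by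
  have hm := measurePreserving_torusToCell hL₁ hL₂
  have hT : ∀ {F : ℝ × ℝ → ℂ}, MemLp F 2 (volume.restrict (cell L₁ L₂)) →
      MemLp (F ∘ torusToCell L₁ L₂) 2
        (Measure.pi fun _ : Fin 2 => (AddCircle.haarAddCircle : Measure UnitAddCircle)) :=
    fun h => (h.smul_measure (by finiteness)).comp_measurePreserving hm
  have hc : ∀ {F : ℝ × ℝ → ℂ} (h : MemLp F 2 (volume.restrict (cell L₁ L₂))) (n : Fin 2 → ℤ),
      UnitAddTorus.mFourierCoeff ((hT h).toLp _) n = cfourierCf L₁ L₂ F (n 0, n 1) := by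
    intro F h n
    have e : UnitAddTorus.mFourierCoeff ((hT h).toLp _) n =
        ∫ t, (fun p => F p * expMode L₁ L₂ (-(n 0, n 1)) p) (torusToCell L₁ L₂ t)
          ∂(Measure.pi fun _ : Fin 2 =>
            (AddCircle.haarAddCircle : Measure UnitAddCircle)) := by
      refine integral_congr_ae ?_
      filter_upwards [(hT h).coeFn_toLp] with t ht
      rw [ht, mFourier_eq_expMode hL₁ hL₂]
      simp [mul_comm]
    have e' : AEStronglyMeasurable (fun p => F p * expMode L₁ L₂ (-(n 0, n 1)) p)
        (volume.restrict (cell L₁ L₂)) :=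
      h.1.mul (contDiff_expMode L₁ L₂ _ (n := 0)).continuous.aestronglyMeasurable
    rw [e, integral_torusToCell hL₁ hL₂ e']
    rfl
  have key := (UnitAddTorus.hasSum_prod_mFourierCoeff ((hT hF).toLp _) ((hT hG).toLp _)).congr_fun
    (g := fun n : Fin 2 → ℤ => (starRingEnd ℂ) (cfourierCf L₁ L₂ F (n 0, n 1)) *
      cfourierCf L₁ L₂ G (n 0, n 1))
    (fun n => (congrArg₂ (fun a b => (starRingEnd ℂ) a * b) (hc hF n) (hc hG n)).symm)
  have e2 : ∫ t, (fun p => (starRingEnd ℂ) (F p) * G p) (torusToCell L₁ L₂ t)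
          ∂(Measure.pi fun _ : Fin 2 =>
            (AddCircle.haarAddCircle : Measure UnitAddCircle)) =
      ((L₁ * L₂)⁻¹ : ℝ) * ∫ p in cell L₁ L₂, (starRingEnd ℂ) (F p) * G p :=
    integral_torusToCell hL₁ hL₂
      ((Complex.continuous_conj.comp_aestronglyMeasurable hF.1).mul hG.1)
  rw [← e2]
  have e3 := (finTwoArrowEquiv ℤ).symm.hasSum_iff (f := fun n : Fin 2 → ℤ =>
    (starRingEnd ℂ) (cfourierCf L₁ L₂ F (n 0, n 1)) * cfourierCf L₁ L₂ G (n 0, n 1))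
    (a := ∫ t, (fun p => (starRingEnd ℂ) (F p) * G p) (torusToCell L₁ L₂ t)
          ∂(Measure.pi fun _ : Fin 2 =>
            (AddCircle.haarAddCircle : Measure UnitAddCircle)))
  refine (e3.mpr ?_).congr_fun ?_
  · convert! key using 1
    refine integral_congr_ae ?_
    filter_upwards [(hT hF).coeFn_toLp, (hT hG).coeFn_toLp] with t h1 h2
    rw [h1, h2]
    rfl
  · intro κ
    simp [finTwoArrowEquiv]

/-! ### Inequalities for series and convolutions -/

theorem summable_mul_of_sq {ι : Type*} {f g : ι → ℝ} (hf : Summable fun i => f i ^ 2)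
    (hg : Summable fun i => g i ^ 2) : Summable fun i => f i * g i := by
  refine Summable.of_norm_bounded (hf.add hg) fun i => ?_
  rw [Real.norm_eq_abs, abs_mul, ← sq_abs (f i), ← sq_abs (g i)]
  nlinarith [sq_nonneg (|f i| - |g i|), sq_nonneg (|f i|), sq_nonneg (|g i|)]

theorem tsum_mul_sq_le {ι : Type*} {f g : ι → ℝ} (hf : Summable fun i => f i ^ 2)
    (hg : Summable fun i => g i ^ 2) :
    (∑' i, f i * g i) ^ 2 ≤ (∑' i, f i ^ 2) * ∑' i, g i ^ 2 := by
  have h := (summable_mul_of_sq hf hg).hasSum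
  refine le_of_tendsto (h.pow 2) (Filter.Eventually.of_forall fun s => ?_)
  refine (Finset.sum_mul_sq_le_sq_mul_sq s f g).trans ?_
  exact mul_le_mul (hf.sum_le_tsum s fun i _ => sq_nonneg _)
    (hg.sum_le_tsum s fun i _ => sq_nonneg _) (Finset.sum_nonneg fun i _ => sq_nonneg _)
    (tsum_nonneg fun i => sq_nonneg _)

/-- The shear `(κ, j) ↦ (j, κ - j)`, which turns a double series into a series of convolutions. -/
def convEquiv (G : Type*) [AddCommGroup G] : G × G ≃ G × G where
  toFun x := (x.2, x.1 - x.2)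
  invFun x := (x.1 + x.2, x.1)
  left_inv x := by ext <;> simp
  right_inv x := by ext <;> simp

section Young

variable {G : Type*} [AddCommGroup G] {A B : G → ℝ}

theorem summable_conv_pair (hA : Summable A) (hA0 : ∀ j, 0 ≤ A j)
    (hB : Summable fun j => B j ^ 2) :
    Summable fun x : G × G => A x.2 * B (x.1 - x.2) ^ 2 :=
  (convEquiv G).summable_iff (f := fun x : G × G => A x.1 * B x.2 ^ 2) |>.mpr
    (hA.mul_of_nonneg hB hA0 fun _ => sq_nonneg _)

theorem summable_conv (hA : Summable A) (hA0 : ∀ j, 0 ≤ A j)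
    (hB : Summable fun j => B j ^ 2) (κ : G) : Summable fun j => A j * B (κ - j) := by
  refine Summable.of_norm_bounded (hA.add ((summable_conv_pair hA hA0 hB).prod_factor κ))
    fun j => ?_
  rw [Real.norm_eq_abs, abs_mul, abs_of_nonneg (hA0 j)]
  have := hA0 j
  have h2 : |B (κ - j)| ≤ 1 + B (κ - j) ^ 2 := by
    rw [← sq_abs]; nlinarith [sq_nonneg (|B (κ - j)| - 1), sq_nonneg (|B (κ - j)|)]
  calc A j * |B (κ - j)| ≤ A j * (1 + B (κ - j) ^ 2) := by gcongr
    _ = _ := by ring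

/-- The Cauchy–Schwarz inequality with respect to the weights `A j`. -/
theorem conv_sq_le (hA : Summable A) (hA0 : ∀ j, 0 ≤ A j)
    (hB : Summable fun j => B j ^ 2) (κ : G) :
    (∑' j, A j * B (κ - j)) ^ 2 ≤ (∑' j, A j) * ∑' j, A j * B (κ - j) ^ 2 := by
  have e1 : ∀ j, √(A j) ^ 2 = A j := fun j => Real.sq_sqrt (hA0 j)
  have e2 : ∀ j, (√(A j) * B (κ - j)) ^ 2 = A j * B (κ - j) ^ 2 := fun j => by
    rw [mul_pow, e1]
  have := tsum_mul_sq_le (f := fun j => √(A j)) (g := fun j => √(A j) * B (κ - j))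
    (by simpa only [e1] using hA)
    (by simpa only [e2] using (summable_conv_pair hA hA0 hB).prod_factor κ)
  simp only [e1, e2] at this
  convert! this using 2
  refine tsum_congr fun j => ?_
  rw [← mul_assoc, ← sq, e1]

theorem summable_conv_sq (hA : Summable A) (hA0 : ∀ j, 0 ≤ A j)
    (hB : Summable fun j => B j ^ 2) : Summable fun κ => (∑' j, A j * B (κ - j)) ^ 2 :=
  Summable.of_nonneg_of_le (fun _ => sq_nonneg _) (conv_sq_le hA hA0 hB)
    ((summable_conv_pair hA hA0 hB).prod.mul_left _)

/-- Young's inequality for the convolution of a summable and a square summable function. -/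
theorem tsum_conv_sq_le (hA : Summable A) (hA0 : ∀ j, 0 ≤ A j)
    (hB : Summable fun j => B j ^ 2) :
    ∑' κ, (∑' j, A j * B (κ - j)) ^ 2 ≤ (∑' j, A j) ^ 2 * ∑' j, B j ^ 2 := by
  have hp := summable_conv_pair hA hA0 hB
  refine ((summable_conv_sq hA hA0 hB).tsum_le_tsum (conv_sq_le hA hA0 hB)
    (hp.prod.mul_left _)).trans_eq ?_
  rw [tsum_mul_left, ← hp.tsum_prod,
    show ∑' p : G × G, A p.2 * B (p.1 - p.2) ^ 2 = ∑' x : G × G, A x.1 * B x.2 ^ 2 from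
      (convEquiv G).tsum_eq (fun x : G × G => A x.1 * B x.2 ^ 2), sq (∑' j, A j), mul_assoc,
    hA.tsum_mul_tsum hB (hA.mul_of_nonneg hB hA0 fun _ => sq_nonneg _)]

theorem tsum_conv_comm (A B : G → ℝ) (κ : G) :
    ∑' j, A j * B (κ - j) = ∑' j, B j * A (κ - j) := by
  rw [← (Equiv.subLeft κ).tsum_eq]
  refine tsum_congr fun j => ?_
  simp [mul_comm]

end Young

/-! ### Wave numbers -/

/-- The modulus of the wave vector `k_κ = (2πκ₁/L₁, 2πκ₂/L₂)`. -/
def waveNum (L₁ L₂ : ℝ) (κ : ℤ × ℤ) : ℝ := √(waveSq L₁ L₂ κ)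

/-- The cross product `k_j × k_l` of two wave vectors. -/
def waveCross (L₁ L₂ : ℝ) (j l : ℤ × ℤ) : ℝ :=
  (2 * Real.pi * j.1 / L₁) * (2 * Real.pi * l.2 / L₂) -
    (2 * Real.pi * j.2 / L₂) * (2 * Real.pi * l.1 / L₁)

section Wave

variable {L₁ L₂ : ℝ}

theorem waveSq_nonneg (κ : ℤ × ℤ) : 0 ≤ waveSq L₁ L₂ κ := by unfold waveSq; positivity

theorem waveNum_nonneg (κ : ℤ × ℤ) : 0 ≤ waveNum L₁ L₂ κ := Real.sqrt_nonneg _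

theorem waveNum_sq (κ : ℤ × ℤ) : waveNum L₁ L₂ κ ^ 2 = waveSq L₁ L₂ κ :=
  Real.sq_sqrt (waveSq_nonneg κ)

theorem waveNum_zero : waveNum L₁ L₂ 0 = 0 := by simp [waveNum, waveSq]

theorem waveNum_neg (κ : ℤ × ℤ) : waveNum L₁ L₂ (-κ) = waveNum L₁ L₂ κ := by
  simp only [waveNum, waveSq, Prod.fst_neg, Prod.snd_neg, Int.cast_neg]
  congr 1
  ring

theorem waveCross_neg_left (j l : ℤ × ℤ) :
    waveCross L₁ L₂ (-j) l = -waveCross L₁ L₂ j l := by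
  simp only [waveCross, Prod.fst_neg, Prod.snd_neg, Int.cast_neg]
  ring

theorem waveCross_sub_self (j κ : ℤ × ℤ) :
    waveCross L₁ L₂ j (κ - j) = waveCross L₁ L₂ j κ := by
  simp only [waveCross, Prod.fst_sub, Prod.snd_sub, Int.cast_sub]
  ring

theorem abs_waveCross_le (j l : ℤ × ℤ) :
    |waveCross L₁ L₂ j l| ≤ waveNum L₁ L₂ j * waveNum L₁ L₂ l := by
  refine abs_le_of_sq_le_sq ?_ (mul_nonneg (waveNum_nonneg _) (waveNum_nonneg _))
  rw [mul_pow, waveNum_sq, waveNum_sq]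
  unfold waveCross waveSq
  nlinarith [sq_nonneg ((2 * Real.pi * j.1 / L₁) * (2 * Real.pi * l.1 / L₁) +
    (2 * Real.pi * j.2 / L₂) * (2 * Real.pi * l.2 / L₂))]

theorem waveNum_add_le (j l : ℤ × ℤ) :
    waveNum L₁ L₂ (j + l) ≤ waveNum L₁ L₂ j + waveNum L₁ L₂ l := by
  have hj := waveNum_nonneg (L₁ := L₁) (L₂ := L₂) j
  have hl := waveNum_nonneg (L₁ := L₁) (L₂ := L₂) l
  refine le_of_sq_le_sq ?_ (add_nonneg hj hl)
  have h : (2 * Real.pi * j.1 / L₁) * (2 * Real.pi * l.1 / L₁) +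
      (2 * Real.pi * j.2 / L₂) * (2 * Real.pi * l.2 / L₂) ≤
        waveNum L₁ L₂ j * waveNum L₁ L₂ l := by
    refine le_of_sq_le_sq ?_ (mul_nonneg hj hl)
    rw [mul_pow, waveNum_sq, waveNum_sq]
    unfold waveSq
    nlinarith [sq_nonneg ((2 * Real.pi * j.1 / L₁) * (2 * Real.pi * l.2 / L₂) -
      (2 * Real.pi * j.2 / L₂) * (2 * Real.pi * l.1 / L₁))]
  rw [add_sq, waveNum_sq, waveNum_sq, waveNum_sq]
  have e : waveSq L₁ L₂ (j + l) = waveSq L₁ L₂ j + 2 * ((2 * Real.pi * j.1 / L₁) *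
      (2 * Real.pi * l.1 / L₁) + (2 * Real.pi * j.2 / L₂) * (2 * Real.pi * l.2 / L₂)) +
      waveSq L₁ L₂ l := by
    simp only [waveSq, Prod.fst_add, Prod.snd_add, Int.cast_add]
    ring
  rw [e]
  linarith

/-- The wave numbers grow linearly in `κ`; in particular, every nonzero one is at least
`2π / max L₁ L₂`. -/
theorem le_waveNum (hL₁ : 0 < L₁) (hL₂ : 0 < L₂) (κ : ℤ × ℤ) :
    2 * Real.pi / max L₁ L₂ * max |(κ.1 : ℝ)| |(κ.2 : ℝ)| ≤ waveNum L₁ L₂ κ := by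
  have hM : 0 < max L₁ L₂ := lt_max_of_lt_left hL₁
  have aux : ∀ {L : ℝ} (n : ℤ), 0 < L → L ≤ max L₁ L₂ → (2 * Real.pi * n / L) ^ 2 ≤
      waveSq L₁ L₂ κ → 2 * Real.pi / max L₁ L₂ * |(n : ℝ)| ≤ waveNum L₁ L₂ κ := by
    intro L n hL hLM h
    calc 2 * Real.pi / max L₁ L₂ * |(n : ℝ)| ≤ 2 * Real.pi / L * |(n : ℝ)| := by gcongr
      _ = |2 * Real.pi * n / L| := by
        rw [abs_div, abs_mul, abs_of_pos hL, abs_of_pos Real.two_pi_pos]; ring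
      _ ≤ _ := Real.abs_le_sqrt h
  rcases le_total |(κ.1 : ℝ)| |(κ.2 : ℝ)| with h | h
  · rw [max_eq_right h]
    exact aux _ hL₂ (le_max_right _ _)
      (by unfold waveSq; nlinarith [sq_nonneg (2 * Real.pi * κ.1 / L₁)])
  · rw [max_eq_left h]
    exact aux _ hL₁ (le_max_left _ _)
      (by unfold waveSq; nlinarith [sq_nonneg (2 * Real.pi * κ.2 / L₂)])

/-- The square root `max L₁ L₂ / 2π` of the Poincaré constant. -/
def poincareRoot (L₁ L₂ : ℝ) : ℝ := max L₁ L₂ / (2 * Real.pi)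

theorem poincareRoot_pos (hL₁ : 0 < L₁) : 0 < poincareRoot L₁ L₂ :=
  div_pos (lt_max_of_lt_left hL₁) Real.two_pi_pos

theorem one_le_poincareRoot_mul (hL₁ : 0 < L₁) (hL₂ : 0 < L₂) {κ : ℤ × ℤ} (hκ : κ ≠ 0) :
    1 ≤ poincareRoot L₁ L₂ * waveNum L₁ L₂ κ := by
  have hM : 0 < max L₁ L₂ := lt_max_of_lt_left hL₁
  have h1 : (1:ℝ) ≤ max |(κ.1 : ℝ)| |(κ.2 : ℝ)| := by
    have : κ.1 ≠ 0 ∨ κ.2 ≠ 0 := by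
      by_contra! h
      exact hκ (Prod.ext h.1 h.2)
    rcases this with h | h
    · exact le_max_of_le_left (by exact_mod_cast Int.one_le_abs h)
    · exact le_max_of_le_right (by exact_mod_cast Int.one_le_abs h)
  have h2 := le_waveNum hL₁ hL₂ κ
  have h3 : 2 * Real.pi / max L₁ L₂ ≤ waveNum L₁ L₂ κ :=
    le_trans (le_mul_of_one_le_right (by positivity) h1) h2
  calc (1:ℝ) = poincareRoot L₁ L₂ * (2 * Real.pi / max L₁ L₂) := by
        unfold poincareRoot; field_simp
    _ ≤ _ := by have := poincareRoot_pos (L₂ := L₂) hL₁; gcongr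

theorem waveNum_pos (hL₁ : 0 < L₁) (hL₂ : 0 < L₂) {κ : ℤ × ℤ} (hκ : κ ≠ 0) :
    0 < waveNum L₁ L₂ κ := by
  have h := one_le_poincareRoot_mul hL₁ hL₂ hκ
  have h0 := waveNum_nonneg (L₁ := L₁) (L₂ := L₂) κ
  rcases h0.eq_or_lt with h' | h'
  · rw [← h'] at h; norm_num at h
  · exact h'

theorem summable_waveNum_inv_cube (hL₁ : 0 < L₁) (hL₂ : 0 < L₂) :
    Summable fun κ : ℤ × ℤ => (waveNum L₁ L₂ κ ^ 3)⁻¹ := by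
  have h : Summable fun κ : ℤ × ℤ => (max |(κ.1 : ℝ)| |(κ.2 : ℝ)| ^ 3)⁻¹ := by
    have h := EisensteinSeries.summable_one_div_norm_rpow (k := 3) (by norm_num)
    refine ((finTwoArrowEquiv ℤ).symm.summable_iff.mpr h).congr fun κ => ?_
    have e : ‖(finTwoArrowEquiv ℤ).symm κ‖ = max |(κ.1 : ℝ)| |(κ.2 : ℝ)| := by
      rw [EisensteinSeries.norm_eq_max_natAbs]
      simp [finTwoArrowEquiv, Nat.cast_natAbs]
    simp only [Function.comp_apply, e]
    rw [Real.rpow_neg (le_max_of_le_left (abs_nonneg _))]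
    norm_cast
  have hM : 0 < max L₁ L₂ := lt_max_of_lt_left hL₁
  refine Summable.of_nonneg_of_le
    (fun κ => inv_nonneg.mpr (pow_nonneg (waveNum_nonneg κ) _)) (fun κ => ?_)
    (h.mul_left ((2 * Real.pi / max L₁ L₂) ^ 3)⁻¹)
  rcases eq_or_ne κ 0 with rfl | hκ
  · simp [waveNum_zero]
  · rw [← mul_inv, ← mul_pow]
    have h1 : (0:ℝ) < max |(κ.1 : ℝ)| |(κ.2 : ℝ)| := by
      by_contra! h
      have h1 := (abs_nonpos_iff.mp (le_trans (le_max_left _ _) h))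
      have h2 := (abs_nonpos_iff.mp (le_trans (le_max_right _ _) h))
      exact hκ (Prod.ext (by exact_mod_cast h1) (by exact_mod_cast h2))
    have := le_waveNum hL₁ hL₂ κ
    gcongr

end Wave

/-! ### Sobolev norms of coefficient sequences -/

/-- A sequence of coefficients on the dual lattice `ℤ²`. -/
abbrev Coeffs := ℤ × ℤ → ℂ

/-- The sequence `a` has a finite homogeneous norm of order `n / 2`. -/
def SobSummable (L₁ L₂ : ℝ) (n : ℕ) (a : Coeffs) : Prop :=
  Summable fun κ => waveNum L₁ L₂ κ ^ n * ‖a κ‖ ^ 2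

/-- The squared homogeneous norm `∑ |k_κ|ⁿ |a_κ|²`, of order `n / 2`. -/
def sobSq (L₁ L₂ : ℝ) (n : ℕ) (a : Coeffs) : ℝ := ∑' κ, waveNum L₁ L₂ κ ^ n * ‖a κ‖ ^ 2

/-- The sequence `a` has a finite norm of order `-1`. -/
def DualSummable (L₁ L₂ : ℝ) (a : Coeffs) : Prop :=
  Summable fun κ => (waveNum L₁ L₂ κ ^ 2)⁻¹ * ‖a κ‖ ^ 2

/-- The squared norm of order `-1`; the mode `κ = 0` does not contribute. -/
def dualSq (L₁ L₂ : ℝ) (a : Coeffs) : ℝ := ∑' κ, (waveNum L₁ L₂ κ ^ 2)⁻¹ * ‖a κ‖ ^ 2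

/-- The velocity with vorticity `a` has summable Fourier coefficients. -/
def VelSummable (L₁ L₂ : ℝ) (a : Coeffs) : Prop :=
  Summable fun κ => (waveNum L₁ L₂ κ)⁻¹ * ‖a κ‖

/-- The sum of the moduli of the Fourier coefficients of the velocity with vorticity `a`; it
bounds the maximum of the velocity. -/
def velNorm (L₁ L₂ : ℝ) (a : Coeffs) : ℝ := ∑' κ, (waveNum L₁ L₂ κ)⁻¹ * ‖a κ‖

/-- The sum of the moduli of the coefficients. -/
def absSum (a : Coeffs) : ℝ := ∑' κ, ‖a κ‖

/-- The square of the constant of the embeddings of `H^{1/2}` and `H^{3/2}` vorticities into the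
spaces of absolutely convergent Fourier series for velocity and vorticity. -/
def embConst (L₁ L₂ : ℝ) : ℝ := ∑' κ, (waveNum L₁ L₂ κ ^ 3)⁻¹

section Norms

variable {L₁ L₂ : ℝ} {n : ℕ} {a b : Coeffs}

theorem sobSq_nonneg : 0 ≤ sobSq L₁ L₂ n a :=
  tsum_nonneg fun κ => mul_nonneg (pow_nonneg (waveNum_nonneg κ) _) (sq_nonneg _)

theorem dualSq_nonneg : 0 ≤ dualSq L₁ L₂ a :=
  tsum_nonneg fun _ => mul_nonneg (inv_nonneg.mpr (sq_nonneg _)) (sq_nonneg _)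

theorem embConst_nonneg : 0 ≤ embConst L₁ L₂ :=
  tsum_nonneg fun κ => inv_nonneg.mpr (pow_nonneg (waveNum_nonneg κ) _)

theorem sq_norm_lin_le (r s : ℝ) (x y : ℂ) :
    ‖(r : ℂ) * x - (s : ℂ) * y‖ ^ 2 ≤ 2 * r ^ 2 * ‖x‖ ^ 2 + 2 * s ^ 2 * ‖y‖ ^ 2 := by
  have h := norm_sub_le ((r : ℂ) * x) ((s : ℂ) * y)
  rw [norm_mul, norm_mul, Complex.norm_real, Complex.norm_real, Real.norm_eq_abs,
    Real.norm_eq_abs] at h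
  calc _ ≤ (|r| * ‖x‖ + |s| * ‖y‖) ^ 2 := by gcongr
    _ ≤ 2 * |r| ^ 2 * ‖x‖ ^ 2 + 2 * |s| ^ 2 * ‖y‖ ^ 2 := by
      nlinarith [sq_nonneg (|r| * ‖x‖ - |s| * ‖y‖)]
    _ = _ := by rw [sq_abs, sq_abs]

theorem SobSummable.lin (ha : SobSummable L₁ L₂ n a) (hb : SobSummable L₁ L₂ n b) (r s : ℝ) :
    SobSummable L₁ L₂ n (fun κ => (r : ℂ) * a κ - (s : ℂ) * b κ) := by
  refine Summable.of_nonneg_of_le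
    (fun κ => mul_nonneg (pow_nonneg (waveNum_nonneg κ) _) (sq_nonneg _)) (fun κ => ?_)
    ((Summable.mul_left (2 * r ^ 2) ha).add (Summable.mul_left (2 * s ^ 2) hb))
  have := mul_le_mul_of_nonneg_left (sq_norm_lin_le r s (a κ) (b κ))
    (pow_nonneg (waveNum_nonneg (L₁ := L₁) (L₂ := L₂) κ) n)
  linarith

theorem sobSq_lin_le (ha : SobSummable L₁ L₂ n a) (hb : SobSummable L₁ L₂ n b) (r s : ℝ) :
    sobSq L₁ L₂ n (fun κ => (r : ℂ) * a κ - (s : ℂ) * b κ) ≤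
      2 * r ^ 2 * sobSq L₁ L₂ n a + 2 * s ^ 2 * sobSq L₁ L₂ n b := by
  refine hasSum_le (fun κ => ?_) (ha.lin hb r s).hasSum
    ((ha.hasSum.mul_left (2 * r ^ 2)).add (hb.hasSum.mul_left (2 * s ^ 2)))
  have := mul_le_mul_of_nonneg_left (sq_norm_lin_le r s (a κ) (b κ))
    (pow_nonneg (waveNum_nonneg (L₁ := L₁) (L₂ := L₂) κ) n)
  linarith

/-- Interpolation between neighbouring norms. -/
theorem sobSq_succ_le {ε : ℝ} (hε : 0 < ε) (h0 : SobSummable L₁ L₂ n a)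
    (h2 : SobSummable L₁ L₂ (n + 2) a) :
    SobSummable L₁ L₂ (n + 1) a ∧
      sobSq L₁ L₂ (n + 1) a ≤ ε⁻¹ * sobSq L₁ L₂ n a + ε * sobSq L₁ L₂ (n + 2) a := by
  have key : ∀ κ, waveNum L₁ L₂ κ ^ (n + 1) * ‖a κ‖ ^ 2 ≤
      ε⁻¹ * (waveNum L₁ L₂ κ ^ n * ‖a κ‖ ^ 2) + ε * (waveNum L₁ L₂ κ ^ (n + 2) * ‖a κ‖ ^ 2) := by
    intro κ
    have hm := waveNum_nonneg (L₁ := L₁) (L₂ := L₂) κ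
    have h1 : waveNum L₁ L₂ κ ≤ ε⁻¹ + ε * waveNum L₁ L₂ κ ^ 2 := by
      have : ε * ε⁻¹ = 1 := mul_inv_cancel₀ hε.ne'
      have hi := inv_pos.mpr hε
      nlinarith [sq_nonneg (ε * waveNum L₁ L₂ κ - 1),
        mul_nonneg hi.le (sq_nonneg (ε * waveNum L₁ L₂ κ - 1))]
    have h2 : 0 ≤ waveNum L₁ L₂ κ ^ n * ‖a κ‖ ^ 2 := by positivity
    calc _ = waveNum L₁ L₂ κ * (waveNum L₁ L₂ κ ^ n * ‖a κ‖ ^ 2) := by ring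
      _ ≤ (ε⁻¹ + ε * waveNum L₁ L₂ κ ^ 2) * (waveNum L₁ L₂ κ ^ n * ‖a κ‖ ^ 2) := by gcongr
      _ = _ := by ring
  have hs := (Summable.mul_left ε⁻¹ h0).add (Summable.mul_left ε h2)
  have h1 : SobSummable L₁ L₂ (n + 1) a := Summable.of_nonneg_of_le
    (fun κ => mul_nonneg (pow_nonneg (waveNum_nonneg κ) _) (sq_nonneg _)) key hs
  exact ⟨h1, hasSum_le key h1.hasSum ((h0.hasSum.mul_left ε⁻¹).add (h2.hasSum.mul_left ε))⟩

variable (hL₁ : 0 < L₁) (hL₂ : 0 < L₂)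
include hL₁ hL₂

theorem sob_mode_le (ha0 : a 0 = 0) (κ : ℤ × ℤ) : waveNum L₁ L₂ κ ^ n * ‖a κ‖ ^ 2 ≤
    poincareRoot L₁ L₂ * (waveNum L₁ L₂ κ ^ (n + 1) * ‖a κ‖ ^ 2) := by
  rcases eq_or_ne κ 0 with rfl | hκ
  · simp [ha0]
  · have h := one_le_poincareRoot_mul hL₁ hL₂ hκ
    have h2 : 0 ≤ waveNum L₁ L₂ κ ^ n * ‖a κ‖ ^ 2 :=
      mul_nonneg (pow_nonneg (waveNum_nonneg κ) _) (sq_nonneg _)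
    have := mul_le_mul_of_nonneg_right h h2
    rw [one_mul] at this
    refine this.trans_eq ?_
    ring

theorem SobSummable.of_succ (ha0 : a 0 = 0) (h : SobSummable L₁ L₂ (n + 1) a) :
    SobSummable L₁ L₂ n a :=
  Summable.of_nonneg_of_le
    (fun κ => mul_nonneg (pow_nonneg (waveNum_nonneg κ) _) (sq_nonneg _))
    (sob_mode_le hL₁ hL₂ ha0) (Summable.mul_left _ h)

/-- Poincaré's inequality. -/
theorem sobSq_le_succ (ha0 : a 0 = 0) (h : SobSummable L₁ L₂ (n + 1) a) :
    sobSq L₁ L₂ n a ≤ poincareRoot L₁ L₂ * sobSq L₁ L₂ (n + 1) a :=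
  hasSum_le (sob_mode_le hL₁ hL₂ ha0) (h.of_succ hL₁ hL₂ ha0).hasSum (h.hasSum.mul_left _)

theorem sob_zero_mode_le (ha0 : a 0 = 0) (κ : ℤ × ℤ) : (waveNum L₁ L₂ κ ^ 2)⁻¹ * ‖a κ‖ ^ 2 ≤
    poincareRoot L₁ L₂ ^ 2 * (waveNum L₁ L₂ κ ^ 0 * ‖a κ‖ ^ 2) := by
  rcases eq_or_ne κ 0 with rfl | hκ
  · simp [ha0]
  · have h := one_le_poincareRoot_mul hL₁ hL₂ hκ
    have hm := waveNum_pos hL₁ hL₂ hκ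
    have : (waveNum L₁ L₂ κ ^ 2)⁻¹ ≤ poincareRoot L₁ L₂ ^ 2 := by
      rw [inv_le_iff_one_le_mul₀ (by positivity), ← mul_pow]
      exact one_le_pow₀ h
    rw [pow_zero, one_mul]
    gcongr

theorem SobSummable.dual (ha0 : a 0 = 0) (h : SobSummable L₁ L₂ 0 a) : DualSummable L₁ L₂ a :=
  Summable.of_nonneg_of_le
    (fun _ => mul_nonneg (inv_nonneg.mpr (sq_nonneg _)) (sq_nonneg _))
    (sob_zero_mode_le hL₁ hL₂ ha0) (Summable.mul_left _ h)

theorem dualSq_le (ha0 : a 0 = 0) (h : SobSummable L₁ L₂ 0 a) :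
    dualSq L₁ L₂ a ≤ poincareRoot L₁ L₂ ^ 2 * sobSq L₁ L₂ 0 a :=
  hasSum_le (sob_zero_mode_le hL₁ hL₂ ha0) (h.dual hL₁ hL₂ ha0).hasSum (h.hasSum.mul_left _)

/-- Vorticities in `H^{1/2}` have velocities with absolutely convergent Fourier series. -/
theorem velNorm_sq_le (h : SobSummable L₁ L₂ 1 a) : VelSummable L₁ L₂ a ∧
    velNorm L₁ L₂ a ^ 2 ≤ embConst L₁ L₂ * sobSq L₁ L₂ 1 a := by
  have e0 : ∀ κ, √((waveNum L₁ L₂ κ ^ 3)⁻¹) ^ 2 = (waveNum L₁ L₂ κ ^ 3)⁻¹ := fun κ =>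
    Real.sq_sqrt (inv_nonneg.mpr (pow_nonneg (waveNum_nonneg κ) _))
  have e1 : ∀ κ, (√(waveNum L₁ L₂ κ) * ‖a κ‖) ^ 2 = waveNum L₁ L₂ κ ^ 1 * ‖a κ‖ ^ 2 := fun κ => by
    rw [mul_pow, Real.sq_sqrt (waveNum_nonneg κ), pow_one]
  have e2 : ∀ κ, √((waveNum L₁ L₂ κ ^ 3)⁻¹) * (√(waveNum L₁ L₂ κ) * ‖a κ‖) =
      (waveNum L₁ L₂ κ)⁻¹ * ‖a κ‖ := fun κ => by
    rcases eq_or_ne κ 0 with rfl | hκ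
    · simp [waveNum_zero]
    · have hm := waveNum_pos hL₁ hL₂ hκ
      rw [← mul_assoc, ← Real.sqrt_mul (by positivity),
        show (waveNum L₁ L₂ κ ^ 3)⁻¹ * waveNum L₁ L₂ κ = ((waveNum L₁ L₂ κ)⁻¹) ^ 2 by field_simp,
        Real.sqrt_sq (by positivity)]
  have hs := summable_waveNum_inv_cube hL₁ hL₂
  have h1 := summable_mul_of_sq (f := fun κ => √((waveNum L₁ L₂ κ ^ 3)⁻¹))
    (g := fun κ => √(waveNum L₁ L₂ κ) * ‖a κ‖) (by simpa only [e0] using hs)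
    (by simp only [e1]; exact h)
  have h2 := tsum_mul_sq_le (f := fun κ => √((waveNum L₁ L₂ κ ^ 3)⁻¹))
    (g := fun κ => √(waveNum L₁ L₂ κ) * ‖a κ‖) (by simpa only [e0] using hs)
    (by simp only [e1]; exact h)
  simp only [e0, e1, e2] at h1 h2
  exact ⟨h1, h2⟩

/-- Vorticities in `H^{3/2}` have absolutely convergent Fourier series. -/
theorem absSum_sq_le (ha0 : a 0 = 0) (h : SobSummable L₁ L₂ 3 a) : (Summable fun κ => ‖a κ‖) ∧
    absSum a ^ 2 ≤ embConst L₁ L₂ * sobSq L₁ L₂ 3 a := by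
  have e0 : ∀ κ, (waveNum L₁ L₂ κ * ‖a κ‖) ^ 2 = waveNum L₁ L₂ κ ^ 2 * ‖a κ‖ ^ 2 :=
    fun κ => mul_pow _ _ _
  have e1 : ∀ κ, waveNum L₁ L₂ κ ^ 1 * ‖(waveNum L₁ L₂ κ : ℂ) * a κ‖ ^ 2 =
      waveNum L₁ L₂ κ ^ 3 * ‖a κ‖ ^ 2 := fun κ => by
    rw [norm_mul, Complex.norm_real, Real.norm_eq_abs, abs_of_nonneg (waveNum_nonneg κ)]; ring
  have e2 : ∀ κ, (waveNum L₁ L₂ κ)⁻¹ * ‖(waveNum L₁ L₂ κ : ℂ) * a κ‖ = ‖a κ‖ := fun κ => by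
    rcases eq_or_ne κ 0 with rfl | hκ
    · simp [ha0]
    · have hm := waveNum_pos hL₁ hL₂ hκ
      rw [norm_mul, Complex.norm_real, Real.norm_eq_abs, abs_of_nonneg (waveNum_nonneg κ),
        inv_mul_cancel_left₀ hm.ne']
  have := velNorm_sq_le hL₁ hL₂ (a := fun κ => (waveNum L₁ L₂ κ : ℂ) * a κ)
    (by unfold SobSummable; simp only [e1]; exact h)
  unfold VelSummable velNorm sobSq at this
  simp only [e1, e2] at this
  exact this

end Norms

/-! ### The Jacobian in Fourier space -/

/-- The Fourier coefficients of the Jacobian `∂(Δ⁻¹u, v)`, where `u` and `v` are given by their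
Fourier coefficients. -/
def jac (L₁ L₂ : ℝ) (u v : Coeffs) (κ : ℤ × ℤ) : ℂ :=
  ∑' j, ((waveCross L₁ L₂ j κ / waveNum L₁ L₂ j ^ 2 : ℝ) : ℂ) * u j * v (κ - j)

section Jac

variable {L₁ L₂ : ℝ} {u v : Coeffs}

theorem waveCross_div_le (j κ : ℤ × ℤ) :
    |waveCross L₁ L₂ j κ / waveNum L₁ L₂ j ^ 2| ≤ (waveNum L₁ L₂ j)⁻¹ * waveNum L₁ L₂ κ := by
  have hj := waveNum_nonneg (L₁ := L₁) (L₂ := L₂) j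
  rw [abs_div, abs_of_nonneg (sq_nonneg (waveNum L₁ L₂ j))]
  calc _ ≤ waveNum L₁ L₂ j * waveNum L₁ L₂ κ / waveNum L₁ L₂ j ^ 2 := by
        gcongr; exact abs_waveCross_le j κ
    _ = _ := by
      rcases hj.eq_or_lt with h | h
      · simp [← h]
      · field_simp

/-- A derivative in the Jacobian may be put on the product. -/
theorem norm_jac_term_le (κ j : ℤ × ℤ) :
    ‖((waveCross L₁ L₂ j κ / waveNum L₁ L₂ j ^ 2 : ℝ) : ℂ) * u j * v (κ - j)‖ ≤
      waveNum L₁ L₂ κ * ((waveNum L₁ L₂ j)⁻¹ * ‖u j‖ * ‖v (κ - j)‖) := by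
  rw [norm_mul, norm_mul, Complex.norm_real, Real.norm_eq_abs]
  calc _ ≤ (waveNum L₁ L₂ j)⁻¹ * waveNum L₁ L₂ κ * ‖u j‖ * ‖v (κ - j)‖ := by
        gcongr; exact waveCross_div_le j κ
    _ = _ := by ring

/-- A derivative in the Jacobian may be put on the advected factor. -/
theorem norm_jac_term_le' (κ j : ℤ × ℤ) :
    ‖((waveCross L₁ L₂ j κ / waveNum L₁ L₂ j ^ 2 : ℝ) : ℂ) * u j * v (κ - j)‖ ≤
      (waveNum L₁ L₂ j)⁻¹ * ‖u j‖ * (waveNum L₁ L₂ (κ - j) * ‖v (κ - j)‖) := by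
  rw [norm_mul, norm_mul, Complex.norm_real, Real.norm_eq_abs, ← waveCross_sub_self]
  calc _ ≤ (waveNum L₁ L₂ j)⁻¹ * waveNum L₁ L₂ (κ - j) * ‖u j‖ * ‖v (κ - j)‖ := by
        gcongr; exact waveCross_div_le j _
    _ = _ := by ring

theorem vel_nonneg (u : Coeffs) (j : ℤ × ℤ) : 0 ≤ (waveNum L₁ L₂ j)⁻¹ * ‖u j‖ :=
  mul_nonneg (inv_nonneg.mpr (waveNum_nonneg j)) (norm_nonneg _)

theorem SobSummable.sq_zero (hv : SobSummable L₁ L₂ 0 v) : Summable fun κ => ‖v κ‖ ^ 2 :=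
  Summable.congr hv fun κ => by simp

theorem SobSummable.sq_two (hv : SobSummable L₁ L₂ 2 v) :
    Summable fun κ => (waveNum L₁ L₂ κ * ‖v κ‖) ^ 2 :=
  Summable.congr hv fun κ => by ring

theorem DualSummable.sq (hv : DualSummable L₁ L₂ v) :
    Summable fun κ => ((waveNum L₁ L₂ κ)⁻¹ * ‖v κ‖) ^ 2 :=
  Summable.congr hv fun κ => by ring

theorem summable_jac_term (hu : VelSummable L₁ L₂ u) (hv : SobSummable L₁ L₂ 0 v) (κ : ℤ × ℤ) :
    Summable fun j => ((waveCross L₁ L₂ j κ / waveNum L₁ L₂ j ^ 2 : ℝ) : ℂ) * u j * v (κ - j) :=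
  Summable.of_norm_bounded ((summable_conv hu (vel_nonneg u) hv.sq_zero κ).mul_left _)
    (norm_jac_term_le κ)

theorem norm_jac_le (hu : VelSummable L₁ L₂ u) (hv : SobSummable L₁ L₂ 0 v) (κ : ℤ × ℤ) :
    ‖jac L₁ L₂ u v κ‖ ≤
      waveNum L₁ L₂ κ * ∑' j, (waveNum L₁ L₂ j)⁻¹ * ‖u j‖ * ‖v (κ - j)‖ := by
  rw [← tsum_mul_left]
  exact tsum_of_norm_bounded
    ((summable_conv hu (vel_nonneg u) hv.sq_zero κ).mul_left _).hasSum (norm_jac_term_le κ)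

theorem norm_jac_le' (hu : VelSummable L₁ L₂ u) (hv : SobSummable L₁ L₂ 2 v) (κ : ℤ × ℤ) :
    ‖jac L₁ L₂ u v κ‖ ≤
      ∑' j, (waveNum L₁ L₂ j)⁻¹ * ‖u j‖ * (waveNum L₁ L₂ (κ - j) * ‖v (κ - j)‖) :=
  tsum_of_norm_bounded (summable_conv hu (vel_nonneg u) hv.sq_two κ).hasSum (norm_jac_term_le' κ)

theorem inv_sq_mul_le {m x y : ℝ} (hm : 0 ≤ m) (hx : 0 ≤ x) (h : x ≤ m * y) :
    (m ^ 2)⁻¹ * x ^ 2 ≤ y ^ 2 := by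
  rcases hm.eq_or_lt with h0 | h0
  · simp [← h0, sq_nonneg]
  · rw [inv_mul_le_iff₀ (by positivity), ← mul_pow]
    gcongr

/-- The Jacobian in `H⁻¹`: it is the divergence of velocity times vorticity. -/
theorem jac_dual_le (hu : VelSummable L₁ L₂ u) (hv : SobSummable L₁ L₂ 0 v) :
    DualSummable L₁ L₂ (jac L₁ L₂ u v) ∧
      dualSq L₁ L₂ (jac L₁ L₂ u v) ≤ velNorm L₁ L₂ u ^ 2 * sobSq L₁ L₂ 0 v := by
  have key : ∀ κ, (waveNum L₁ L₂ κ ^ 2)⁻¹ * ‖jac L₁ L₂ u v κ‖ ^ 2 ≤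
      (∑' j, (waveNum L₁ L₂ j)⁻¹ * ‖u j‖ * ‖v (κ - j)‖) ^ 2 := fun κ =>
    inv_sq_mul_le (waveNum_nonneg κ) (norm_nonneg _) (norm_jac_le hu hv κ)
  have hs := summable_conv_sq hu (vel_nonneg u) hv.sq_zero
  have h1 : DualSummable L₁ L₂ (jac L₁ L₂ u v) := Summable.of_nonneg_of_le
    (fun _ => mul_nonneg (inv_nonneg.mpr (sq_nonneg _)) (sq_nonneg _)) key hs
  refine ⟨h1, (Summable.tsum_le_tsum key h1 hs).trans
    ((tsum_conv_sq_le hu (vel_nonneg u) hv.sq_zero).trans_eq ?_)⟩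
  simp [velNorm, sobSq]

/-- The Jacobian in `H⁻¹`, with the roles of the factors in the product estimate exchanged. -/
theorem jac_dual_le' (hu : VelSummable L₁ L₂ u) (hu' : DualSummable L₁ L₂ u)
    (hv : SobSummable L₁ L₂ 0 v) (hv' : Summable fun κ => ‖v κ‖) :
    dualSq L₁ L₂ (jac L₁ L₂ u v) ≤ absSum v ^ 2 * dualSq L₁ L₂ u := by
  have key : ∀ κ, (waveNum L₁ L₂ κ ^ 2)⁻¹ * ‖jac L₁ L₂ u v κ‖ ^ 2 ≤
      (∑' j, ‖v j‖ * ((waveNum L₁ L₂ (κ - j))⁻¹ * ‖u (κ - j)‖)) ^ 2 := fun κ => by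
    refine inv_sq_mul_le (waveNum_nonneg κ) (norm_nonneg _) ((norm_jac_le hu hv κ).trans_eq ?_)
    rw [tsum_conv_comm (fun j => ‖v j‖) (fun j => (waveNum L₁ L₂ j)⁻¹ * ‖u j‖)]
  have hs := summable_conv_sq hv' (fun _ => norm_nonneg _) hu'.sq
  refine (Summable.tsum_le_tsum key (jac_dual_le hu hv).1 hs).trans
    ((tsum_conv_sq_le hv' (fun _ => norm_nonneg _) hu'.sq).trans_eq ?_)
  simp [absSum, dualSq, mul_pow]

theorem jac_sob_zero_le (hu : VelSummable L₁ L₂ u) (hv : SobSummable L₁ L₂ 2 v) :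
    SobSummable L₁ L₂ 0 (jac L₁ L₂ u v) ∧
      sobSq L₁ L₂ 0 (jac L₁ L₂ u v) ≤ velNorm L₁ L₂ u ^ 2 * sobSq L₁ L₂ 2 v := by
  have key : ∀ κ, waveNum L₁ L₂ κ ^ 0 * ‖jac L₁ L₂ u v κ‖ ^ 2 ≤
      (∑' j, (waveNum L₁ L₂ j)⁻¹ * ‖u j‖ * (waveNum L₁ L₂ (κ - j) * ‖v (κ - j)‖)) ^ 2 := fun κ => by
    rw [pow_zero, one_mul]
    exact pow_le_pow_left₀ (norm_nonneg _) (norm_jac_le' hu hv κ) 2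
  have hs := summable_conv_sq hu (vel_nonneg u) hv.sq_two
  have h1 : SobSummable L₁ L₂ 0 (jac L₁ L₂ u v) := Summable.of_nonneg_of_le
    (fun κ => mul_nonneg (pow_nonneg (waveNum_nonneg κ) _) (sq_nonneg _)) key hs
  refine ⟨h1, (Summable.tsum_le_tsum key h1 hs).trans
    ((tsum_conv_sq_le hu (vel_nonneg u) hv.sq_two).trans_eq ?_)⟩
  simp [velNorm, sobSq, mul_pow]

/-- The Jacobian in `H¹`: the derivative falls either on the velocity or on the gradient of the
advected factor. -/
theorem jac_sob_two_le (hL₁ : 0 < L₁) (hL₂ : 0 < L₂) (hu : VelSummable L₁ L₂ u)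
    (hu' : Summable fun κ => ‖u κ‖)
    (hv : SobSummable L₁ L₂ 2 v) (hv' : SobSummable L₁ L₂ 4 v) (hu0 : u 0 = 0) :
    SobSummable L₁ L₂ 2 (jac L₁ L₂ u v) ∧ sobSq L₁ L₂ 2 (jac L₁ L₂ u v) ≤
      2 * (absSum u ^ 2 * sobSq L₁ L₂ 2 v + velNorm L₁ L₂ u ^ 2 * sobSq L₁ L₂ 4 v) := by
  have hv4 : Summable fun κ => (waveNum L₁ L₂ κ ^ 2 * ‖v κ‖) ^ 2 :=
    Summable.congr hv' fun κ => by ring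
  have key1 : ∀ κ, waveNum L₁ L₂ κ * ‖jac L₁ L₂ u v κ‖ ≤
      (∑' j, ‖u j‖ * (waveNum L₁ L₂ (κ - j) * ‖v (κ - j)‖)) +
      ∑' j, (waveNum L₁ L₂ j)⁻¹ * ‖u j‖ * (waveNum L₁ L₂ (κ - j) ^ 2 * ‖v (κ - j)‖) := fun κ => by
    have s1 := summable_conv hu' (fun _ => norm_nonneg _) hv.sq_two κ
    have s2 := summable_conv hu (vel_nonneg u) hv4 κ
    have s3 := (summable_conv hu (vel_nonneg u) hv.sq_two κ)
    refine (mul_le_mul_of_nonneg_left (norm_jac_le' hu hv κ) (waveNum_nonneg κ)).trans ?_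
    rw [← tsum_mul_left, ← s1.tsum_add s2]
    refine (s3.mul_left _).tsum_le_tsum (fun j => ?_) (s1.add s2)
    have hj := waveNum_nonneg (L₁ := L₁) (L₂ := L₂) j
    have hl := waveNum_nonneg (L₁ := L₁) (L₂ := L₂) (κ - j)
    have h := waveNum_add_le (L₁ := L₁) (L₂ := L₂) j (κ - j)
    rw [add_sub_cancel] at h
    have hc : waveNum L₁ L₂ j * ((waveNum L₁ L₂ j)⁻¹ * ‖u j‖) = ‖u j‖ := by
      rcases eq_or_ne j 0 with rfl | hj0
      · simp [hu0]
      · rw [mul_inv_cancel_left₀ (waveNum_pos hL₁ hL₂ hj0).ne']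
    calc _ ≤ (waveNum L₁ L₂ j + waveNum L₁ L₂ (κ - j)) *
          ((waveNum L₁ L₂ j)⁻¹ * ‖u j‖ * (waveNum L₁ L₂ (κ - j) * ‖v (κ - j)‖)) := by gcongr
      _ = (waveNum L₁ L₂ j * ((waveNum L₁ L₂ j)⁻¹ * ‖u j‖)) *
          (waveNum L₁ L₂ (κ - j) * ‖v (κ - j)‖) + (waveNum L₁ L₂ j)⁻¹ * ‖u j‖ *
            (waveNum L₁ L₂ (κ - j) ^ 2 * ‖v (κ - j)‖) := by ring
      _ = _ := by rw [hc]
  have key : ∀ κ, waveNum L₁ L₂ κ ^ 2 * ‖jac L₁ L₂ u v κ‖ ^ 2 ≤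
      2 * ((∑' j, ‖u j‖ * (waveNum L₁ L₂ (κ - j) * ‖v (κ - j)‖)) ^ 2 +
      (∑' j, (waveNum L₁ L₂ j)⁻¹ * ‖u j‖ *
        (waveNum L₁ L₂ (κ - j) ^ 2 * ‖v (κ - j)‖)) ^ 2) := fun κ => by
    rw [← mul_pow]
    exact (pow_le_pow_left₀ (mul_nonneg (waveNum_nonneg κ) (norm_nonneg _)) (key1 κ) 2).trans
      add_sq_le
  have t1 := summable_conv_sq hu' (fun _ => norm_nonneg _) hv.sq_two
  have t2 := summable_conv_sq hu (vel_nonneg u) hv4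
  have h1 : SobSummable L₁ L₂ 2 (jac L₁ L₂ u v) := Summable.of_nonneg_of_le
    (fun κ => mul_nonneg (pow_nonneg (waveNum_nonneg κ) _) (sq_nonneg _)) key
    ((t1.add t2).mul_left 2)
  refine ⟨h1, (hasSum_le key h1.hasSum ((t1.hasSum.add t2.hasSum).mul_left 2)).trans ?_⟩
  refine mul_le_mul_of_nonneg_left (add_le_add
    ((tsum_conv_sq_le hu' (fun _ => norm_nonneg _) hv.sq_two).trans_eq ?_)
    ((tsum_conv_sq_le hu (vel_nonneg u) hv4).trans_eq ?_)) zero_le_two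
  · simp [absSum, sobSq, mul_pow]
  · simp only [velNorm, sobSq, mul_pow, ← pow_mul]

theorem jac_lin_right (hu : VelSummable L₁ L₂ u) {v' : Coeffs} (hv : SobSummable L₁ L₂ 0 v)
    (hv' : SobSummable L₁ L₂ 0 v') (κ : ℤ × ℤ) :
    jac L₁ L₂ u (fun l => v l - v' l) κ = jac L₁ L₂ u v κ - jac L₁ L₂ u v' κ := by
  unfold jac
  rw [← (summable_jac_term hu hv κ).tsum_sub (summable_jac_term hu hv' κ)]
  exact tsum_congr fun j => by ring

theorem jac_lin_left (hu : VelSummable L₁ L₂ u) {u' : Coeffs} (hu' : VelSummable L₁ L₂ u')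
    (hv : SobSummable L₁ L₂ 0 v) (κ : ℤ × ℤ) :
    jac L₁ L₂ (fun l => u l - u' l) v κ = jac L₁ L₂ u v κ - jac L₁ L₂ u' v κ := by
  unfold jac
  rw [← (summable_jac_term hu hv κ).tsum_sub (summable_jac_term hu' hv κ)]
  exact tsum_congr fun j => by ring

/-- The Jacobian is antisymmetric in its second argument and the test function: this expresses
that advection by a divergence-free velocity conserves the `L²` norm. The second argument need
only be in `L²` if the test function is in `H¹`. -/
theorem jac_antisymm {z p q : Coeffs} (hz : VelSummable L₁ L₂ z)
    (hzr : ∀ κ, z (-κ) = (starRingEnd ℂ) (z κ)) (hp : SobSummable L₁ L₂ 2 p)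
    (hq : SobSummable L₁ L₂ 0 q) :
    (Summable fun κ => (jac L₁ L₂ z q κ * (starRingEnd ℂ) (p κ)).re) ∧
    (Summable fun κ => (jac L₁ L₂ z p κ * (starRingEnd ℂ) (q κ)).re) ∧
    ∑' κ, (jac L₁ L₂ z q κ * (starRingEnd ℂ) (p κ)).re =
      -∑' κ, (jac L₁ L₂ z p κ * (starRingEnd ℂ) (q κ)).re := by
  set T : (ℤ × ℤ) × (ℤ × ℤ) → ℂ := fun x =>
    ((waveCross L₁ L₂ x.2 x.1 / waveNum L₁ L₂ x.2 ^ 2 : ℝ) : ℂ) * z x.2 * q (x.1 - x.2) *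
      (starRingEnd ℂ) (p x.1) with hT
  -- The terms `T` of one trilinear form are, up to sign and conjugation, those of the other one
  -- after the involution `(κ, j) ↦ (κ - j, -j)`, since `k_j × k_κ = k_j × k_{κ - j}`.
  set σ : (ℤ × ℤ) × (ℤ × ℤ) ≃ (ℤ × ℤ) × (ℤ × ℤ) :=
    { toFun := fun x => (x.1 - x.2, -x.2)
      invFun := fun x => (x.1 - x.2, -x.2)
      left_inv := fun x => by ext <;> simp
      right_inv := fun x => by ext <;> simp } with hσ
  have hTs : Summable T := by
    refine Summable.of_norm_bounded ((summable_conv_pair hz (vel_nonneg z) hq.sq_zero).add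
      ((Summable.mul_of_nonneg hp.sq_two hz (fun _ => sq_nonneg _) (vel_nonneg z)))) fun x => ?_
    rw [hT, norm_mul, RCLike.norm_conj]
    refine (mul_le_mul_of_nonneg_right (norm_jac_term_le x.1 x.2) (norm_nonneg _)).trans ?_
    have h0 := vel_nonneg (L₁ := L₁) (L₂ := L₂) z x.2
    calc _ = (waveNum L₁ L₂ x.2)⁻¹ * ‖z x.2‖ *
          (‖q (x.1 - x.2)‖ * (waveNum L₁ L₂ x.1 * ‖p x.1‖)) := by ring
      _ ≤ (waveNum L₁ L₂ x.2)⁻¹ * ‖z x.2‖ *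
          (‖q (x.1 - x.2)‖ ^ 2 + (waveNum L₁ L₂ x.1 * ‖p x.1‖) ^ 2) := by
        gcongr
        nlinarith [sq_nonneg (‖q (x.1 - x.2)‖ - waveNum L₁ L₂ x.1 * ‖p x.1‖),
          sq_nonneg ‖q (x.1 - x.2)‖, sq_nonneg (waveNum L₁ L₂ x.1 * ‖p x.1‖)]
      _ = _ := by ring
  have hσT : ∀ x, -(starRingEnd ℂ) (T (σ x)) =
      ((waveCross L₁ L₂ x.2 x.1 / waveNum L₁ L₂ x.2 ^ 2 : ℝ) : ℂ) * z x.2 * p (x.1 - x.2) *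
      (starRingEnd ℂ) (q x.1) := by
    intro x
    have e1 : waveCross L₁ L₂ (-x.2) (x.1 - x.2) = -waveCross L₁ L₂ x.2 x.1 := by
      rw [waveCross_neg_left, waveCross_sub_self]
    simp only [hT, hσ, Equiv.coe_fn_mk, e1, waveNum_neg, hzr, sub_neg_eq_add, sub_add_cancel,
      map_mul, Complex.conj_conj, Complex.conj_ofReal]
    push_cast
    ring
  have hS : Summable fun x => -(starRingEnd ℂ) (T (σ x)) :=
    ((Complex.conjCLE.summable (f := fun x => T (σ x))).mpr (σ.summable_iff.mpr hTs)).neg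
  have r1 : ∀ κ, ∑' j, T (κ, j) = jac L₁ L₂ z q κ * (starRingEnd ℂ) (p κ) := fun κ => by
    simp only [hT, jac, tsum_mul_right]
  have r2 : ∀ κ, ∑' j, -(starRingEnd ℂ) (T (σ (κ, j))) =
      jac L₁ L₂ z p κ * (starRingEnd ℂ) (q κ) := fun κ => by
    simp only [hσT, jac, tsum_mul_right]
  have s1 : Summable fun κ => jac L₁ L₂ z q κ * (starRingEnd ℂ) (p κ) := by
    simpa only [r1] using hTs.prod
  have s2 : Summable fun κ => jac L₁ L₂ z p κ * (starRingEnd ℂ) (q κ) := by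
    simpa only [r2] using hS.prod
  refine ⟨(Complex.hasSum_re s1.hasSum).summable, (Complex.hasSum_re s2.hasSum).summable, ?_⟩
  rw [← Complex.re_tsum s1, ← Complex.re_tsum s2]
  simp only [← r1, ← r2]
  rw [← hTs.tsum_prod, ← hS.tsum_prod, tsum_neg, Complex.neg_re, neg_neg, ← Complex.conj_tsum,
    Complex.conj_re, σ.tsum_eq T]

end Jac

/-! ### Estimates for one time step -/

/-- The extrapolation `2v - u`. -/
def extrap (u v : Coeffs) : Coeffs := fun κ => 2 * v κ - u κ

/-- The squared `G`-norm of order `n / 2`. With the parallelogram identity, it is written as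
`(|v|² + |2v - u|²) / 2 + a |v|² / 2`, which shows that it is positive. -/
def bdfEnergy (L₁ L₂ : ℝ) (n : ℕ) (a : ℝ) (u v : Coeffs) : ℝ :=
  (sobSq L₁ L₂ n v + sobSq L₁ L₂ n (extrap u v)) / 2 + a / 2 * sobSq L₁ L₂ n v

/-- One step of the scheme in Fourier space, with advection term `β` and forcing `h`. -/
def IsStep (L₁ L₂ μ k : ℝ) (u v w β h : Coeffs) : Prop :=
  ∀ κ, 3 * w κ - 4 * v κ + u κ + 2 * k * β κ + 2 * k * μ * (waveNum L₁ L₂ κ : ℂ) ^ 2 * w κ =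
    2 * k * h κ

section Step

variable {L₁ L₂ μ k a : ℝ} {n : ℕ} {u v w β h z : Coeffs}

theorem IsStep.re (H : IsStep L₁ L₂ μ k u v w β h) (κ : ℤ × ℤ) :
    3 * (w κ).re - 4 * (v κ).re + (u κ).re + 2 * k * (β κ).re +
      2 * k * μ * waveNum L₁ L₂ κ ^ 2 * (w κ).re = 2 * k * (h κ).re := by
  have := congrArg Complex.re (H κ)
  rw [show 2 * (k:ℂ) * μ * (waveNum L₁ L₂ κ : ℂ) ^ 2 =
      ((2 * k * μ * waveNum L₁ L₂ κ ^ 2 : ℝ) : ℂ) by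
    push_cast; ring, show 2 * (k:ℂ) = ((2 * k : ℝ) : ℂ) by push_cast; ring] at this
  simp only [Complex.add_re, Complex.sub_re, Complex.re_ofReal_mul] at this
  simpa only [Complex.mul_re, Complex.re_ofNat, Complex.im_ofNat, zero_mul, sub_zero] using this

theorem IsStep.im (H : IsStep L₁ L₂ μ k u v w β h) (κ : ℤ × ℤ) :
    3 * (w κ).im - 4 * (v κ).im + (u κ).im + 2 * k * (β κ).im +
      2 * k * μ * waveNum L₁ L₂ κ ^ 2 * (w κ).im = 2 * k * (h κ).im := by
  have := congrArg Complex.im (H κ)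
  rw [show 2 * (k:ℂ) * μ * (waveNum L₁ L₂ κ : ℂ) ^ 2 =
      ((2 * k * μ * waveNum L₁ L₂ κ ^ 2 : ℝ) : ℂ) by
    push_cast; ring, show 2 * (k:ℂ) = ((2 * k : ℝ) : ℂ) by push_cast; ring] at this
  simp only [Complex.add_im, Complex.sub_im, Complex.im_ofReal_mul] at this
  simpa only [Complex.mul_im, Complex.re_ofNat, Complex.im_ofNat, zero_mul, add_zero] using this

theorem sq_norm_re_im (x : ℂ) : ‖x‖ ^ 2 = x.re ^ 2 + x.im ^ 2 := by
  rw [Complex.sq_norm, Complex.normSq_apply]; ring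

theorem SobSummable.extrap (hu : SobSummable L₁ L₂ n u) (hv : SobSummable L₁ L₂ n v) :
    SobSummable L₁ L₂ n (extrap u v) := by
  have := hv.lin hu 2 1
  simp only [Complex.ofReal_ofNat, Complex.ofReal_one, one_mul] at this
  exact this

theorem sobSq_extrap_le (hu : SobSummable L₁ L₂ n u) (hv : SobSummable L₁ L₂ n v) :
    sobSq L₁ L₂ n (extrap u v) ≤ 8 * sobSq L₁ L₂ n v + 2 * sobSq L₁ L₂ n u := by
  have := sobSq_lin_le hv hu 2 1
  norm_num at this
  exact this

theorem SobSummable.sub (hu : SobSummable L₁ L₂ n u) (hv : SobSummable L₁ L₂ n v) :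
    SobSummable L₁ L₂ n (fun κ => u κ - v κ) := by
  simpa using hu.lin hv 1 1

theorem sobSq_sub_le (hu : SobSummable L₁ L₂ n u) (hv : SobSummable L₁ L₂ n v) :
    sobSq L₁ L₂ n (fun κ => u κ - v κ) ≤ 2 * sobSq L₁ L₂ n u + 2 * sobSq L₁ L₂ n v := by
  simpa using sobSq_lin_le hu hv 1 1

theorem bdfEnergy_nonneg (ha : 0 ≤ a) : 0 ≤ bdfEnergy L₁ L₂ n a u v := by
  have h1 := sobSq_nonneg (L₁ := L₁) (L₂ := L₂) (n := n) (a := v)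
  have h2 := sobSq_nonneg (L₁ := L₁) (L₂ := L₂) (n := n) (a := extrap u v)
  unfold bdfEnergy
  positivity

theorem sobSq_le_bdfEnergy (ha : 0 ≤ a) : sobSq L₁ L₂ n v ≤ 2 * bdfEnergy L₁ L₂ n a u v := by
  have h1 := sobSq_nonneg (L₁ := L₁) (L₂ := L₂) (n := n) (a := v)
  have h2 := sobSq_nonneg (L₁ := L₁) (L₂ := L₂) (n := n) (a := extrap u v)
  unfold bdfEnergy
  nlinarith [mul_nonneg ha h1]

theorem sobSq_extrap_le_bdfEnergy (ha : 0 ≤ a) :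
    sobSq L₁ L₂ n (extrap u v) ≤ 2 * bdfEnergy L₁ L₂ n a u v := by
  have h1 := sobSq_nonneg (L₁ := L₁) (L₂ := L₂) (n := n) (a := v)
  have h2 := sobSq_nonneg (L₁ := L₁) (L₂ := L₂) (n := n) (a := extrap u v)
  unfold bdfEnergy
  nlinarith [mul_nonneg ha h1]

theorem bdfEnergy_le (ha1 : a ≤ 1) (hu : SobSummable L₁ L₂ n u) (hv : SobSummable L₁ L₂ n v) :
    bdfEnergy L₁ L₂ n a u v ≤ 5 * sobSq L₁ L₂ n v + sobSq L₁ L₂ n u := by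
  have h1 := sobSq_nonneg (L₁ := L₁) (L₂ := L₂) (n := n) (a := v)
  have h2 := sobSq_extrap_le hu hv
  unfold bdfEnergy
  nlinarith

theorem HasSum.bdfEnergy (hu : SobSummable L₁ L₂ n u) (hv : SobSummable L₁ L₂ n v) (a : ℝ) :
    HasSum (fun κ =>
      (waveNum L₁ L₂ κ ^ n * ‖v κ‖ ^ 2 + waveNum L₁ L₂ κ ^ n * ‖extrap u v κ‖ ^ 2) / 2 +
        a / 2 * (waveNum L₁ L₂ κ ^ n * ‖v κ‖ ^ 2)) (bdfEnergy L₁ L₂ n a u v) :=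
  ((hv.hasSum.add (hu.extrap hv).hasSum).div_const 2).add (hv.hasSum.mul_left _)

/-- The Hill–Süli identity for the real or imaginary part of one Fourier mode: the defect
`(1 + a) w - 2v + u` between the new value and the extrapolation is dissipated. -/
theorem energy_scalar {M u v w b h : ℝ} (hM : 0 < M) (hk : 0 < k) (hμ : 0 < μ) (ha : 0 ≤ a)
    (haM : a ≤ k * μ * M / 2)
    (H : 3 * w - 4 * v + u + 2 * k * b + 2 * k * μ * M * w = 2 * k * h) :
    (w ^ 2 + (2 * w - v) ^ 2) / 2 + a / 2 * w ^ 2 +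
      (2 * (1 + a))⁻¹ * ((1 + a) * w - (2 * v - u)) ^ 2 + 5 / 4 * (k * μ) * (M * w ^ 2) ≤
    (1 + a)⁻¹ * ((v ^ 2 + (2 * v - u) ^ 2) / 2 + a / 2 * v ^ 2) +
      4 * k / μ * (M⁻¹ * h ^ 2) - 2 * k * (b * w) := by
  have e1 : (w ^ 2 + (2 * w - v) ^ 2) / 2 + a / 2 * w ^ 2 +
      (2 * (1 + a))⁻¹ * ((1 + a) * w - (2 * v - u)) ^ 2 -
      (1 + a)⁻¹ * ((v ^ 2 + (2 * v - u) ^ 2) / 2 + a / 2 * v ^ 2) =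
      (3 * w - 4 * v + u) * w + a * w ^ 2 := by
    have : 1 + a ≠ 0 := by positivity
    field_simp
    ring
  have e2 : (3 * w - 4 * v + u) * w = 2 * k * h * w - 2 * k * b * w - 2 * k * μ * M * w ^ 2 := by
    linear_combination w * H
  have e3 : 2 * k * h * w ≤ k * μ / 4 * (M * w ^ 2) + 4 * k / μ * (M⁻¹ * h ^ 2) := by
    have : k * μ / 4 * (M * w ^ 2) + 4 * k / μ * (M⁻¹ * h ^ 2) - 2 * k * h * w =
        k / (4 * μ * M) * ((μ * M * w - 4 * h) ^ 2) := by
      field_simp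
      ring
    have h2 : 0 ≤ k / (4 * μ * M) * ((μ * M * w - 4 * h) ^ 2) := by positivity
    linarith
  have e4 : a * w ^ 2 ≤ k * μ * M / 2 * w ^ 2 := by gcongr
  linarith

/-- The energy estimate for one step with advection by `z`. The advection term is
`2k (∂(Δ⁻¹z, w), (1 + a) w - 2v + u)`, by antisymmetry, and is absorbed by the dissipation of
the scheme and the viscosity if the time step is small compared to the velocity. -/
theorem energy_step (hL₁ : 0 < L₁) (hL₂ : 0 < L₂) (hk : 0 < k) (hμ : 0 < μ) (ha : 0 ≤ a)
    (ha1 : a ≤ 1) (haμ : a * poincareRoot L₁ L₂ ^ 2 ≤ k * μ / 2)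
    (hu : SobSummable L₁ L₂ 0 u) (hv : SobSummable L₁ L₂ 0 v) (hw : SobSummable L₁ L₂ 2 w)
    (hu0 : u 0 = 0) (hv0 : v 0 = 0) (hw0 : w 0 = 0) (hz : VelSummable L₁ L₂ z)
    (hzr : ∀ κ, z (-κ) = (starRingEnd ℂ) (z κ)) (hzk : 16 * k * velNorm L₁ L₂ z ^ 2 ≤ μ)
    (hh : DualSummable L₁ L₂ h)
    (H : IsStep L₁ L₂ μ k u v w (jac L₁ L₂ z (extrap u v)) h) :
    bdfEnergy L₁ L₂ 0 a v w + μ * k * sobSq L₁ L₂ 2 w ≤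
      (1 + a)⁻¹ * bdfEnergy L₁ L₂ 0 a u v + 4 * k / μ * dualSq L₁ L₂ h := by
  have hwz : SobSummable L₁ L₂ 0 w :=
    (hw.of_succ hL₁ hL₂ hw0).of_succ hL₁ hL₂ hw0
  set q := extrap u v with hq
  have hqs : SobSummable L₁ L₂ 0 q := hu.extrap hv
  set δ : Coeffs := fun κ => ((1 + a : ℝ) : ℂ) * w κ - ((1 : ℝ) : ℂ) * q κ with hδ
  have hδs : SobSummable L₁ L₂ 0 δ := hwz.lin hqs (1 + a) 1
  obtain ⟨s1, s2, e12⟩ := jac_antisymm hz hzr hw hqs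
  obtain ⟨s3, -, e34⟩ := jac_antisymm hz hzr hw hwz
  -- `(∂(Δ⁻¹z, w), w) = 0`, so that any multiple of `w` may be added to the test function
  have e3 : ∑' κ, (jac L₁ L₂ z w κ * (starRingEnd ℂ) (w κ)).re = 0 := by linarith
  have e5 : HasSum (fun κ => (jac L₁ L₂ z w κ * (starRingEnd ℂ) (δ κ)).re)
      (∑' κ, (jac L₁ L₂ z q κ * (starRingEnd ℂ) (w κ)).re) := by
    have := (s3.hasSum.mul_left (1 + a)).sub s2.hasSum
    rw [e3, mul_zero, zero_sub, ← e12] at this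
    refine this.congr_fun fun κ => ?_
    simp only [hδ, map_sub, map_mul, Complex.conj_ofReal, Complex.mul_re, Complex.sub_re,
      Complex.sub_im, Complex.mul_im, Complex.ofReal_re, Complex.ofReal_im, Complex.conj_re,
      Complex.conj_im]
    ring
  obtain ⟨j1, j2⟩ := jac_sob_zero_le hz hw
  -- the advection term against the dissipation of the scheme
  have e6 : -(2 * k) * ∑' κ, (jac L₁ L₂ z q κ * (starRingEnd ℂ) (w κ)).re ≤
      (2 * (1 + a))⁻¹ * sobSq L₁ L₂ 0 δ + 2 * (1 + a) * k ^ 2 * sobSq L₁ L₂ 0 (jac L₁ L₂ z w) := by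
    refine hasSum_le (fun κ => ?_) (e5.mul_left (-(2 * k)))
      ((hδs.hasSum.mul_left _).add (j1.hasSum.mul_left _))
    have c1 : -(jac L₁ L₂ z w κ * (starRingEnd ℂ) (δ κ)).re ≤ ‖jac L₁ L₂ z w κ‖ * ‖δ κ‖ := by
      refine (neg_le_abs _).trans ((Complex.abs_re_le_norm _).trans_eq ?_)
      rw [norm_mul, RCLike.norm_conj]
    simp only [pow_zero, one_mul]
    have c2 : (2 * (1 + a))⁻¹ * ‖δ κ‖ ^ 2 + 2 * (1 + a) * k ^ 2 * ‖jac L₁ L₂ z w κ‖ ^ 2 -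
        2 * k * (‖jac L₁ L₂ z w κ‖ * ‖δ κ‖) =
        (2 * (1 + a))⁻¹ * (‖δ κ‖ - 2 * (1 + a) * k * ‖jac L₁ L₂ z w κ‖) ^ 2 := by
      have : 1 + a ≠ 0 := by positivity
      field_simp
      ring
    have c3 : 0 ≤ (2 * (1 + a))⁻¹ * (‖δ κ‖ - 2 * (1 + a) * k * ‖jac L₁ L₂ z w κ‖) ^ 2 := by
      positivity
    nlinarith
  have e7 : 2 * (1 + a) * k ^ 2 * sobSq L₁ L₂ 0 (jac L₁ L₂ z w) ≤ k * μ / 4 * sobSq L₁ L₂ 2 w := by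
    have hN := sobSq_nonneg (L₁ := L₁) (L₂ := L₂) (n := 2) (a := w)
    calc _ ≤ 2 * (1 + 1) * k ^ 2 * (velNorm L₁ L₂ z ^ 2 * sobSq L₁ L₂ 2 w) := by
          have := sobSq_nonneg (L₁ := L₁) (L₂ := L₂) (n := 0) (a := jac L₁ L₂ z w)
          gcongr
      _ = k / 4 * (16 * k * velNorm L₁ L₂ z ^ 2) * sobSq L₁ L₂ 2 w := by ring
      _ ≤ k / 4 * μ * sobSq L₁ L₂ 2 w := by gcongr
      _ = _ := by ring
  have e8 := hasSum_le (f := fun κ => ((waveNum L₁ L₂ κ ^ 0 * ‖w κ‖ ^ 2 +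
      waveNum L₁ L₂ κ ^ 0 * ‖extrap v w κ‖ ^ 2) / 2 + a / 2 * (waveNum L₁ L₂ κ ^ 0 * ‖w κ‖ ^ 2)) +
      (2 * (1 + a))⁻¹ * (waveNum L₁ L₂ κ ^ 0 * ‖δ κ‖ ^ 2) +
      5 / 4 * (k * μ) * (waveNum L₁ L₂ κ ^ 2 * ‖w κ‖ ^ 2))
    (g := fun κ => (1 + a)⁻¹ * ((waveNum L₁ L₂ κ ^ 0 * ‖v κ‖ ^ 2 +
      waveNum L₁ L₂ κ ^ 0 * ‖extrap u v κ‖ ^ 2) / 2 + a / 2 * (waveNum L₁ L₂ κ ^ 0 * ‖v κ‖ ^ 2)) +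
      4 * k / μ * ((waveNum L₁ L₂ κ ^ 2)⁻¹ * ‖h κ‖ ^ 2) -
      2 * k * (jac L₁ L₂ z q κ * (starRingEnd ℂ) (w κ)).re)
    (fun κ => by
      rcases eq_or_ne κ 0 with rfl | hκ
      · simp [hδ, hq, extrap, hu0, hv0, hw0, waveNum_zero]
      · have hm := waveNum_pos hL₁ hL₂ hκ
        have h1 := one_le_poincareRoot_mul hL₁ hL₂ hκ
        have haM : a ≤ k * μ * waveNum L₁ L₂ κ ^ 2 / 2 := by
          calc a ≤ a * (poincareRoot L₁ L₂ * waveNum L₁ L₂ κ) ^ 2 :=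
                le_mul_of_one_le_right ha (one_le_pow₀ h1)
            _ = a * poincareRoot L₁ L₂ ^ 2 * waveNum L₁ L₂ κ ^ 2 := by ring
            _ ≤ k * μ / 2 * waveNum L₁ L₂ κ ^ 2 := by gcongr
            _ = _ := by ring
        have r1 := energy_scalar (by positivity) hk hμ ha haM (H.re κ)
        have r2 := energy_scalar (by positivity) hk hμ ha haM (H.im κ)
        simp only [pow_zero, one_mul, sq_norm_re_im, hδ, hq, extrap, Complex.mul_re,
          Complex.conj_re, Complex.conj_im, Complex.sub_re, Complex.sub_im, Complex.mul_im,
          Complex.ofReal_re, Complex.ofReal_im, Complex.re_ofNat, Complex.im_ofNat, zero_mul,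
          sub_zero, add_zero] at r1 r2 ⊢
        linarith)
    (((HasSum.bdfEnergy hv hwz a).add (hδs.hasSum.mul_left _)).add (hw.hasSum.mul_left _))
    ((((HasSum.bdfEnergy hu hv a).mul_left _).add (hh.hasSum.mul_left _)).sub
      (s1.hasSum.mul_left _))
  change bdfEnergy L₁ L₂ 0 a v w + (2 * (1 + a))⁻¹ * sobSq L₁ L₂ 0 δ +
    5 / 4 * (k * μ) * sobSq L₁ L₂ 2 w ≤ (1 + a)⁻¹ * bdfEnergy L₁ L₂ 0 a u v +
    4 * k / μ * dualSq L₁ L₂ h - 2 * k * _ at e8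
  linarith

theorem regularity_scalar {M u v w b h : ℝ} (hM : 0 < M) (hk : 0 < k) (hμ : 0 < μ)
    (H : 3 * w - 4 * v + u + 2 * k * b + 2 * k * μ * M * w = 2 * k * h) :
    (w ^ 2 + (2 * w - v) ^ 2) / 2 + k * μ * (M * w ^ 2) ≤
    (v ^ 2 + (2 * v - u) ^ 2) / 2 + 2 * k / μ * (M⁻¹ * (h ^ 2 + b ^ 2)) := by
  have e1 : (w ^ 2 + (2 * w - v) ^ 2) / 2 + (w - (2 * v - u)) ^ 2 / 2 -
      (v ^ 2 + (2 * v - u) ^ 2) / 2 =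
      2 * k * h * w - 2 * k * b * w - 2 * k * μ * M * w ^ 2 := by
    linear_combination w * H
  have aux : ∀ x : ℝ, 2 * k * x * w ≤ k * μ / 2 * (M * w ^ 2) + 2 * k / μ * (M⁻¹ * x ^ 2) := by
    intro x
    have : k * μ / 2 * (M * w ^ 2) + 2 * k / μ * (M⁻¹ * x ^ 2) - 2 * k * x * w =
        k / (2 * μ * M) * ((μ * M * w - 2 * x) ^ 2) := by
      field_simp
      ring
    have h2 : 0 ≤ k / (2 * μ * M) * ((μ * M * w - 2 * x) ^ 2) := by positivity
    linarith
  have a1 := aux h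
  have a2 := aux (-b)
  rw [neg_sq] at a2
  nlinarith [sq_nonneg (w - (2 * v - u))]

/-- The estimate for one step in which the advection term is treated as a forcing. -/
theorem regularity_step (hL₁ : 0 < L₁) (hL₂ : 0 < L₂) (hk : 0 < k) (hμ : 0 < μ)
    (hu : SobSummable L₁ L₂ n u) (hv : SobSummable L₁ L₂ n v)
    (hu0 : u 0 = 0) (hv0 : v 0 = 0) (hw0 : w 0 = 0) {P : ℤ × ℤ → ℝ} {S : ℝ} (hP : HasSum P S)
    (hhβ : ∀ κ, waveNum L₁ L₂ κ ^ n * ((waveNum L₁ L₂ κ ^ 2)⁻¹ * (‖h κ‖ ^ 2 + ‖β κ‖ ^ 2)) ≤ P κ)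
    (H : IsStep L₁ L₂ μ k u v w β h) :
    SobSummable L₁ L₂ (n + 2) w ∧
    bdfEnergy L₁ L₂ n 0 v w + k * μ * sobSq L₁ L₂ (n + 2) w ≤
      bdfEnergy L₁ L₂ n 0 u v + 2 * k / μ * S := by
  have key : ∀ κ, ((waveNum L₁ L₂ κ ^ n * ‖w κ‖ ^ 2 +
      waveNum L₁ L₂ κ ^ n * ‖extrap v w κ‖ ^ 2) / 2 + 0 / 2 * (waveNum L₁ L₂ κ ^ n * ‖w κ‖ ^ 2)) +
      k * μ * (waveNum L₁ L₂ κ ^ (n + 2) * ‖w κ‖ ^ 2) ≤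
      ((waveNum L₁ L₂ κ ^ n * ‖v κ‖ ^ 2 +
      waveNum L₁ L₂ κ ^ n * ‖extrap u v κ‖ ^ 2) / 2 + 0 / 2 * (waveNum L₁ L₂ κ ^ n * ‖v κ‖ ^ 2)) +
      2 * k / μ * P κ := by
    intro κ
    have hP1 : 2 * k / μ * (waveNum L₁ L₂ κ ^ n *
        ((waveNum L₁ L₂ κ ^ 2)⁻¹ * (‖h κ‖ ^ 2 + ‖β κ‖ ^ 2))) ≤ 2 * k / μ * P κ :=
      mul_le_mul_of_nonneg_left (hhβ κ) (by positivity)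
    refine le_trans ?_ (add_le_add_right hP1 _)
    rcases eq_or_ne κ 0 with rfl | hκ
    · simp [extrap, hu0, hv0, hw0, waveNum_zero]
    · have hm := waveNum_pos hL₁ hL₂ hκ
      have r1 := regularity_scalar (by positivity) hk hμ (H.re κ)
      have r2 := regularity_scalar (by positivity) hk hμ (H.im κ)
      have r3 := mul_le_mul_of_nonneg_left (add_le_add r1 r2) (pow_nonneg hm.le n)
      simp only [sq_norm_re_im, extrap, Complex.sub_re, Complex.sub_im, Complex.mul_re,
        Complex.mul_im, Complex.re_ofNat, Complex.im_ofNat, zero_mul, sub_zero, add_zero,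
        pow_add] at r3 ⊢
      linarith
  have hR := (HasSum.bdfEnergy hu hv 0).add (hP.mul_left (2 * k / μ))
  have hnn : ∀ (m : ℕ) (b : Coeffs) κ, 0 ≤ waveNum L₁ L₂ κ ^ m * ‖b κ‖ ^ 2 := fun m b κ =>
    mul_nonneg (pow_nonneg (waveNum_nonneg κ) _) (sq_nonneg _)
  have s2 : SobSummable L₁ L₂ (n + 2) w := by
    refine Summable.of_nonneg_of_le (hnn _ w) (fun κ => ?_) (hR.summable.mul_left (k * μ)⁻¹)
    rw [le_inv_mul_iff₀ (by positivity)]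
    linarith [key κ, hnn n w κ, hnn n (extrap v w) κ]
  have s1 : SobSummable L₁ L₂ n w := (s2.of_succ hL₁ hL₂ hw0).of_succ hL₁ hL₂ hw0
  exact ⟨s2, hasSum_le key ((HasSum.bdfEnergy hv s1 0).add (s2.hasSum.mul_left (k * μ))) hR⟩

theorem increment_scalar {M u v w b h : ℝ} (hM : 0 ≤ M) (hk : 0 < k) (hμ : 0 < μ)
    (H : 3 * w - 4 * v + u + 2 * k * b + 2 * k * μ * M * w = 2 * k * h) :
    2 * (w - v) ^ 2 + k * μ * (M * w ^ 2) ≤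
      1 / 2 * (v - u) ^ 2 + k * μ * (M * v ^ 2) + 4 * k ^ 2 * (h ^ 2 + b ^ 2) := by
  have e : 3 * (w - v) ^ 2 - (v - u) * (w - v) + 2 * k * μ * M * w * (w - v) =
      2 * k * (h - b) * (w - v) := by linear_combination (w - v) * H
  have hkm : 0 ≤ k * μ * M := by positivity
  nlinarith [sq_nonneg ((v - u) - (w - v)), mul_nonneg hkm (sq_nonneg (w - v)),
    sq_nonneg (2 * k * (h - b) - (w - v)), mul_nonneg (sq_nonneg k) (sq_nonneg (h + b))]

/-- Testing one step with the increment `w - v`. -/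
theorem increment_step (hk : 0 < k) (hμ : 0 < μ)
    (hu : SobSummable L₁ L₂ 0 u) (hv : SobSummable L₁ L₂ 0 v) (hw : SobSummable L₁ L₂ 0 w)
    (hv2 : SobSummable L₁ L₂ 2 v) (hw2 : SobSummable L₁ L₂ 2 w)
    (hh : SobSummable L₁ L₂ 0 h) (hβ : SobSummable L₁ L₂ 0 β)
    (H : IsStep L₁ L₂ μ k u v w β h) :
    2 * sobSq L₁ L₂ 0 (fun κ => w κ - v κ) + k * μ * sobSq L₁ L₂ 2 w ≤
      1 / 2 * sobSq L₁ L₂ 0 (fun κ => v κ - u κ) + k * μ * sobSq L₁ L₂ 2 v +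
        4 * k ^ 2 * (sobSq L₁ L₂ 0 h + sobSq L₁ L₂ 0 β) := by
  refine hasSum_le (fun κ => ?_)
    (((hw.sub hv).hasSum.mul_left 2).add (hw2.hasSum.mul_left (k * μ)))
    ((((hv.sub hu).hasSum.mul_left (1 / 2)).add (hv2.hasSum.mul_left (k * μ))).add
      ((hh.hasSum.add hβ.hasSum).mul_left (4 * k ^ 2)))
  have r1 := increment_scalar (sq_nonneg _) hk hμ (H.re κ)
  have r2 := increment_scalar (sq_nonneg _) hk hμ (H.im κ)
  simp only [pow_zero, one_mul, sq_norm_re_im, Complex.sub_re, Complex.sub_im] at r1 r2 ⊢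
  linarith

theorem increment_scalar' {M u v w b h : ℝ}
    (H : 3 * w - 4 * v + u + 2 * k * b + 2 * k * μ * M * w = 2 * k * h) :
    9 * (w - v) ^ 2 ≤ 2 * (v - u) ^ 2 +
      24 * k ^ 2 * (h ^ 2 + b ^ 2 + μ ^ 2 * (M ^ 2 * w ^ 2)) := by
  have e : 3 * (w - v) = (v - u) + 2 * k * (h - b - μ * M * w) := by linear_combination H
  have e2 : 9 * (w - v) ^ 2 = ((v - u) + 2 * k * (h - b - μ * M * w)) ^ 2 := by
    rw [← e]; ring
  rw [e2]
  have h3 : (h - b - μ * M * w) ^ 2 ≤ 3 * (h ^ 2 + b ^ 2 + μ ^ 2 * (M ^ 2 * w ^ 2)) := by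
    nlinarith [sq_nonneg (h + b), sq_nonneg (h + μ * M * w), sq_nonneg (b - μ * M * w)]
  nlinarith [sq_nonneg ((v - u) - 2 * k * (h - b - μ * M * w)),
    mul_le_mul_of_nonneg_left h3 (sq_nonneg k)]

/-- The increment `w - v` is read off from one step, with the viscous term as a forcing. -/
theorem increment_step'
    (hu : SobSummable L₁ L₂ 0 u) (hv : SobSummable L₁ L₂ 0 v) (hw : SobSummable L₁ L₂ 0 w)
    (hw4 : SobSummable L₁ L₂ 4 w)
    (hh : SobSummable L₁ L₂ 0 h) (hβ : SobSummable L₁ L₂ 0 β)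
    (H : IsStep L₁ L₂ μ k u v w β h) :
    9 * sobSq L₁ L₂ 0 (fun κ => w κ - v κ) ≤
      2 * sobSq L₁ L₂ 0 (fun κ => v κ - u κ) +
        24 * k ^ 2 * (sobSq L₁ L₂ 0 h + sobSq L₁ L₂ 0 β + μ ^ 2 * sobSq L₁ L₂ 4 w) := by
  refine hasSum_le (fun κ => ?_)
    ((hw.sub hv).hasSum.mul_left 9)
    (((hv.sub hu).hasSum.mul_left 2).add
      (((hh.hasSum.add hβ.hasSum).add (hw4.hasSum.mul_left (μ ^ 2))).mul_left (24 * k ^ 2)))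
  have r1 := increment_scalar' (H.re κ)
  have r2 := increment_scalar' (H.im κ)
  rw [← pow_mul, show 2 * 2 = 4 from rfl] at r1 r2
  simp only [pow_zero, one_mul, sq_norm_re_im, Complex.sub_re, Complex.sub_im] at r1 r2 ⊢
  linarith

end Step

/-! ### Discrete Gronwall inequalities -/

theorem discrete_gronwall {x g : ℕ → ℝ} {h : ℝ} {j N : ℕ} (hh : 0 ≤ h) (hg : ∀ i, 0 ≤ g i)
    (hx : 0 ≤ x j) (H : ∀ i < N, x (i + 1) ≤ (1 + g i) * x i + h) {n : ℕ} (hjn : j ≤ n)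
    (hn : n ≤ N) : x n ≤ (x j + n * h) * Real.exp (∑ i ∈ Finset.Ico j n, g i) := by
  induction n, hjn using Nat.le_induction with
  | base =>
    simp only [Finset.Ico_self, Finset.sum_empty, Real.exp_zero, mul_one]
    have : 0 ≤ (j : ℝ) * h := by positivity
    linarith
  | succ n hjn ih =>
    have h1 := ih (by omega)
    have h2 := H n (by omega)
    rw [Finset.sum_Ico_succ_top hjn, Real.exp_add]
    have hgn := hg n
    set S := ∑ i ∈ Finset.Ico j n, g i with hS
    have hS0 : 0 ≤ S := Finset.sum_nonneg fun i _ => hg i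
    have e1 : 1 ≤ Real.exp S := Real.one_le_exp hS0
    have e2 : 1 + g n ≤ Real.exp (g n) := by linarith [Real.add_one_le_exp (g n)]
    have e3 : 1 ≤ Real.exp (g n) := by linarith
    have hn0 : 0 ≤ x j + n * h := by positivity
    calc x (n + 1) ≤ (1 + g n) * ((x j + n * h) * Real.exp S) + h := by
          refine h2.trans ?_; gcongr
      _ ≤ Real.exp (g n) * ((x j + n * h) * Real.exp S) + h * (Real.exp S * Real.exp (g n)) := by
          gcongr
          exact le_mul_of_one_le_right hh (one_le_mul_of_one_le_of_one_le e1 e3)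
      _ = _ := by push_cast; ring

/-- The discrete uniform Gronwall inequality: a bound for the sum over a window bounds the value
at the end of the window, since some value in the window is at most the average. -/
theorem uniform_gronwall {x g : ℕ → ℝ} {h X G : ℝ} {N : ℕ} (hN : 0 < N) (hh : 0 ≤ h)
    (hg : ∀ i, 0 ≤ g i) (hx : ∀ i, 0 ≤ x i) (H : ∀ i < N, x (i + 1) ≤ (1 + g i) * x i + h)
    (hX : ∑ i ∈ Finset.range N, x i ≤ X) (hG : ∑ i ∈ Finset.range N, g i ≤ G) :
    x N ≤ (X / N + N * h) * Real.exp G := by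
  have hN' : (0 : ℝ) < N := by exact_mod_cast hN
  obtain ⟨j, hj, hjx⟩ : ∃ j ∈ Finset.range N, x j ≤ X / N := by
    refine Finset.exists_le_of_sum_le ⟨0, by simpa using hN⟩ (hX.trans_eq ?_)
    rw [Finset.sum_const, Finset.card_range, nsmul_eq_mul]
    field_simp
  have hjN := (Finset.mem_range.mp hj)
  refine (discrete_gronwall hh hg (hx j) H hjN.le le_rfl).trans ?_
  have h1 : ∑ i ∈ Finset.Ico j N, g i ≤ G := by
    refine le_trans (Finset.sum_le_sum_of_subset_of_nonneg ?_ fun i _ _ => hg i) hG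
    intro i hi
    exact Finset.mem_range.mpr (Finset.mem_Ico.mp hi).2
  have hX0 : 0 ≤ X / N := (hx j).trans hjx
  have : 0 ≤ X / N + N * h := by positivity
  gcongr

theorem telescope_le {x y : ℕ → ℝ} {c : ℝ} (m : ℕ)
    (H : ∀ j, x (m + j + 1) + y (m + j) ≤ x (m + j) + c) (i : ℕ) :
    x (m + i) + ∑ j ∈ Finset.range i, y (m + j) ≤ x m + i * c := by
  induction i with
  | zero => simp
  | succ i ih =>
    rw [Finset.sum_range_succ]
    have := H i
    push_cast
    rw [← add_assoc m i 1]
    linarith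

/-- A contraction with a source: after `N` steps the initial value has been divided by `N`. -/
theorem contraction_le {x : ℕ → ℝ} {c X : ℝ} (hX : 0 ≤ X) (m : ℕ)
    (H : ∀ j, x (m + j + 1) ≤ 1 / 4 * x (m + j) + c) (hc : 0 ≤ c) (hx : x m ≤ X) {N : ℕ}
    (hN : 0 < N) : x (m + N) ≤ X / N + 2 * c := by
  have key : ∀ i : ℕ, x (m + i) ≤ (1 / 4) ^ i * X + 2 * c := by
    intro i
    induction i with
    | zero => simp; linarith
    | succ i ih =>
      have := H i
      rw [← add_assoc, pow_succ]
      linarith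
  refine (key N).trans ?_
  have h1 : ((1:ℝ) / 4) ^ N ≤ 1 / N := by
    -- the factor `1 / N` is of the order of the time step if `N` counts the steps of a window
    rw [one_div_pow]
    have : (N : ℝ) ≤ 4 ^ N := by
      exact_mod_cast (Nat.lt_pow_self (by norm_num : 1 < 4)).le
    have hN' : (0 : ℝ) < N := by exact_mod_cast hN
    gcongr
  have := mul_le_mul_of_nonneg_right h1 hX
  rw [one_div_mul_eq_div] at this
  linarith

theorem sum_shift_le {y : ℕ → ℝ} {S : ℝ} (hy : ∀ n, 0 ≤ y n) {i : ℕ}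
    (hS : ∀ m, ∑ j ∈ Finset.range i, y (m + 2 + j) ≤ S) (m : ℕ) :
    ∑ j ∈ Finset.range i, y (m + j) ≤ y 0 + y 1 + S := by
  match m with
  | 0 =>
    have h : ∑ j ∈ Finset.range i, y (0 + j) ≤ ∑ j ∈ Finset.range (i + 1 + 1), y (0 + j) :=
      Finset.sum_le_sum_of_subset_of_nonneg (Finset.range_mono (by omega)) fun _ _ _ => hy _
    rw [Finset.sum_range_succ', Finset.sum_range_succ'] at h
    have h2 := hS 0
    simp only [zero_add, add_zero, add_comm 2] at h h2 ⊢
    simp only [add_assoc, one_add_one_eq_two] at h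
    linarith
  | 1 =>
    have h : ∑ j ∈ Finset.range i, y (1 + j) ≤ ∑ j ∈ Finset.range (i + 1), y (1 + j) :=
      Finset.sum_le_sum_of_subset_of_nonneg (Finset.range_mono (by omega)) fun _ _ _ => hy _
    rw [Finset.sum_range_succ'] at h
    have h2 := hS 0
    have e : ∀ j, 1 + (j + 1) = 0 + 2 + j := fun j => by ring
    simp only [e, add_zero] at h
    linarith [hy 0]
  | m + 2 => linarith [hS m, hy 0, hy 1]

theorem sum_pair_le {x y : ℕ → ℝ} {S p q : ℝ} {N m : ℕ} (hp : 0 ≤ p) (hq : 0 ≤ q)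
    (hy : ∀ n, 0 ≤ y n) (hx : ∀ j, x (m + j) ≤ p * y (m + j + 1) + q * y (m + j))
    (hS : ∑ j ∈ Finset.range (N + 1), y (m + j) ≤ S) :
    ∑ j ∈ Finset.range N, x (m + j) ≤ (p + q) * S := by
  have h1 : ∑ j ∈ Finset.range N, y (m + j) ≤ S :=
    le_trans (Finset.sum_le_sum_of_subset_of_nonneg (Finset.range_mono (by omega))
      fun _ _ _ => hy _) hS
  have h2 : ∑ j ∈ Finset.range N, y (m + j + 1) ≤ S := by
    rw [Finset.sum_range_succ'] at hS
    have := hy (m + 0)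
    simp only [add_assoc] at hS ⊢
    linarith
  calc ∑ j ∈ Finset.range N, x (m + j)
      ≤ ∑ j ∈ Finset.range N, (p * y (m + j + 1) + q * y (m + j)) :=
        Finset.sum_le_sum fun j _ => hx j
    _ = p * ∑ j ∈ Finset.range N, y (m + j + 1) + q * ∑ j ∈ Finset.range N, y (m + j) := by
        rw [Finset.sum_add_distrib, Finset.mul_sum, Finset.mul_sum]
    _ ≤ p * S + q * S := by gcongr
    _ = _ := by ring

/-! ### The scheme in Fourier space: energy and small time steps -/

/-- The sequences `a 0, a 1, …` of Fourier coefficients solve the scheme with forcing `g`. -/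
structure IsTrajectory (L₁ L₂ μ k : ℝ) (a g : ℕ → Coeffs) : Prop where
  pos₁ : 0 < L₁
  pos₂ : 0 < L₂
  μ_pos : 0 < μ
  k_pos : 0 < k
  zero : ∀ n, a n 0 = 0
  conj : ∀ n κ, a n (-κ) = (starRingEnd ℂ) (a n κ)
  sob_zero : ∀ n, SobSummable L₁ L₂ 0 (a n)
  sob_one_init : SobSummable L₁ L₂ 1 (a 0) ∧ SobSummable L₁ L₂ 1 (a 1)
  dual : ∀ n, DualSummable L₁ L₂ (g n)
  step : ∀ n, IsStep L₁ L₂ μ k (a n) (a (n + 1)) (a (n + 2))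
    (jac L₁ L₂ (extrap (a n) (a (n + 1))) (extrap (a n) (a (n + 1)))) (g (n + 1))

section Trajectory

variable {L₁ L₂ μ k : ℝ} {a g : ℕ → Coeffs}

theorem poincareRoot_sq : poincareRoot L₁ L₂ ^ 2 = poincareConst L₁ L₂ := rfl

theorem decayRate_pos (hL₁ : 0 < L₁) (hμ : 0 < μ) : 0 < decayRate L₁ L₂ μ := by
  have := poincareRoot_pos (L₂ := L₂) hL₁
  unfold decayRate
  rw [← poincareRoot_sq]
  positivity

theorem decayRate_mul_sq (hL₁ : 0 < L₁) :
    decayRate L₁ L₂ μ * k * poincareRoot L₁ L₂ ^ 2 = k * μ / 2 := by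
  have := poincareRoot_pos (L₂ := L₂) hL₁
  unfold decayRate
  rw [← poincareRoot_sq]
  field_simp

theorem extrap_zero {u v : Coeffs} (hu : u 0 = 0) (hv : v 0 = 0) : extrap u v 0 = 0 := by
  simp [extrap, hu, hv]

theorem extrap_conj {u v : Coeffs} (hu : ∀ κ, u (-κ) = (starRingEnd ℂ) (u κ))
    (hv : ∀ κ, v (-κ) = (starRingEnd ℂ) (v κ)) (κ : ℤ × ℤ) :
    extrap u v (-κ) = (starRingEnd ℂ) (extrap u v κ) := by
  simp only [extrap, hu, hv, map_sub, map_mul, map_ofNat]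

theorem inv_one_add_le_exp {x : ℝ} (h0 : 0 ≤ x) (h1 : x ≤ 1) :
    (1 + x)⁻¹ ≤ Real.exp (-(x / 2)) := by
  refine le_trans ?_ (Real.one_sub_le_exp_neg (x / 2))
  rw [inv_le_iff_one_le_mul₀ (by positivity)]
  nlinarith

namespace IsTrajectory

/-- Smoothing by one step: if the data are in `H^{1/2}`, then the velocity is bounded, the advection
term is in `H⁻¹`, and the new vorticity is in `H¹`. -/
theorem sob_aux (H : IsTrajectory L₁ L₂ μ k a g) {n : ℕ} (h0 : SobSummable L₁ L₂ 1 (a n))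
    (h1 : SobSummable L₁ L₂ 1 (a (n + 1))) : SobSummable L₁ L₂ 2 (a (n + 2)) := by
  have hΩ : SobSummable L₁ L₂ 1 (extrap (a n) (a (n + 1))) := h0.extrap h1
  have hΩ0 : SobSummable L₁ L₂ 0 (extrap (a n) (a (n + 1))) :=
    (H.sob_zero n).extrap (H.sob_zero (n + 1))
  have hj := (jac_dual_le (velNorm_sq_le H.pos₁ H.pos₂ hΩ).1 hΩ0).1
  refine (regularity_step (n := 0) H.pos₁ H.pos₂ H.k_pos H.μ_pos (H.sob_zero n)
    (H.sob_zero (n + 1)) (H.zero _) (H.zero _) (H.zero _)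
    ((H.dual (n + 1)).hasSum.add hj.hasSum) (fun κ => ?_) (H.step n)).1
  simp only [pow_zero, one_mul, mul_add, le_refl]

theorem sob_one (H : IsTrajectory L₁ L₂ μ k a g) (n : ℕ) : SobSummable L₁ L₂ 1 (a n) := by
  have : ∀ n, SobSummable L₁ L₂ 1 (a n) ∧ SobSummable L₁ L₂ 1 (a (n + 1)) := by
    intro n
    induction n with
    | zero => exact H.sob_one_init
    | succ n ih => exact ⟨ih.2, (H.sob_aux ih.1 ih.2).of_succ H.pos₁ H.pos₂ (H.zero _)⟩
  exact (this n).1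

/-- The vorticity is in `H¹` after the initial data. -/
theorem sob_two (H : IsTrajectory L₁ L₂ μ k a g) (n : ℕ) : SobSummable L₁ L₂ 2 (a (n + 2)) :=
  H.sob_aux (H.sob_one n) (H.sob_one (n + 1))

theorem velSummable (H : IsTrajectory L₁ L₂ μ k a g) (n : ℕ) :
    VelSummable L₁ L₂ (extrap (a n) (a (n + 1))) :=
  (velNorm_sq_le H.pos₁ H.pos₂ ((H.sob_one n).extrap (H.sob_one (n + 1)))).1

/-- The energy estimate for one step of the scheme. -/
theorem energy_le (H : IsTrajectory L₁ L₂ μ k a g) (hνk : decayRate L₁ L₂ μ * k ≤ 1) {Φ : ℝ}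
    (n : ℕ) (hΦ : dualSq L₁ L₂ (g (n + 1)) ≤ Φ)
    (hS : 16 * k * velNorm L₁ L₂ (extrap (a n) (a (n + 1))) ^ 2 ≤ μ) :
    bdfEnergy L₁ L₂ 0 (decayRate L₁ L₂ μ * k) (a (n + 1)) (a (n + 2)) +
        μ * k * sobSq L₁ L₂ 2 (a (n + 2)) ≤
      (1 + decayRate L₁ L₂ μ * k)⁻¹ *
        bdfEnergy L₁ L₂ 0 (decayRate L₁ L₂ μ * k) (a n) (a (n + 1)) + 4 * k / μ * Φ := by
  have hν := decayRate_pos (L₂ := L₂) H.pos₁ H.μ_pos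
  have hk := H.k_pos
  have hμ := H.μ_pos
  refine (energy_step H.pos₁ H.pos₂ hk hμ (by positivity) hνk
    (decayRate_mul_sq H.pos₁).le (H.sob_zero n) (H.sob_zero (n + 1)) (H.sob_two n) (H.zero _)
    (H.zero _) (H.zero _) (H.velSummable n) (extrap_conj (H.conj n) (H.conj (n + 1))) hS
    (H.dual (n + 1)) (H.step n)).trans ?_
  gcongr

/-- Summation of the energy estimates, with a source that accumulates to at most
`8 Φ / (μ ν)`. -/
theorem energy_decay (H : IsTrajectory L₁ L₂ μ k a g) (hνk : decayRate L₁ L₂ μ * k ≤ 1) {Φ : ℝ}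
    (hΦ : ∀ n, dualSq L₁ L₂ (g n) ≤ Φ) (n : ℕ)
    (hS : ∀ j ≤ n, 16 * k * velNorm L₁ L₂ (extrap (a j) (a (j + 1))) ^ 2 ≤ μ) :
    bdfEnergy L₁ L₂ 0 (decayRate L₁ L₂ μ * k) (a (n + 1)) (a (n + 2)) +
        μ * k * sobSq L₁ L₂ 2 (a (n + 2)) ≤
      Real.exp (-(decayRate L₁ L₂ μ * n * k / 2)) *
        bdfEnergy L₁ L₂ 0 (decayRate L₁ L₂ μ * k) (a 0) (a 1) +
        8 * Φ / (μ * decayRate L₁ L₂ μ) := by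
  have hν := decayRate_pos (L₂ := L₂) H.pos₁ H.μ_pos
  have hk := H.k_pos
  have hμ := H.μ_pos
  have hΦ0 : 0 ≤ Φ := dualSq_nonneg.trans (hΦ 0)
  set ν := decayRate L₁ L₂ μ with hν'
  set E : ℕ → ℝ := fun n => bdfEnergy L₁ L₂ 0 (ν * k) (a n) (a (n + 1)) with hE
  have hE0 : ∀ n, 0 ≤ E n := fun n => bdfEnergy_nonneg (by positivity)
  have hρ := inv_one_add_le_exp (x := ν * k) (by positivity) hνk
  have hρ1 : (1 + ν * k)⁻¹ ≤ 1 := inv_le_one_of_one_le₀ (by linarith [mul_pos hν hk])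
  -- `8 Φ / (μ ν)` is a stationary supersolution of the recursion, because `ν k ≤ 1`
  have hfix : (1 + ν * k)⁻¹ * (8 * Φ / (μ * ν)) + 4 * k / μ * Φ ≤ 8 * Φ / (μ * ν) := by
    have e : 8 * Φ / (μ * ν) - ((1 + ν * k)⁻¹ * (8 * Φ / (μ * ν)) + 4 * k / μ * Φ) =
        4 * k * Φ * (1 - ν * k) / (μ * (1 + ν * k)) := by
      field_simp
      ring
    have : 0 ≤ 1 - ν * k := by linarith
    have h2 : 0 ≤ 4 * k * Φ * (1 - ν * k) / (μ * (1 + ν * k)) := by positivity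
    linarith
  have key : ∀ j ≤ n, E (j + 1) + μ * k * sobSq L₁ L₂ 2 (a (j + 2)) ≤
      Real.exp (-(ν * j * k / 2)) * E 0 + 8 * Φ / (μ * ν) := by
    intro j
    induction j with
    | zero =>
      intro hj
      refine (H.energy_le hνk 0 (hΦ _) (hS 0 hj)).trans ?_
      have h1 : (1 + ν * k)⁻¹ * E 0 ≤ 1 * E 0 := mul_le_mul_of_nonneg_right hρ1 (hE0 0)
      have h2 : 0 ≤ (1 + ν * k)⁻¹ * (8 * Φ / (μ * ν)) := by positivity
      simp only [Nat.cast_zero, mul_zero, zero_mul, zero_div, neg_zero, Real.exp_zero]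
      linarith
    | succ j ih =>
      intro hj
      have h1 := ih (by omega)
      refine (H.energy_le hνk (j + 1) (hΦ _) (hS (j + 1) hj)).trans ?_
      have h2 : 0 ≤ μ * k * sobSq L₁ L₂ 2 (a (j + 2)) := mul_nonneg (by positivity) sobSq_nonneg
      calc (1 + ν * k)⁻¹ * E (j + 1) + 4 * k / μ * Φ
          ≤ (1 + ν * k)⁻¹ * (Real.exp (-(ν * j * k / 2)) * E 0 + 8 * Φ / (μ * ν)) +
            4 * k / μ * Φ := by gcongr; linarith
        _ = (1 + ν * k)⁻¹ * (Real.exp (-(ν * j * k / 2)) * E 0) +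
            ((1 + ν * k)⁻¹ * (8 * Φ / (μ * ν)) + 4 * k / μ * Φ) := by ring
        _ ≤ Real.exp (-(ν * k / 2)) * (Real.exp (-(ν * j * k / 2)) * E 0) +
            8 * Φ / (μ * ν) := by
          have := hE0 0
          gcongr
        _ = _ := by
          rw [← mul_assoc, ← Real.exp_add]
          congr 3
          push_cast
          ring
  exact key n le_rfl

end IsTrajectory

/-- A bound for the energy along the trajectory, for initial data with squared `H^{1/2}` norms at
most `Q` and forcing with squared `H⁻¹` norms at most `Φ`. -/
def energyScale (L₁ L₂ μ Q Φ : ℝ) : ℝ :=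
  6 * poincareRoot L₁ L₂ * Q + 8 * Φ / (μ * decayRate L₁ L₂ μ)

/-- An admissible bound for the time step, for initial data with squared `H^{1/2}` norms at most
`Q` and forcing with squared `H⁻¹` norms at most `Φ`. -/
def maxStep (L₁ L₂ μ Q Φ : ℝ) : ℝ :=
  min (min 1 (1 / decayRate L₁ L₂ μ))
    ((μ / (160 * embConst L₁ L₂ * (Q + 2 * energyScale L₁ L₂ μ Q Φ +
      energyScale L₁ L₂ μ Q Φ / μ) + 1)) ^ 2)

theorem energyScale_nonneg (hL₁ : 0 < L₁) (hμ : 0 < μ) {Q Φ : ℝ} (hQ : 0 ≤ Q) (hΦ : 0 ≤ Φ) :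
    0 ≤ energyScale L₁ L₂ μ Q Φ := by
  have := decayRate_pos (L₂ := L₂) hL₁ hμ
  have := poincareRoot_pos (L₂ := L₂) hL₁
  unfold energyScale
  positivity

theorem maxStep_pos (hL₁ : 0 < L₁) (hμ : 0 < μ) {Q Φ : ℝ} (hQ : 0 ≤ Q) (hΦ : 0 ≤ Φ) :
    0 < maxStep L₁ L₂ μ Q Φ := by
  have h1 := decayRate_pos (L₂ := L₂) hL₁ hμ
  have h2 := energyScale_nonneg (L₂ := L₂) hL₁ hμ hQ hΦ
  have h3 := embConst_nonneg (L₁ := L₁) (L₂ := L₂)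
  unfold maxStep
  refine lt_min (lt_min one_pos (by positivity)) (by positivity)

theorem energy_init_le (H : IsTrajectory L₁ L₂ μ k a g) (hνk : decayRate L₁ L₂ μ * k ≤ 1) {Q : ℝ}
    (h0 : sobSq L₁ L₂ 1 (a 0) ≤ Q) (h1 : sobSq L₁ L₂ 1 (a 1) ≤ Q) :
    bdfEnergy L₁ L₂ 0 (decayRate L₁ L₂ μ * k) (a 0) (a 1) ≤ 6 * poincareRoot L₁ L₂ * Q := by
  have h2 := bdfEnergy_le hνk (H.sob_zero 0) (H.sob_zero 1)
  have hr := poincareRoot_pos (L₂ := L₂) H.pos₁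
  have h3 := sobSq_le_succ H.pos₁ H.pos₂ (H.zero 0) (H.sob_one 0)
  have h4 := sobSq_le_succ H.pos₁ H.pos₂ (H.zero 1) (H.sob_one 1)
  have h5 := mul_le_mul_of_nonneg_left h0 hr.le
  have h6 := mul_le_mul_of_nonneg_left h1 hr.le
  linarith

/-- For small time steps, the velocity is bounded in terms of the time step along the whole
trajectory: the energy estimate bounds `k |∇ω|²`, and hence `k^{1/2} |ω|_{H^{1/2}}²`. -/
theorem IsTrajectory.small (H : IsTrajectory L₁ L₂ μ k a g) {Q Φ : ℝ}
    (hk : k ≤ maxStep L₁ L₂ μ Q Φ) (hΦ : ∀ n, dualSq L₁ L₂ (g n) ≤ Φ)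
    (h0 : sobSq L₁ L₂ 1 (a 0) ≤ Q) (h1 : sobSq L₁ L₂ 1 (a 1) ≤ Q) :
    decayRate L₁ L₂ μ * k ≤ 1 ∧
    ∀ n, 16 * k * velNorm L₁ L₂ (extrap (a n) (a (n + 1))) ^ 2 ≤ μ := by
  have hk0 := H.k_pos
  have hμ := H.μ_pos
  have hν := decayRate_pos (L₂ := L₂) H.pos₁ H.μ_pos
  have hQ0 : 0 ≤ Q := sobSq_nonneg.trans h0
  have hΦ0 : 0 ≤ Φ := dualSq_nonneg.trans (hΦ 0)
  have hK0 := energyScale_nonneg (L₂ := L₂) H.pos₁ hμ hQ0 hΦ0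
  have hC := embConst_nonneg (L₁ := L₁) (L₂ := L₂)
  have hk1 : k ≤ 1 := hk.trans ((min_le_left _ _).trans (min_le_left _ _))
  have hνk : decayRate L₁ L₂ μ * k ≤ 1 := by
    have := hk.trans ((min_le_left _ _).trans (min_le_right _ _))
    rw [le_div_iff₀ hν] at this
    linarith
  have hk3 := hk.trans (min_le_right _ _)
  set K := energyScale L₁ L₂ μ Q Φ with hK
  set B := Q + 2 * K + K / μ with hB
  have hB0 : 0 ≤ B := by positivity
  have hs0 : 0 < √k := Real.sqrt_pos.mpr hk0
  have hsk : √k * √k = k := Real.mul_self_sqrt hk0.le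
  have hs1 : √k ≤ 1 := Real.sqrt_le_one.mpr hk1
  have hs3 : √k * (160 * embConst L₁ L₂ * B + 1) ≤ μ := by
    rw [← le_div_iff₀ (by positivity)]
    exact Real.sqrt_le_iff.mpr ⟨by positivity, hk3⟩
  refine ⟨hνk, fun n => ?_⟩
  induction n using Nat.strong_induction_on with
  | _ n ih =>
    have hN : ∀ j ≤ n + 1, k * sobSq L₁ L₂ 1 (a j) ≤ √k * B := by
      have hinit : ∀ {x : ℝ}, x ≤ Q → 0 ≤ x → k * x ≤ √k * B := fun {x} hx hx0 => by
        have hQB : x ≤ B := hx.trans (by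
          rw [hB, add_assoc]
          exact le_add_of_nonneg_right (by positivity))
        calc k * x = √k * √k * x := by rw [hsk]
          _ ≤ √k * 1 * B := by gcongr
          _ = √k * B := by ring
      intro j hj
      match j with
      | 0 => exact hinit h0 sobSq_nonneg
      | 1 => exact hinit h1 sobSq_nonneg
      | j + 2 =>
        have h2 := H.energy_decay hνk hΦ j (fun i hi => ih i (by omega))
        have h3 : Real.exp (-(decayRate L₁ L₂ μ * j * k / 2)) ≤ 1 :=
          Real.exp_le_one_iff.mpr (neg_nonpos.mpr (by positivity))
        have h4 := energy_init_le H hνk h0 h1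
        have h5 : 0 ≤ bdfEnergy L₁ L₂ 0 (decayRate L₁ L₂ μ * k) (a 0) (a 1) :=
          bdfEnergy_nonneg (by positivity)
        have h6 := mul_le_mul_of_nonneg_right h3 h5
        have h7 : bdfEnergy L₁ L₂ 0 (decayRate L₁ L₂ μ * k) (a (j + 1)) (a (j + 2)) +
            μ * k * sobSq L₁ L₂ 2 (a (j + 2)) ≤ K := by
          rw [hK, energyScale]; linarith
        have h8 : sobSq L₁ L₂ 0 (a (j + 2)) ≤
            2 * bdfEnergy L₁ L₂ 0 (decayRate L₁ L₂ μ * k) (a (j + 1)) (a (j + 2)) :=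
          sobSq_le_bdfEnergy (by positivity)
        have h9 : 0 ≤ bdfEnergy L₁ L₂ 0 (decayRate L₁ L₂ μ * k) (a (j + 1)) (a (j + 2)) :=
          bdfEnergy_nonneg (by positivity)
        have h10 := sobSq_nonneg (L₁ := L₁) (L₂ := L₂) (n := 2) (a := a (j + 2))
        have h11 : 0 ≤ μ * k * sobSq L₁ L₂ 2 (a (j + 2)) := by positivity
        have h12 : k * sobSq L₁ L₂ 2 (a (j + 2)) ≤ K / μ := by
          rw [le_div_iff₀ hμ]; linarith
        -- interpolation with weight `k^{1/2}`
        have h13 := (sobSq_succ_le (n := 0) hs0 (H.sob_zero (j + 2)) (H.sob_two j)).2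
        calc k * sobSq L₁ L₂ 1 (a (j + 2))
            ≤ k * ((√k)⁻¹ * sobSq L₁ L₂ 0 (a (j + 2)) + √k * sobSq L₁ L₂ 2 (a (j + 2))) := by
              gcongr
          _ = √k * sobSq L₁ L₂ 0 (a (j + 2)) + √k * (k * sobSq L₁ L₂ 2 (a (j + 2))) := by
              rw [mul_add, ← mul_assoc]
              congr 1
              · rw [← div_eq_mul_inv, Real.div_sqrt]
              · ring
          _ ≤ √k * (2 * K) + √k * (K / μ) := by
              gcongr
              linarith
          _ = √k * (2 * K + K / μ) := by ring
          _ ≤ √k * B := by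
              gcongr
              rw [hB, add_assoc]
              exact le_add_of_nonneg_left hQ0
    have hv := (velNorm_sq_le H.pos₁ H.pos₂ ((H.sob_one n).extrap (H.sob_one (n + 1)))).2
    have hx := sobSq_extrap_le (H.sob_one n) (H.sob_one (n + 1))
    have hn := hN n (by omega)
    have hn1 := hN (n + 1) le_rfl
    calc 16 * k * velNorm L₁ L₂ (extrap (a n) (a (n + 1))) ^ 2
        ≤ 16 * k *
            (embConst L₁ L₂ * (8 * sobSq L₁ L₂ 1 (a (n + 1)) + 2 * sobSq L₁ L₂ 1 (a n))) := by
          gcongr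
          exact hv.trans (by gcongr)
      _ = 16 * embConst L₁ L₂ *
          (8 * (k * sobSq L₁ L₂ 1 (a (n + 1))) + 2 * (k * sobSq L₁ L₂ 1 (a n))) := by ring
      _ ≤ 16 * embConst L₁ L₂ * (8 * (√k * B) + 2 * (√k * B)) := by gcongr
      _ = √k * (160 * embConst L₁ L₂ * B) := by ring
      _ ≤ √k * (160 * embConst L₁ L₂ * B + 1) := by gcongr; linarith
      _ ≤ μ := hs3

end Trajectory

/-! ### Bounds in `H¹` -/

/-- A trajectory with a time step that is small compared to the viscosity and the velocity,
together with the number `N` of steps in a time window of length about `1 / ν`. -/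
structure IsStable (L₁ L₂ μ k : ℝ) (N : ℕ) (a g : ℕ → Coeffs) : Prop
    extends IsTrajectory L₁ L₂ μ k a g where
  rate_mul_le : decayRate L₁ L₂ μ * k ≤ 1
  small : ∀ n, 16 * k * velNorm L₁ L₂ (extrap (a n) (a (n + 1))) ^ 2 ≤ μ
  window_pos : 0 < N
  le_window : 1 / decayRate L₁ L₂ μ ≤ N * k
  window_le : N * k ≤ 2 / decayRate L₁ L₂ μ

theorem exists_window {ν k : ℝ} (hν : 0 < ν) (hk : 0 < k) (hνk : ν * k ≤ 1) :
    ∃ N : ℕ, 0 < N ∧ 1 / ν ≤ N * k ∧ N * k ≤ 2 / ν := by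
  have hpos : 0 < 1 / (ν * k) := by positivity
  refine ⟨⌈1 / (ν * k)⌉₊, Nat.ceil_pos.mpr hpos, ?_, ?_⟩
  · have := mul_le_mul_of_nonneg_right (Nat.le_ceil (1 / (ν * k))) hk.le
    refine le_trans (le_of_eq ?_) this
    field_simp
  · have := mul_le_mul_of_nonneg_right (Nat.ceil_lt_add_one hpos.le).le hk.le
    refine this.trans ?_
    rw [le_div_iff₀ hν]
    have : (1 / (ν * k) + 1) * k * ν = 1 + ν * k := by field_simp
    linarith

section Regularity

variable {L₁ L₂ μ k : ℝ} {N : ℕ} {a g : ℕ → Coeffs}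

/-- The bound for the energy of order one after a window in which the dissipation sums to `S`. -/
def sobOneBound (L₁ L₂ μ S Φ₀ : ℝ) : ℝ :=
  (6 * S * decayRate L₁ L₂ μ + 4 * Φ₀ / (μ * decayRate L₁ L₂ μ)) *
    Real.exp (40 * (embConst L₁ L₂ * poincareRoot L₁ L₂) * S / μ)

namespace IsStable

theorem rate_pos (H : IsStable L₁ L₂ μ k N a g) : 0 < decayRate L₁ L₂ μ :=
  decayRate_pos H.pos₁ H.μ_pos

theorem succ_window_le (H : IsStable L₁ L₂ μ k N a g) :
    ((N + 1 : ℕ) : ℝ) * k ≤ 3 / decayRate L₁ L₂ μ := by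
  have h := H.window_le
  have hν := H.rate_pos
  have h2 := H.rate_mul_le
  have h3 : k ≤ 1 / decayRate L₁ L₂ μ := by rw [le_div_iff₀ hν]; linarith
  have : 3 / decayRate L₁ L₂ μ = 2 / decayRate L₁ L₂ μ + 1 / decayRate L₁ L₂ μ := by ring
  push_cast
  linarith

theorem sob_extrap (H : IsStable L₁ L₂ μ k N a g) {i n : ℕ} (h0 : SobSummable L₁ L₂ i (a n))
    (h1 : SobSummable L₁ L₂ i (a (n + 1))) :
    extrap (a n) (a (n + 1)) 0 = 0 ∧ SobSummable L₁ L₂ i (extrap (a n) (a (n + 1))) :=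
  ⟨extrap_zero (H.zero n) (H.zero (n + 1)), h0.extrap h1⟩

theorem emb_nonneg (H : IsStable L₁ L₂ μ k N a g) :
    0 ≤ embConst L₁ L₂ * poincareRoot L₁ L₂ :=
  mul_nonneg embConst_nonneg (poincareRoot_pos H.pos₁).le

theorem velNorm_sq_le_sob (H : IsStable L₁ L₂ μ k N a g) {u : Coeffs} (hu0 : u 0 = 0)
    (hu : SobSummable L₁ L₂ 2 u) :
    velNorm L₁ L₂ u ^ 2 ≤ embConst L₁ L₂ * poincareRoot L₁ L₂ * sobSq L₁ L₂ 2 u := by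
  refine (velNorm_sq_le H.pos₁ H.pos₂ (hu.of_succ H.pos₁ H.pos₂ hu0)).2.trans ?_
  rw [mul_assoc]
  exact mul_le_mul_of_nonneg_left (sobSq_le_succ H.pos₁ H.pos₂ hu0 hu) embConst_nonneg

theorem absSum_sq_le_sob (H : IsStable L₁ L₂ μ k N a g) {u : Coeffs} (hu0 : u 0 = 0)
    (hu : SobSummable L₁ L₂ 4 u) :
    absSum u ^ 2 ≤ embConst L₁ L₂ * poincareRoot L₁ L₂ * sobSq L₁ L₂ 4 u := by
  refine (absSum_sq_le H.pos₁ H.pos₂ hu0 (hu.of_succ H.pos₁ H.pos₂ hu0)).2.trans ?_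
  rw [mul_assoc]
  exact mul_le_mul_of_nonneg_left (sobSq_le_succ H.pos₁ H.pos₂ hu0 hu) embConst_nonneg

theorem jac_le (H : IsStable L₁ L₂ μ k N a g) {u : Coeffs} (hu0 : u 0 = 0)
    (hu : SobSummable L₁ L₂ 2 u) : SobSummable L₁ L₂ 0 (jac L₁ L₂ u u) ∧
    sobSq L₁ L₂ 0 (jac L₁ L₂ u u) ≤
      embConst L₁ L₂ * poincareRoot L₁ L₂ * sobSq L₁ L₂ 2 u ^ 2 := by
  obtain ⟨h1, h2⟩ := jac_sob_zero_le
    (velNorm_sq_le H.pos₁ H.pos₂ (hu.of_succ H.pos₁ H.pos₂ hu0)).1 hu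
  refine ⟨h1, h2.trans ?_⟩
  rw [sq (sobSq L₁ L₂ 2 u), ← mul_assoc]
  exact mul_le_mul_of_nonneg_right (H.velNorm_sq_le_sob hu0 hu) sobSq_nonneg

/-- One step in `H¹`, with the advection term as a forcing. -/
theorem sob_one_step (H : IsStable L₁ L₂ μ k N a g) {n : ℕ} {Φ₀ : ℝ}
    (h0 : SobSummable L₁ L₂ 2 (a n)) (h1 : SobSummable L₁ L₂ 2 (a (n + 1)))
    (hg : SobSummable L₁ L₂ 0 (g (n + 1))) (hΦ : sobSq L₁ L₂ 0 (g (n + 1)) ≤ Φ₀) :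
    SobSummable L₁ L₂ 4 (a (n + 2)) ∧
    bdfEnergy L₁ L₂ 2 0 (a (n + 1)) (a (n + 2)) + k * μ * sobSq L₁ L₂ 4 (a (n + 2)) ≤
      bdfEnergy L₁ L₂ 2 0 (a n) (a (n + 1)) + 2 * k / μ * (Φ₀ +
        embConst L₁ L₂ * poincareRoot L₁ L₂ * sobSq L₁ L₂ 2 (extrap (a n) (a (n + 1))) ^ 2) := by
  obtain ⟨hΩ0, hΩ⟩ := H.sob_extrap h0 h1
  obtain ⟨j1, j2⟩ := H.jac_le hΩ0 hΩ
  obtain ⟨s1, s2⟩ := regularity_step (n := 2) H.pos₁ H.pos₂ H.k_pos H.μ_pos h0 h1 (H.zero _)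
    (H.zero _) (H.zero _) (hg.hasSum.add j1.hasSum) (fun κ => by
      rw [← mul_add, pow_zero, one_mul, ← mul_assoc]
      refine mul_le_of_le_one_left (by positivity) mul_inv_le_one) (H.step n)
  refine ⟨s1, s2.trans ?_⟩
  have := H.k_pos
  have := H.μ_pos
  gcongr
  · exact hΦ
  · exact j2

/-- The advection term is quadratic in a quantity that the energy bounds. One factor is left in the
growth rate, where the dissipation over a window controls its sum. -/
theorem sob_one_step' (H : IsStable L₁ L₂ μ k N a g) {n : ℕ} {Φ₀ : ℝ}
    (h0 : SobSummable L₁ L₂ 2 (a n)) (h1 : SobSummable L₁ L₂ 2 (a (n + 1)))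
    (hg : SobSummable L₁ L₂ 0 (g (n + 1))) (hΦ : sobSq L₁ L₂ 0 (g (n + 1)) ≤ Φ₀) :
    bdfEnergy L₁ L₂ 2 0 (a (n + 1)) (a (n + 2)) ≤
      (1 + 4 * k * (embConst L₁ L₂ * poincareRoot L₁ L₂) / μ *
        sobSq L₁ L₂ 2 (extrap (a n) (a (n + 1)))) * bdfEnergy L₁ L₂ 2 0 (a n) (a (n + 1)) +
        2 * k / μ * Φ₀ := by
  have h2 := (H.sob_one_step h0 h1 hg hΦ).2
  have h3 : sobSq L₁ L₂ 2 (extrap (a n) (a (n + 1))) ≤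
    2 * bdfEnergy L₁ L₂ 2 0 (a n) (a (n + 1)) := sobSq_extrap_le_bdfEnergy le_rfl
  set X := sobSq L₁ L₂ 2 (extrap (a n) (a (n + 1)))
  have hX : 0 ≤ X := sobSq_nonneg
  have hk := H.k_pos
  have hμ := H.μ_pos
  have h4 : 0 ≤ k * μ * sobSq L₁ L₂ 4 (a (n + 2)) := mul_nonneg (by positivity) sobSq_nonneg
  have hc := H.emb_nonneg
  set c := embConst L₁ L₂ * poincareRoot L₁ L₂
  have h5 : 2 * k / μ * (c * X ^ 2) ≤
      4 * k * c / μ * X * bdfEnergy L₁ L₂ 2 0 (a n) (a (n + 1)) := by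
    calc 2 * k / μ * (c * X ^ 2) = 2 * k * c / μ * X * X := by ring
      _ ≤ 2 * k * c / μ * X * (2 * bdfEnergy L₁ L₂ 2 0 (a n) (a (n + 1))) := by gcongr
      _ = _ := by ring
  linarith

theorem window_sum_extrap (H : IsStable L₁ L₂ μ k N a g) {i m : ℕ} {S : ℝ}
    (hs : ∀ n ≥ m, SobSummable L₁ L₂ i (a n))
    (hS : ∑ j ∈ Finset.range (N + 1), k * sobSq L₁ L₂ i (a (m + j)) ≤ S) :
    (∑ j ∈ Finset.range N, k * sobSq L₁ L₂ i (extrap (a (m + j)) (a (m + j + 1))) ≤ 10 * S) ∧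
    ∑ j ∈ Finset.range N, k * bdfEnergy L₁ L₂ i 0 (a (m + j)) (a (m + j + 1)) ≤ 6 * S := by
  have hk := H.k_pos
  have hy : ∀ n, 0 ≤ k * sobSq L₁ L₂ i (a n) := fun n => mul_nonneg hk.le sobSq_nonneg
  constructor
  · refine (sum_pair_le (p := 8) (q := 2) (by norm_num) (by norm_num) hy
      (x := fun n => k * sobSq L₁ L₂ i (extrap (a n) (a (n + 1)))) (fun j => ?_) hS).trans_eq
      (by norm_num)
    have := mul_le_mul_of_nonneg_left (sobSq_extrap_le (hs (m + j) (by omega))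
      (hs (m + j + 1) (by omega))) hk.le
    linarith
  · refine (sum_pair_le (p := 5) (q := 1) (by norm_num) (by norm_num) hy
      (x := fun n => k * bdfEnergy L₁ L₂ i 0 (a n) (a (n + 1))) (fun j => ?_) hS).trans_eq
      (by norm_num)
    have := mul_le_mul_of_nonneg_left (bdfEnergy_le zero_le_one (hs (m + j) (by omega))
      (hs (m + j + 1) (by omega))) hk.le
    linarith

/-- A window has at least `1 / (ν k)` steps. -/
theorem div_window_le (H : IsStable L₁ L₂ μ k N a g) {S : ℝ} (hS : 0 ≤ S) :
    S / k / N ≤ S * decayRate L₁ L₂ μ := by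
  have hk := H.k_pos
  have hν := H.rate_pos
  have hN : (0 : ℝ) < N := by exact_mod_cast H.window_pos
  have h := H.le_window
  rw [div_le_iff₀ hν] at h
  rw [div_div, div_le_iff₀ (by positivity)]
  calc S = S * 1 := (mul_one S).symm
    _ ≤ S * (N * k * decayRate L₁ L₂ μ) := by gcongr
    _ = _ := by ring

/-- The uniform Gronwall inequality in `H¹`: a bound at the end of a time window in which
the dissipation is bounded. -/
theorem sob_one_window (H : IsStable L₁ L₂ μ k N a g) {m : ℕ} {S Φ₀ : ℝ}
    (hg : ∀ n, SobSummable L₁ L₂ 0 (g n)) (hΦ : ∀ n, sobSq L₁ L₂ 0 (g n) ≤ Φ₀)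
    (hs : ∀ n ≥ m, SobSummable L₁ L₂ 2 (a n))
    (hS : ∑ j ∈ Finset.range (N + 1), k * sobSq L₁ L₂ 2 (a (m + j)) ≤ S) :
    bdfEnergy L₁ L₂ 2 0 (a (m + N)) (a (m + N + 1)) ≤ sobOneBound L₁ L₂ μ S Φ₀ := by
  have hk := H.k_pos
  have hμ := H.μ_pos
  have hν := H.rate_pos
  have hc := H.emb_nonneg
  have hΦ0 : 0 ≤ Φ₀ := sobSq_nonneg.trans (hΦ 0)
  obtain ⟨w1, w2⟩ := H.window_sum_extrap hs hS
  have hS0 : 0 ≤ S := le_trans (Finset.sum_nonneg fun _ _ => mul_nonneg hk.le sobSq_nonneg) hS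
  rw [← Finset.mul_sum] at w2
  have hX : ∑ j ∈ Finset.range N, bdfEnergy L₁ L₂ 2 0 (a (m + j)) (a (m + j + 1)) ≤ 6 * S / k := by
    rw [le_div_iff₀ hk]; linarith
  have hG : ∑ j ∈ Finset.range N, 4 * k * (embConst L₁ L₂ * poincareRoot L₁ L₂) / μ *
      sobSq L₁ L₂ 2 (extrap (a (m + j)) (a (m + j + 1))) ≤
      40 * (embConst L₁ L₂ * poincareRoot L₁ L₂) * S / μ := by
    rw [← Finset.mul_sum] at w1 ⊢
    calc _ = 4 * (embConst L₁ L₂ * poincareRoot L₁ L₂) / μ *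
          (k * ∑ j ∈ Finset.range N, sobSq L₁ L₂ 2 (extrap (a (m + j)) (a (m + j + 1)))) := by ring
      _ ≤ 4 * (embConst L₁ L₂ * poincareRoot L₁ L₂) / μ * (10 * S) := by gcongr
      _ = _ := by ring
  have := uniform_gronwall (x := fun j => bdfEnergy L₁ L₂ 2 0 (a (m + j)) (a (m + j + 1)))
    (g := fun j => 4 * k * (embConst L₁ L₂ * poincareRoot L₁ L₂) / μ *
      sobSq L₁ L₂ 2 (extrap (a (m + j)) (a (m + j + 1)))) (h := 2 * k / μ * Φ₀) H.window_pos
    (by positivity) (fun j => mul_nonneg (by positivity) sobSq_nonneg)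
    (fun j => bdfEnergy_nonneg le_rfl)
    (fun j _ => H.sob_one_step' (hs _ (Nat.le_add_right m j))
      (hs _ ((Nat.le_add_right m j).trans (Nat.le_succ _))) (hg _) (hΦ _)) hX hG
  refine this.trans ?_
  unfold sobOneBound
  have h1 := H.div_window_le (S := 6 * S) (by positivity)
  have h2 : N * (2 * k / μ * Φ₀) ≤ 4 * Φ₀ / (μ * decayRate L₁ L₂ μ) := by
    calc N * (2 * k / μ * Φ₀) = (N * k) * (2 / μ * Φ₀) := by ring
      _ ≤ 2 / decayRate L₁ L₂ μ * (2 / μ * Φ₀) := by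
        have := H.window_le
        gcongr
      _ = _ := by field_simp; ring
  gcongr

/-- The dissipation in a time window, when the energy is bounded. -/
theorem dissipation_window (H : IsStable L₁ L₂ μ k N a g) {m : ℕ} {K Φ : ℝ}
    (hΦ : ∀ n, dualSq L₁ L₂ (g n) ≤ Φ)
    (hK : bdfEnergy L₁ L₂ 0 (decayRate L₁ L₂ μ * k) (a m) (a (m + 1)) ≤ K) :
    ∑ j ∈ Finset.range (N + 1), k * sobSq L₁ L₂ 2 (a (m + 2 + j)) ≤
      (K + 12 * Φ / (μ * decayRate L₁ L₂ μ)) / μ := by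
  have hk := H.k_pos
  have hμ := H.μ_pos
  have hν := H.rate_pos
  have hΦ0 : 0 ≤ Φ := dualSq_nonneg.trans (hΦ 0)
  set ν := decayRate L₁ L₂ μ with hν'
  have hρ1 : (1 + ν * k)⁻¹ ≤ 1 := inv_le_one_of_one_le₀ (by linarith [mul_pos hν hk])
  have h1 := telescope_le (x := fun n => bdfEnergy L₁ L₂ 0 (ν * k) (a n) (a (n + 1)))
    (y := fun n => μ * k * sobSq L₁ L₂ 2 (a (n + 2))) (c := 4 * k / μ * Φ) m (fun j => by
      have e := H.energy_le H.rate_mul_le (m + j) (hΦ _) (H.small _)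
      have e0 : 0 ≤ bdfEnergy L₁ L₂ 0 (ν * k) (a (m + j)) (a (m + j + 1)) :=
        bdfEnergy_nonneg (by positivity)
      have := mul_le_mul_of_nonneg_right hρ1 e0
      simp only [← hν'] at e
      linarith) (N + 1)
  have h2 : 0 ≤ bdfEnergy L₁ L₂ 0 (ν * k) (a (m + (N + 1))) (a (m + (N + 1) + 1)) :=
    bdfEnergy_nonneg (by positivity)
  have h3 : ((N + 1 : ℕ) : ℝ) * (4 * k / μ * Φ) ≤ 12 * Φ / (μ * ν) := by
    calc ((N + 1 : ℕ) : ℝ) * (4 * k / μ * Φ) = (((N + 1 : ℕ) : ℝ) * k) * (4 / μ * Φ) := by ring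
      _ ≤ 3 / ν * (4 / μ * Φ) := by
        have := H.succ_window_le
        gcongr
      _ = _ := by field_simp; ring
  rw [le_div_iff₀ hμ]
  have e : (∑ j ∈ Finset.range (N + 1), k * sobSq L₁ L₂ 2 (a (m + 2 + j))) * μ =
      ∑ j ∈ Finset.range (N + 1), μ * k * sobSq L₁ L₂ 2 (a (m + j + 2)) := by
    rw [Finset.sum_mul]
    refine Finset.sum_congr rfl fun j _ => ?_
    rw [add_right_comm]
    ring
  rw [e]
  linarith

/-- Bound in `H¹` for all times, for initial data in `H¹`. -/
theorem sob_one_all (H : IsStable L₁ L₂ μ k N a g) {Q K Φ Φ₀ : ℝ}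
    (hΦ : ∀ n, dualSq L₁ L₂ (g n) ≤ Φ) (hg : ∀ n, SobSummable L₁ L₂ 0 (g n))
    (hΦ₀ : ∀ n, sobSq L₁ L₂ 0 (g n) ≤ Φ₀)
    (hK : ∀ n, bdfEnergy L₁ L₂ 0 (decayRate L₁ L₂ μ * k) (a n) (a (n + 1)) ≤ K)
    (hs0 : SobSummable L₁ L₂ 2 (a 0)) (hs1 : SobSummable L₁ L₂ 2 (a 1))
    (hQ0 : sobSq L₁ L₂ 2 (a 0) ≤ Q) (hQ1 : sobSq L₁ L₂ 2 (a 1) ≤ Q) (n : ℕ) :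
    bdfEnergy L₁ L₂ 2 0 (a n) (a (n + 1)) ≤ 6 * Q * Real.exp (40 * (embConst L₁ L₂ *
        poincareRoot L₁ L₂) * (2 * Q / decayRate L₁ L₂ μ +
        (K + 12 * Φ / (μ * decayRate L₁ L₂ μ)) / μ) / μ) +
      sobOneBound L₁ L₂ μ (2 * Q / decayRate L₁ L₂ μ +
        (K + 12 * Φ / (μ * decayRate L₁ L₂ μ)) / μ) Φ₀ := by
  have hk := H.k_pos
  have hμ := H.μ_pos
  have hν := H.rate_pos
  have hc := H.emb_nonneg
  have hQ : 0 ≤ Q := sobSq_nonneg.trans hQ0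
  have hΦ0 : 0 ≤ Φ₀ := sobSq_nonneg.trans (hΦ₀ 0)
  have hs : ∀ n, SobSummable L₁ L₂ 2 (a n)
    | 0 => hs0
    | 1 => hs1
    | n + 2 => H.sob_two n
  set S := 2 * Q / decayRate L₁ L₂ μ + (K + 12 * Φ / (μ * decayRate L₁ L₂ μ)) / μ with hSdef
  have hS : ∀ m, ∑ j ∈ Finset.range (N + 1), k * sobSq L₁ L₂ 2 (a (m + j)) ≤ S := by
    intro m
    refine (sum_shift_le (y := fun n => k * sobSq L₁ L₂ 2 (a n))
      (fun n => mul_nonneg hk.le sobSq_nonneg)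
      (fun m => H.dissipation_window hΦ (hK m)) m).trans ?_
    have hk1 : k ≤ 1 / decayRate L₁ L₂ μ := by
      rw [le_div_iff₀ hν]; linarith [H.rate_mul_le]
    have h0 : k * sobSq L₁ L₂ 2 (a 0) ≤ 1 / decayRate L₁ L₂ μ * Q :=
      mul_le_mul hk1 hQ0 sobSq_nonneg (by positivity)
    have h1 : k * sobSq L₁ L₂ 2 (a 1) ≤ 1 / decayRate L₁ L₂ μ * Q :=
      mul_le_mul hk1 hQ1 sobSq_nonneg (by positivity)
    rw [hSdef]
    have : 2 * Q / decayRate L₁ L₂ μ = 1 / decayRate L₁ L₂ μ * Q + 1 / decayRate L₁ L₂ μ * Q := by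
      ring
    linarith
  have hS0 : 0 ≤ S := le_trans (Finset.sum_nonneg fun _ _ => mul_nonneg hk.le sobSq_nonneg) (hS 0)
  rcases le_total N n with hn | hn
  · obtain ⟨m, rfl⟩ := Nat.exists_eq_add_of_le' hn
    have := H.sob_one_window hg hΦ₀ (fun n _ => hs n) (hS m)
    exact this.trans (le_add_of_nonneg_left (by positivity))
  · -- in the first window, the bound comes from the initial data
    have h1 := discrete_gronwall (x := fun j => bdfEnergy L₁ L₂ 2 0 (a j) (a (j + 1)))
      (g := fun j => 4 * k * (embConst L₁ L₂ * poincareRoot L₁ L₂) / μ *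
        sobSq L₁ L₂ 2 (extrap (a j) (a (j + 1)))) (h := 2 * k / μ * Φ₀) (j := 0) (N := N)
      (by positivity) (fun j => mul_nonneg (by positivity) sobSq_nonneg)
      (bdfEnergy_nonneg le_rfl)
      (fun j _ => H.sob_one_step' (hs _) (hs _) (hg _) (hΦ₀ _)) n.zero_le hn
    have hS' := hS 0
    have hw := (H.window_sum_extrap (m := 0) (fun n _ => hs n) hS').1
    simp only [zero_add] at hw
    have hG : ∑ j ∈ Finset.Ico 0 n, 4 * k * (embConst L₁ L₂ * poincareRoot L₁ L₂) / μ *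
        sobSq L₁ L₂ 2 (extrap (a j) (a (j + 1))) ≤
        40 * (embConst L₁ L₂ * poincareRoot L₁ L₂) * S / μ := by
      rw [Nat.Ico_zero_eq_range]
      refine (Finset.sum_le_sum_of_subset_of_nonneg (Finset.range_mono hn)
        fun j _ _ => mul_nonneg (by positivity) sobSq_nonneg).trans ?_
      rw [← Finset.mul_sum] at hw ⊢
      calc _ = 4 * (embConst L₁ L₂ * poincareRoot L₁ L₂) / μ *
            (k * ∑ j ∈ Finset.range N, sobSq L₁ L₂ 2 (extrap (a j) (a (j + 1)))) := by ring
        _ ≤ 4 * (embConst L₁ L₂ * poincareRoot L₁ L₂) / μ * (10 * S) := by gcongr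
        _ = _ := by ring
    have h2 : n * (2 * k / μ * Φ₀) ≤ 4 * Φ₀ / (μ * decayRate L₁ L₂ μ) := by
      calc n * (2 * k / μ * Φ₀) ≤ N * (2 * k / μ * Φ₀) := by gcongr
        _ = (N * k) * (2 / μ * Φ₀) := by ring
        _ ≤ 2 / decayRate L₁ L₂ μ * (2 / μ * Φ₀) := by
          have := H.window_le
          gcongr
        _ = _ := by field_simp; ring
    have h3 : bdfEnergy L₁ L₂ 2 0 (a 0) (a 1) ≤ 6 * Q := by
      have := bdfEnergy_le (n := 2) (a := 0) zero_le_one hs0 hs1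
      linarith
    refine h1.trans ?_
    calc _ ≤ (6 * Q + 4 * Φ₀ / (μ * decayRate L₁ L₂ μ)) *
          Real.exp (40 * (embConst L₁ L₂ * poincareRoot L₁ L₂) * S / μ) := by gcongr
      _ ≤ _ := by
        unfold sobOneBound
        rw [← add_mul, ← add_assoc]
        have : 0 ≤ 6 * S * decayRate L₁ L₂ μ := by positivity
        gcongr
        linarith

end IsStable

end Regularity

/-! ### Increments, and bounds in `H²` -/

/-- The sequence `a` has squared norm of order `n / 2` at most `B`. -/
def SobBound (L₁ L₂ : ℝ) (n : ℕ) (a : Coeffs) (B : ℝ) : Prop :=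
  SobSummable L₁ L₂ n a ∧ sobSq L₁ L₂ n a ≤ B

/-- The squared `L²` norm of the increment `a (n + 1) - a n`. -/
def incSq (L₁ L₂ : ℝ) (a : ℕ → Coeffs) (n : ℕ) : ℝ :=
  sobSq L₁ L₂ 0 fun κ => a (n + 1) κ - a n κ

section Increments

variable {L₁ L₂ μ k : ℝ} {N m : ℕ} {a g : ℕ → Coeffs} {M Φ₀ : ℝ}

theorem SobBound.nonneg {n : ℕ} {u : Coeffs} {B : ℝ} (h : SobBound L₁ L₂ n u B) : 0 ≤ B :=
  sobSq_nonneg.trans h.2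

theorem SobBound.extrap {n : ℕ} {u v : Coeffs} {B : ℝ} (hu : SobBound L₁ L₂ n u B)
    (hv : SobBound L₁ L₂ n v B) : SobBound L₁ L₂ n (extrap u v) (10 * B) :=
  ⟨hu.1.extrap hv.1, by linarith [sobSq_extrap_le hu.1 hv.1, hu.2, hv.2]⟩

theorem sobSq_zero_le_two (hL₁ : 0 < L₁) (hL₂ : 0 < L₂) {u : Coeffs} (hu0 : u 0 = 0)
    (hu : SobSummable L₁ L₂ 2 u) :
    sobSq L₁ L₂ 0 u ≤ poincareRoot L₁ L₂ ^ 2 * sobSq L₁ L₂ 2 u := by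
  have hr := poincareRoot_pos (L₂ := L₂) hL₁
  have h1 := sobSq_le_succ hL₁ hL₂ hu0 hu
  have h2 := sobSq_le_succ hL₁ hL₂ hu0 (hu.of_succ hL₁ hL₂ hu0)
  have h3 := mul_le_mul_of_nonneg_left h1 hr.le
  rw [sq, mul_assoc]
  exact h2.trans h3

namespace IsStable

theorem step_le (H : IsStable L₁ L₂ μ k N a g) : k ≤ 1 / decayRate L₁ L₂ μ := by
  rw [le_div_iff₀ H.rate_pos]; linarith [H.rate_mul_le]

theorem div_window_le' (H : IsStable L₁ L₂ μ k N a g) {X : ℝ} (hX : 0 ≤ X) :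
    X / N ≤ k * (decayRate L₁ L₂ μ * X) := by
  have hk := H.k_pos
  have := H.div_window_le (S := X * k) (by positivity)
  rw [mul_div_cancel_right₀ _ hk.ne'] at this
  linarith

/-- The increments test the scheme: `2 |dⁿ⁺¹|² + k μ |∇ωⁿ⁺¹|² ≤ |dⁿ|² / 2 + k μ |∇ωⁿ|² + O(k²)`. -/
theorem incSq_step (H : IsStable L₁ L₂ μ k N a g) (hg : ∀ n, SobBound L₁ L₂ 0 (g n) Φ₀)
    (hM : ∀ n ≥ m, SobBound L₁ L₂ 2 (a n) M) {n : ℕ} (hn : m ≤ n) :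
    2 * incSq L₁ L₂ a (n + 1) + k * μ * sobSq L₁ L₂ 2 (a (n + 2)) ≤
      1 / 2 * incSq L₁ L₂ a n + k * μ * sobSq L₁ L₂ 2 (a (n + 1)) +
        4 * k ^ 2 * (Φ₀ + 100 * (embConst L₁ L₂ * poincareRoot L₁ L₂) * M ^ 2) := by
  have hΩ := (hM n hn).extrap (hM (n + 1) (by omega))
  obtain ⟨j1, j2⟩ := H.jac_le (extrap_zero (H.zero n) (H.zero (n + 1))) hΩ.1
  have hc := H.emb_nonneg
  refine (increment_step H.k_pos H.μ_pos (H.sob_zero n) (H.sob_zero (n + 1)) (H.sob_zero (n + 2))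
    (hM (n + 1) (by omega)).1 (hM (n + 2) (by omega)).1 (hg _).1 j1 (H.step n)).trans ?_
  have h1 : embConst L₁ L₂ * poincareRoot L₁ L₂ *
      sobSq L₁ L₂ 2 (PeriodicNS.extrap (a n) (a (n + 1))) ^ 2 ≤
      embConst L₁ L₂ * poincareRoot L₁ L₂ * (10 * M) ^ 2 := by
    have := sobSq_nonneg (L₁ := L₁) (L₂ := L₂) (n := 2) (a := PeriodicNS.extrap (a n) (a (n + 1)))
    gcongr
    exact hΩ.2
  have h2 : sobSq L₁ L₂ 0 (g (n + 1)) + sobSq L₁ L₂ 0 (jac L₁ L₂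
      (PeriodicNS.extrap (a n) (a (n + 1))) (PeriodicNS.extrap (a n) (a (n + 1)))) ≤
      Φ₀ + 100 * (embConst L₁ L₂ * poincareRoot L₁ L₂) * M ^ 2 := by
    have := (hg (n + 1)).2
    linarith
  have h3 : 0 ≤ 4 * k ^ 2 := by positivity
  have := mul_le_mul_of_nonneg_left h2 h3
  simp only [incSq]
  linarith

end IsStable

/-- Increments are of order `k^{1/2}` one time window after the vorticity is bounded in `H¹`: a
window has at least `1 / (ν k)` steps, so that the contraction reduces the initial value of `|d|²`
to order `k`, and the difference of the terms `k μ |∇ω|²` is also of order `k`. -/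
theorem exists_incSq_le (L₁ L₂ μ M Φ₀ : ℝ) : ∃ B, ∀ {k : ℝ} {N m : ℕ} {a g : ℕ → Coeffs},
    IsStable L₁ L₂ μ k N a g → (∀ n, SobBound L₁ L₂ 0 (g n) Φ₀) →
    (∀ n ≥ m, SobBound L₁ L₂ 2 (a n) M) → ∀ n ≥ m + N, incSq L₁ L₂ a n ≤ k * B := by
  refine ⟨decayRate L₁ L₂ μ * (4 * poincareRoot L₁ L₂ ^ 2 * M) + 2 * (1 / 2 * μ * M +
    2 / decayRate L₁ L₂ μ * (Φ₀ + 100 * (embConst L₁ L₂ * poincareRoot L₁ L₂) * M ^ 2)), ?_⟩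
  intro k N m a g H hg hM n hn
  obtain ⟨p, rfl⟩ := Nat.exists_eq_add_of_le' hn
  have hk := H.k_pos
  have hμ := H.μ_pos
  have hν := H.rate_pos
  have hc := H.emb_nonneg
  have hM0 : 0 ≤ M := (hM m le_rfl).nonneg
  have hΦ0 : 0 ≤ Φ₀ := (hg 0).nonneg
  set B := Φ₀ + 100 * (embConst L₁ L₂ * poincareRoot L₁ L₂) * M ^ 2 with hB
  have hB0 : 0 ≤ B := by positivity
  have hr : ∀ n ≥ m, sobSq L₁ L₂ 0 (a n) ≤ poincareRoot L₁ L₂ ^ 2 * M := fun n hn => by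
    have := (hM n hn).2
    refine (sobSq_zero_le_two H.pos₁ H.pos₂ (H.zero n) (hM n hn).1).trans ?_
    gcongr
  have h0 : incSq L₁ L₂ a (p + m) ≤ 4 * poincareRoot L₁ L₂ ^ 2 * M := by
    have := sobSq_sub_le (H.sob_zero (p + m + 1)) (H.sob_zero (p + m))
    have h1 := hr (p + m + 1) (by omega)
    have h2 := hr (p + m) (by omega)
    unfold incSq
    linarith
  have := contraction_le (x := incSq L₁ L₂ a) (c := k * (1 / 2 * μ * M + 2 / decayRate L₁ L₂ μ * B))
    (X := 4 * poincareRoot L₁ L₂ ^ 2 * M) (by positivity) (p + m) (fun j => by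
      have h1 := H.incSq_step hg hM (n := p + m + j) (by omega)
      have h2 : 0 ≤ k * μ * sobSq L₁ L₂ 2 (a (p + m + j + 2)) :=
        mul_nonneg (by positivity) sobSq_nonneg
      have h3 : k * μ * sobSq L₁ L₂ 2 (a (p + m + j + 1)) ≤ k * μ * M := by
        have := (hM (p + m + j + 1) (by omega)).2
        gcongr
      have h4 : k ^ 2 * B ≤ k * (1 / decayRate L₁ L₂ μ) * B := by
        rw [sq]
        have := H.step_le
        gcongr
      have h5 : k * (1 / decayRate L₁ L₂ μ) * B = k * (1 / decayRate L₁ L₂ μ * B) := by ring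
      have h6 : 2 / decayRate L₁ L₂ μ * B = 2 * (1 / decayRate L₁ L₂ μ * B) := by ring
      rw [h6, ← hB] at *
      nlinarith) (by positivity) h0 H.window_pos
  have h7 := H.div_window_le' (X := 4 * poincareRoot L₁ L₂ ^ 2 * M) (by positivity)
  rw [← add_assoc]
  linarith

/-- Sums of increments over a time window are of order `k`. -/
theorem exists_sum_incSq_le (L₁ L₂ μ M Φ₀ : ℝ) : ∃ B, 0 ≤ B ∧
    ∀ {k : ℝ} {N m : ℕ} {a g : ℕ → Coeffs},
    IsStable L₁ L₂ μ k N a g → (∀ n, SobBound L₁ L₂ 0 (g n) Φ₀) →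
    (∀ n ≥ m, SobBound L₁ L₂ 2 (a n) M) → ∀ n ≥ m + N + 1,
      ∑ j ∈ Finset.range (N + 1), incSq L₁ L₂ a (n + j) ≤ k * B := by
  obtain ⟨B₀, hB₀⟩ := exists_incSq_le L₁ L₂ μ M Φ₀
  set B := Φ₀ + 100 * (embConst L₁ L₂ * poincareRoot L₁ L₂) * M ^ 2 with hB
  refine ⟨max 0 (1 / 2 * B₀ + μ * M + 12 / decayRate L₁ L₂ μ * B), le_max_left _ _, ?_⟩
  intro k N m a g H hg hM n hn
  obtain ⟨p, rfl⟩ : ∃ p, n = p + 1 := ⟨n - 1, by omega⟩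
  have hk := H.k_pos
  have hμ := H.μ_pos
  have hν := H.rate_pos
  have hc := H.emb_nonneg
  have hΦ0 : 0 ≤ Φ₀ := (hg 0).nonneg
  have hB0 : 0 ≤ B := by positivity
  have h1 := telescope_le
    (x := fun n => 1 / 2 * incSq L₁ L₂ a n + k * μ * sobSq L₁ L₂ 2 (a (n + 1)))
    (y := fun n => 3 / 2 * incSq L₁ L₂ a (n + 1)) (c := 4 * k ^ 2 * B) p (fun j => by
      have := H.incSq_step hg hM (n := p + j) (by omega)
      linarith) (N + 1)
  have h2 : 0 ≤ 1 / 2 * incSq L₁ L₂ a (p + (N + 1)) +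
      k * μ * sobSq L₁ L₂ 2 (a (p + (N + 1) + 1)) :=
    add_nonneg (mul_nonneg (by norm_num) sobSq_nonneg) (mul_nonneg (by positivity) sobSq_nonneg)
  have h3 := hB₀ H hg hM p (by omega)
  have h4 : k * μ * sobSq L₁ L₂ 2 (a (p + 1)) ≤ k * μ * M := by
    have := (hM (p + 1) (by omega)).2
    gcongr
  have h5 : ((N + 1 : ℕ) : ℝ) * (4 * k ^ 2 * B) ≤ k * (12 / decayRate L₁ L₂ μ * B) := by
    calc ((N + 1 : ℕ) : ℝ) * (4 * k ^ 2 * B) = (((N + 1 : ℕ) : ℝ) * k) * (4 * k * B) := by ring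
      _ ≤ 3 / decayRate L₁ L₂ μ * (4 * k * B) := by
        have := H.succ_window_le
        gcongr
      _ = _ := by ring
  have h6 : ∑ j ∈ Finset.range (N + 1), incSq L₁ L₂ a (p + 1 + j) ≤
      ∑ j ∈ Finset.range (N + 1), 3 / 2 * incSq L₁ L₂ a (p + j + 1) := by
    refine Finset.sum_le_sum fun j _ => ?_
    rw [add_right_comm]
    have : 0 ≤ incSq L₁ L₂ a (p + j + 1) := sobSq_nonneg
    linarith
  calc _ ≤ k * (1 / 2 * B₀ + μ * M + 12 / decayRate L₁ L₂ μ * B) := by linarith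
    _ ≤ _ := by gcongr; exact le_max_right _ _

/-- The dissipation in `H¹` over a time window. -/
theorem exists_sob_two_window (L₁ L₂ μ M Φ₀ : ℝ) : ∃ S, ∀ {k : ℝ} {N m : ℕ} {a g : ℕ → Coeffs},
    IsStable L₁ L₂ μ k N a g → (∀ n, SobBound L₁ L₂ 0 (g n) Φ₀) →
    (∀ n ≥ m, SobBound L₁ L₂ 2 (a n) M) → (∀ n ≥ m + 2, SobSummable L₁ L₂ 4 (a n)) ∧
    ∀ n ≥ m + 2, ∑ j ∈ Finset.range (N + 1), k * sobSq L₁ L₂ 4 (a (n + j)) ≤ S := by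
  set B := Φ₀ + 100 * (embConst L₁ L₂ * poincareRoot L₁ L₂) * M ^ 2 with hB
  refine ⟨(6 * M + 6 / (μ * decayRate L₁ L₂ μ) * B) / μ, ?_⟩
  intro k N m a g H hg hM
  have hk := H.k_pos
  have hμ := H.μ_pos
  have hν := H.rate_pos
  have hc := H.emb_nonneg
  have hΦ0 : 0 ≤ Φ₀ := (hg 0).nonneg
  have hB0 : 0 ≤ B := by positivity
  have hstep : ∀ n ≥ m, SobSummable L₁ L₂ 4 (a (n + 2)) ∧
      bdfEnergy L₁ L₂ 2 0 (a (n + 1)) (a (n + 2)) + k * μ * sobSq L₁ L₂ 4 (a (n + 2)) ≤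
      bdfEnergy L₁ L₂ 2 0 (a n) (a (n + 1)) + 2 * k / μ * B := by
    intro n hn
    obtain ⟨s1, s2⟩ := H.sob_one_step (hM n hn).1 (hM (n + 1) (by omega)).1 (hg (n + 1)).1
      (hg (n + 1)).2
    refine ⟨s1, s2.trans ?_⟩
    have hΩ := ((hM n hn).extrap (hM (n + 1) (by omega))).2
    have h0 := sobSq_nonneg (L₁ := L₁) (L₂ := L₂) (n := 2) (a := extrap (a n) (a (n + 1)))
    have h1 : embConst L₁ L₂ * poincareRoot L₁ L₂ * sobSq L₁ L₂ 2 (extrap (a n) (a (n + 1))) ^ 2 ≤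
      embConst L₁ L₂ * poincareRoot L₁ L₂ * (10 * M) ^ 2 := by gcongr
    gcongr
    linarith
  refine ⟨fun n hn => ?_, fun n hn => ?_⟩
  · obtain ⟨p, rfl⟩ : ∃ p, n = p + 2 := ⟨n - 2, by omega⟩
    exact (hstep p (by omega)).1
  · obtain ⟨p, rfl⟩ : ∃ p, n = p + 2 := ⟨n - 2, by omega⟩
    have h1 := telescope_le (x := fun n => bdfEnergy L₁ L₂ 2 0 (a n) (a (n + 1)))
      (y := fun n => k * μ * sobSq L₁ L₂ 4 (a (n + 2))) (c := 2 * k / μ * B) p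
      (fun j => (hstep (p + j) (by omega)).2) (N + 1)
    have h2 : 0 ≤ bdfEnergy L₁ L₂ 2 0 (a (p + (N + 1))) (a (p + (N + 1) + 1)) :=
      bdfEnergy_nonneg le_rfl
    have h3 := bdfEnergy_le (a := 0) zero_le_one (hM p (by omega)).1 (hM (p + 1) (by omega)).1
    have h4 := (hM p (by omega)).2
    have h5 := (hM (p + 1) (by omega)).2
    have h6 : ((N + 1 : ℕ) : ℝ) * (2 * k / μ * B) ≤ 6 / (μ * decayRate L₁ L₂ μ) * B := by
      calc ((N + 1 : ℕ) : ℝ) * (2 * k / μ * B) = (((N + 1 : ℕ) : ℝ) * k) * (2 / μ * B) := by ring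
        _ ≤ 3 / decayRate L₁ L₂ μ * (2 / μ * B) := by
          have := H.succ_window_le
          gcongr
        _ = _ := by field_simp; ring
    rw [le_div_iff₀ hμ]
    have e : (∑ j ∈ Finset.range (N + 1), k * sobSq L₁ L₂ 4 (a (p + 2 + j))) * μ =
        ∑ j ∈ Finset.range (N + 1), k * μ * sobSq L₁ L₂ 4 (a (p + j + 2)) := by
      rw [Finset.sum_mul]
      refine Finset.sum_congr rfl fun j _ => ?_
      rw [add_right_comm]
      ring
    rw [e]
    linarith

theorem dualSq_sub_le {u v : Coeffs} (hu : DualSummable L₁ L₂ u) (hv : DualSummable L₁ L₂ v) :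
    DualSummable L₁ L₂ (fun κ => u κ - v κ) ∧
      dualSq L₁ L₂ (fun κ => u κ - v κ) ≤ 2 * dualSq L₁ L₂ u + 2 * dualSq L₁ L₂ v := by
  have key : ∀ κ, (waveNum L₁ L₂ κ ^ 2)⁻¹ * ‖u κ - v κ‖ ^ 2 ≤
      2 * ((waveNum L₁ L₂ κ ^ 2)⁻¹ * ‖u κ‖ ^ 2) + 2 * ((waveNum L₁ L₂ κ ^ 2)⁻¹ * ‖v κ‖ ^ 2) := by
    intro κ
    have := sq_norm_lin_le 1 1 (u κ) (v κ)
    norm_num at this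
    have := mul_le_mul_of_nonneg_left this (inv_nonneg.mpr (sq_nonneg (waveNum L₁ L₂ κ)))
    linarith
  have hs := (hu.hasSum.mul_left 2).add (hv.hasSum.mul_left 2)
  have h1 : DualSummable L₁ L₂ (fun κ => u κ - v κ) := Summable.of_nonneg_of_le
    (fun _ => mul_nonneg (inv_nonneg.mpr (sq_nonneg _)) (sq_nonneg _)) key hs.summable
  exact ⟨h1, hasSum_le key h1.hasSum hs⟩

/-- The increments solve the linearised scheme: its advection term is treated as in the energy
estimate, and the stretching of the vorticity gradient is estimated in `H⁻¹`. -/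
theorem IsStable.increment_energy (H : IsStable L₁ L₂ μ k N a g) {n : ℕ} {D : ℝ}
    (h4 : SobSummable L₁ L₂ 4 (a n)) (h5 : SobSummable L₁ L₂ 4 (a (n + 1)))
    (hD : dualSq L₁ L₂ (fun κ => g (n + 2) κ - g (n + 1) κ) ≤ D) :
    bdfEnergy L₁ L₂ 0 (decayRate L₁ L₂ μ * k) (fun κ => a (n + 2) κ - a (n + 1) κ)
        (fun κ => a (n + 3) κ - a (n + 2) κ) ≤
      (1 + 16 * k * (embConst L₁ L₂ * poincareRoot L₁ L₂ * poincareRoot L₁ L₂ ^ 2) / μ *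
        sobSq L₁ L₂ 4 (extrap (a n) (a (n + 1)))) *
        bdfEnergy L₁ L₂ 0 (decayRate L₁ L₂ μ * k) (fun κ => a (n + 1) κ - a n κ)
          (fun κ => a (n + 2) κ - a (n + 1) κ) + 8 * k / μ * D := by
  have hk := H.k_pos
  have hμ := H.μ_pos
  have hν := H.rate_pos
  have hc := H.emb_nonneg
  have hL₁ := H.pos₁
  have hL₂ := H.pos₂
  set Ω := extrap (a n) (a (n + 1)) with hΩ
  set Ω' := extrap (a (n + 1)) (a (n + 2)) with hΩ'
  set d : Coeffs := fun κ => a (n + 1) κ - a n κ with hd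
  set d' : Coeffs := fun κ => a (n + 2) κ - a (n + 1) κ with hd'
  set d'' : Coeffs := fun κ => a (n + 3) κ - a (n + 2) κ with hd''
  set X := extrap d d' with hX
  have hXe : X = fun κ => Ω' κ - Ω κ := by
    funext κ
    simp only [hX, hΩ, hΩ', hd, hd', extrap]
    ring
  have sd : SobSummable L₁ L₂ 0 d := (H.sob_zero _).sub (H.sob_zero _)
  have sd' : SobSummable L₁ L₂ 0 d' := (H.sob_zero _).sub (H.sob_zero _)
  have d0 : d 0 = 0 := by simp [hd, H.zero]
  have d'0 : d' 0 = 0 := by simp [hd', H.zero]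
  have d''0 : d'' 0 = 0 := by simp [hd'', H.zero]
  have hd''2 : SobSummable L₁ L₂ 2 d'' := (H.sob_two (n + 1)).sub (H.sob_two n)
  have sX : SobSummable L₁ L₂ 0 X := sd.extrap sd'
  have X0 : X 0 = 0 := extrap_zero d0 d'0
  have sΩ : SobSummable L₁ L₂ 0 Ω := (H.sob_zero _).extrap (H.sob_zero _)
  have sΩ' : SobSummable L₁ L₂ 0 Ω' := (H.sob_zero _).extrap (H.sob_zero _)
  have vΩ : VelSummable L₁ L₂ Ω := H.velSummable n
  have vΩ' : VelSummable L₁ L₂ Ω' := H.velSummable (n + 1)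
  have vX : VelSummable L₁ L₂ X := by
    rw [hXe]
    exact (velNorm_sq_le hL₁ hL₂ (((H.sob_one _).extrap (H.sob_one _)).sub
      ((H.sob_one _).extrap (H.sob_one _)))).1
  have hΩ4 : SobSummable L₁ L₂ 4 Ω := h4.extrap h5
  have Ω0 : Ω 0 = 0 := extrap_zero (H.zero _) (H.zero _)
  have hΩ3 := absSum_sq_le hL₁ hL₂ Ω0 (hΩ4.of_succ hL₁ hL₂ Ω0)
  have hdual := jac_dual_le' vX (sX.dual hL₁ hL₂ X0) sΩ hΩ3.1
  have hγ := dualSq_sub_le (H.dual (n + 2)) (H.dual (n + 1))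
  have hh := dualSq_sub_le hγ.1 (jac_dual_le vX sΩ).1
  -- the difference of two steps, with `∂(Ω', Ω') - ∂(Ω, Ω) = ∂(Ω', X) + ∂(X, Ω)`, where the last
  -- term is counted as forcing
  have hstep : IsStep L₁ L₂ μ k d d' d'' (jac L₁ L₂ Ω' (extrap d d'))
      (fun κ => (g (n + 2) κ - g (n + 1) κ) - jac L₁ L₂ X Ω κ) := by
    intro κ
    have e1 : jac L₁ L₂ Ω' X κ = jac L₁ L₂ Ω' Ω' κ - jac L₁ L₂ Ω' Ω κ := by
      rw [hXe]; exact jac_lin_right vΩ' sΩ' sΩ κ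
    have e2 : jac L₁ L₂ X Ω κ = jac L₁ L₂ Ω' Ω κ - jac L₁ L₂ Ω Ω κ := by
      rw [hXe]; exact jac_lin_left vΩ' vΩ sΩ κ
    have s1 : 3 * a (n + 2) κ - 4 * a (n + 1) κ + a n κ + 2 * k * jac L₁ L₂ Ω Ω κ +
        2 * k * μ * (waveNum L₁ L₂ κ : ℂ) ^ 2 * a (n + 2) κ = 2 * k * g (n + 1) κ := H.step n κ
    have s2 : 3 * a (n + 3) κ - 4 * a (n + 2) κ + a (n + 1) κ + 2 * k * jac L₁ L₂ Ω' Ω' κ +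
        2 * k * μ * (waveNum L₁ L₂ κ : ℂ) ^ 2 * a (n + 3) κ = 2 * k * g (n + 2) κ :=
      H.step (n + 1) κ
    rw [← hX, e1]
    simp only [e2, hd, hd', hd'']
    linear_combination s2 - s1
  have key := energy_step hL₁ hL₂ hk hμ (by positivity) H.rate_mul_le
    (decayRate_mul_sq H.pos₁).le sd sd' hd''2 d0 d'0 d''0 vΩ'
    (extrap_conj (H.conj (n + 1)) (H.conj (n + 2))) (H.small (n + 1)) hh.1 hstep
  have q1 : 0 ≤ μ * k * sobSq L₁ L₂ 2 d'' := mul_nonneg (by positivity) sobSq_nonneg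
  have q2 : 0 ≤ bdfEnergy L₁ L₂ 0 (decayRate L₁ L₂ μ * k) d d' := bdfEnergy_nonneg (by positivity)
  have q3 : (1 + decayRate L₁ L₂ μ * k)⁻¹ ≤ 1 :=
    inv_le_one_of_one_le₀ (by linarith [mul_pos hν hk])
  have q4 := mul_le_mul_of_nonneg_right q3 q2
  have q5 : absSum Ω ^ 2 ≤ embConst L₁ L₂ * poincareRoot L₁ L₂ * sobSq L₁ L₂ 4 Ω :=
    H.absSum_sq_le_sob Ω0 hΩ4
  have q6 : dualSq L₁ L₂ X ≤ poincareRoot L₁ L₂ ^ 2 *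
      (2 * bdfEnergy L₁ L₂ 0 (decayRate L₁ L₂ μ * k) d d') := by
    refine (dualSq_le hL₁ hL₂ X0 sX).trans ?_
    have : sobSq L₁ L₂ 0 X ≤ 2 * bdfEnergy L₁ L₂ 0 (decayRate L₁ L₂ μ * k) d d' :=
      sobSq_extrap_le_bdfEnergy (by positivity)
    gcongr
  set E := bdfEnergy L₁ L₂ 0 (decayRate L₁ L₂ μ * k) d d'
  have q7 : dualSq L₁ L₂ (jac L₁ L₂ X Ω) ≤
      embConst L₁ L₂ * poincareRoot L₁ L₂ * sobSq L₁ L₂ 4 Ω *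
        (poincareRoot L₁ L₂ ^ 2 * (2 * E)) := by
    refine hdual.trans ?_
    have h0 := sobSq_nonneg (L₁ := L₁) (L₂ := L₂) (n := 4) (a := Ω)
    have h1 := dualSq_nonneg (L₁ := L₁) (L₂ := L₂) (a := X)
    gcongr
  have q8 : 4 * k / μ * dualSq L₁ L₂ (fun κ => (g (n + 2) κ - g (n + 1) κ) - jac L₁ L₂ X Ω κ) ≤
      4 * k / μ * (2 * D + 2 * (embConst L₁ L₂ * poincareRoot L₁ L₂ * sobSq L₁ L₂ 4 Ω *
        (poincareRoot L₁ L₂ ^ 2 * (2 * E)))) := by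
    have := hh.2
    gcongr
    linarith
  have q9 : 4 * k / μ * (2 * D + 2 * (embConst L₁ L₂ * poincareRoot L₁ L₂ * sobSq L₁ L₂ 4 Ω *
        (poincareRoot L₁ L₂ ^ 2 * (2 * E)))) = 16 * k * (embConst L₁ L₂ * poincareRoot L₁ L₂ *
        poincareRoot L₁ L₂ ^ 2) / μ * sobSq L₁ L₂ 4 Ω * E + 8 * k / μ * D := by ring
  linarith

/-- Increments are of order `k` if those of the forcing are: the sum of the squared increments over
a time window is of order `k`, so that they are of order `k²` somewhere in the window, and from
there they grow at most by a fixed factor until its end. -/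
theorem exists_incSq_le_sq (L₁ L₂ μ M Φ₀ : ℝ) : ∃ B : ℝ → ℝ,
    ∀ {k : ℝ} {N m : ℕ} {a g : ℕ → Coeffs},
    IsStable L₁ L₂ μ k N a g → (∀ n, SobBound L₁ L₂ 0 (g n) Φ₀) →
    (∀ n ≥ m, SobBound L₁ L₂ 2 (a n) M) → ∀ D,
    (∀ n, dualSq L₁ L₂ (fun κ => g (n + 1) κ - g n κ) ≤ D * k ^ 2) →
    ∀ n ≥ m + 2 * N + 5, incSq L₁ L₂ a n ≤ k ^ 2 * B D := by
  obtain ⟨B₁, hB₁0, hB₁⟩ := exists_sum_incSq_le L₁ L₂ μ M Φ₀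
  obtain ⟨S, hS⟩ := exists_sob_two_window L₁ L₂ μ M Φ₀
  set c := embConst L₁ L₂ * poincareRoot L₁ L₂ * poincareRoot L₁ L₂ ^ 2 with hc
  refine ⟨fun D => 2 * ((decayRate L₁ L₂ μ * (6 * B₁) + 16 / (μ * decayRate L₁ L₂ μ) * D) *
    Real.exp (160 * c * S / μ)), ?_⟩
  intro k N m a g H hg hM D hD n hn
  have hk := H.k_pos
  have hμ := H.μ_pos
  have hν := H.rate_pos
  have hc0 : 0 ≤ c := mul_nonneg H.emb_nonneg (sq_nonneg _)
  obtain ⟨hS1, hS2⟩ := hS H hg hM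
  obtain ⟨p, rfl⟩ : ∃ p, n = p + N + 1 := ⟨n - N - 1, by omega⟩
  have hD0 : 0 ≤ D * k ^ 2 := dualSq_nonneg.trans (hD 0)
  set E : ℕ → ℝ := fun n => bdfEnergy L₁ L₂ 0 (decayRate L₁ L₂ μ * k) (fun κ => a (n + 1) κ - a n κ)
    (fun κ => a (n + 2) κ - a (n + 1) κ) with hE
  have hE0 : ∀ n, 0 ≤ E n := fun n => bdfEnergy_nonneg (by positivity)
  have hX : ∑ j ∈ Finset.range N, E (p + j) ≤ 6 * (k * B₁) := by
    refine (sum_pair_le (p := 5) (q := 1) (by norm_num) (by norm_num)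
      (y := incSq L₁ L₂ a) (fun n => sobSq_nonneg) (x := E) (fun j => ?_)
      (hB₁ H hg hM p (by omega))).trans_eq (by norm_num)
    have := bdfEnergy_le (n := 0) H.rate_mul_le ((H.sob_zero (p + j + 1)).sub (H.sob_zero (p + j)))
      ((H.sob_zero (p + j + 2)).sub (H.sob_zero (p + j + 1)))
    simp only [hE, incSq]
    linarith
  have hw := (H.window_sum_extrap (i := 4) (m := p) (fun n hn => hS1 n (by omega))
    (hS2 p (by omega))).1
  have hG : ∑ j ∈ Finset.range N, 16 * k * c / μ *
      sobSq L₁ L₂ 4 (extrap (a (p + j)) (a (p + j + 1))) ≤ 160 * c * S / μ := by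
    rw [← Finset.mul_sum] at hw ⊢
    calc _ = 16 * c / μ *
          (k * ∑ j ∈ Finset.range N, sobSq L₁ L₂ 4 (extrap (a (p + j)) (a (p + j + 1)))) := by ring
      _ ≤ 16 * c / μ * (10 * S) := by gcongr
      _ = _ := by ring
  have := uniform_gronwall (x := fun j => E (p + j))
    (g := fun j => 16 * k * c / μ * sobSq L₁ L₂ 4 (extrap (a (p + j)) (a (p + j + 1))))
    (h := 8 * k / μ * (D * k ^ 2)) H.window_pos (by positivity)
    (fun j => mul_nonneg (by positivity) sobSq_nonneg) (fun j => hE0 _)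
    (fun j _ => H.increment_energy (n := p + j) (hS1 _ (by omega)) (hS1 _ (by omega)) (hD _)) hX hG
  have h1 : incSq L₁ L₂ a (p + N + 1) ≤ 2 * E (p + N) := sobSq_le_bdfEnergy (by positivity)
  have h2 := H.div_window_le' (X := 6 * (k * B₁)) (by positivity)
  have h3 : N * (8 * k / μ * (D * k ^ 2)) ≤ k ^ 2 * (16 / (μ * decayRate L₁ L₂ μ) * D) := by
    calc N * (8 * k / μ * (D * k ^ 2)) = (N * k) * (8 / μ * (D * k ^ 2)) := by ring
      _ ≤ 2 / decayRate L₁ L₂ μ * (8 / μ * (D * k ^ 2)) := by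
        have := H.window_le
        gcongr
      _ = _ := by field_simp; ring
  have h4 := mul_le_mul_of_nonneg_right (add_le_add h2 h3) (Real.exp_nonneg (160 * c * S / μ))
  calc _ ≤ 2 * ((k * (decayRate L₁ L₂ μ * (6 * (k * B₁))) +
        k ^ 2 * (16 / (μ * decayRate L₁ L₂ μ) * D)) * Real.exp (160 * c * S / μ)) := by linarith
    _ = _ := by ring

/-- One step in `H²`, when the vorticity is bounded in `H¹`: the growth rate is then constant. -/
theorem IsStable.sob_two_step (H : IsStable L₁ L₂ μ k N a g) {n : ℕ} {Φ₁ : ℝ}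
    (h0 : SobBound L₁ L₂ 2 (a n) M) (h1 : SobBound L₁ L₂ 2 (a (n + 1)) M)
    (h2 : SobSummable L₁ L₂ 4 (a n)) (h3 : SobSummable L₁ L₂ 4 (a (n + 1)))
    (hg : SobBound L₁ L₂ 2 (g (n + 1)) Φ₁) :
    bdfEnergy L₁ L₂ 4 0 (a (n + 1)) (a (n + 2)) ≤
      (1 + 160 * k * (embConst L₁ L₂ * poincareRoot L₁ L₂) * M / μ) *
        bdfEnergy L₁ L₂ 4 0 (a n) (a (n + 1)) + 2 * k / μ * Φ₁ := by
  have hk := H.k_pos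
  have hμ := H.μ_pos
  have hc := H.emb_nonneg
  have hΩ := h0.extrap h1
  have hΩ4 : SobSummable L₁ L₂ 4 (extrap (a n) (a (n + 1))) := h2.extrap h3
  have Ω0 : extrap (a n) (a (n + 1)) 0 = 0 := extrap_zero (H.zero _) (H.zero _)
  have hΩE : sobSq L₁ L₂ 4 (extrap (a n) (a (n + 1))) ≤
    2 * bdfEnergy L₁ L₂ 4 0 (a n) (a (n + 1)) := sobSq_extrap_le_bdfEnergy le_rfl
  set Ω := extrap (a n) (a (n + 1)) with hΩdef
  have hA := absSum_sq_le H.pos₁ H.pos₂ Ω0 (hΩ4.of_succ H.pos₁ H.pos₂ Ω0)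
  obtain ⟨j1, j2⟩ := jac_sob_two_le H.pos₁ H.pos₂ (H.velSummable n) hA.1 hΩ.1 hΩ4 Ω0
  have hA' := H.absSum_sq_le_sob Ω0 hΩ4
  have hV' := H.velNorm_sq_le_sob Ω0 hΩ.1
  have hn2 := sobSq_nonneg (L₁ := L₁) (L₂ := L₂) (n := 2) (a := Ω)
  have hn4 := sobSq_nonneg (L₁ := L₁) (L₂ := L₂) (n := 4) (a := Ω)
  have hE0 : 0 ≤ bdfEnergy L₁ L₂ 4 0 (a n) (a (n + 1)) := bdfEnergy_nonneg le_rfl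
  have h5 : sobSq L₁ L₂ 2 (jac L₁ L₂ Ω Ω) ≤ 80 * (embConst L₁ L₂ * poincareRoot L₁ L₂) * M *
      bdfEnergy L₁ L₂ 4 0 (a n) (a (n + 1)) := by
    have hM0 := h0.nonneg
    calc _ ≤ 2 * (embConst L₁ L₂ * poincareRoot L₁ L₂ * sobSq L₁ L₂ 4 Ω * sobSq L₁ L₂ 2 Ω +
          embConst L₁ L₂ * poincareRoot L₁ L₂ * sobSq L₁ L₂ 2 Ω * sobSq L₁ L₂ 4 Ω) :=
        j2.trans (by gcongr)
      _ = 4 * (embConst L₁ L₂ * poincareRoot L₁ L₂) * sobSq L₁ L₂ 2 Ω * sobSq L₁ L₂ 4 Ω := by ring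
      _ ≤ 4 * (embConst L₁ L₂ * poincareRoot L₁ L₂) * (10 * M) *
          (2 * bdfEnergy L₁ L₂ 4 0 (a n) (a (n + 1))) := by
        have := hΩ.2
        gcongr
      _ = _ := by ring
  have h6 := (regularity_step (n := 4) H.pos₁ H.pos₂ hk hμ h2 h3 (H.zero _)
    (H.zero _) (H.zero _) (hg.1.hasSum.add j1.hasSum) (fun κ => by
      rw [← mul_add, ← mul_assoc]
      gcongr
      rcases eq_or_ne κ 0 with rfl | hκ
      · simp [waveNum_zero]
      · have := waveNum_pos H.pos₁ H.pos₂ hκ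
        refine le_of_eq ?_
        field_simp) (H.step n)).2
  have h7 : 0 ≤ k * μ * sobSq L₁ L₂ (4 + 2) (a (n + 2)) := mul_nonneg (by positivity) sobSq_nonneg
  change _ ≤ _ + 2 * k / μ * (sobSq L₁ L₂ 2 (g (n + 1)) + sobSq L₁ L₂ 2 (jac L₁ L₂ Ω Ω)) at h6
  have h8 : 2 * k / μ * (sobSq L₁ L₂ 2 (g (n + 1)) + sobSq L₁ L₂ 2 (jac L₁ L₂ Ω Ω)) ≤
      2 * k / μ * (Φ₁ + 80 * (embConst L₁ L₂ * poincareRoot L₁ L₂) * M *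
      bdfEnergy L₁ L₂ 4 0 (a n) (a (n + 1))) := by
    have := hg.2
    gcongr
  have h9 : 2 * k / μ * (Φ₁ + 80 * (embConst L₁ L₂ * poincareRoot L₁ L₂) * M *
      bdfEnergy L₁ L₂ 4 0 (a n) (a (n + 1))) = 160 * k * (embConst L₁ L₂ * poincareRoot L₁ L₂) *
      M / μ * bdfEnergy L₁ L₂ 4 0 (a n) (a (n + 1)) + 2 * k / μ * Φ₁ := by ring
  linarith

/-- Bounds in `H²` and for the increments, for forcing in `H¹`. The increments need no assumption on
those of the forcing, since in `H²` the viscous term is a bounded forcing in the scheme. -/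
theorem exists_sob_two_le (L₁ L₂ μ M Φ₀ Φ₁ : ℝ) : ∃ B B', ∀ {k : ℝ} {N m : ℕ} {a g : ℕ → Coeffs},
    IsStable L₁ L₂ μ k N a g → (∀ n, SobBound L₁ L₂ 0 (g n) Φ₀) →
    (∀ n, SobBound L₁ L₂ 2 (g n) Φ₁) →
    (∀ n ≥ m, SobBound L₁ L₂ 2 (a n) M) →
    (∀ n ≥ m + N + 3, SobBound L₁ L₂ 4 (a n) B) ∧
    ∀ n ≥ m + 2 * N + 3, incSq L₁ L₂ a n ≤ k ^ 2 * B' := by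
  obtain ⟨B₀, hB₀⟩ := exists_incSq_le L₁ L₂ μ M Φ₀
  obtain ⟨S, hS⟩ := exists_sob_two_window L₁ L₂ μ M Φ₀
  set c := embConst L₁ L₂ * poincareRoot L₁ L₂ with hc
  set B := 2 * ((6 * S * decayRate L₁ L₂ μ + 4 / (μ * decayRate L₁ L₂ μ) * Φ₁) *
    Real.exp (320 * c * M / (μ * decayRate L₁ L₂ μ))) with hBdef
  refine ⟨B, decayRate L₁ L₂ μ * |B₀| +
    2 * (24 / 9 * (Φ₀ + 100 * c * M ^ 2 + μ ^ 2 * B)), ?_⟩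
  intro k N m a g H hg hg1 hM
  have hk := H.k_pos
  have hμ := H.μ_pos
  have hν := H.rate_pos
  have hc0 : 0 ≤ c := H.emb_nonneg
  have hM0 : 0 ≤ M := (hM m le_rfl).nonneg
  have hΦ0 : 0 ≤ Φ₀ := (hg 0).nonneg
  have hΦ1 : 0 ≤ Φ₁ := (hg1 0).nonneg
  obtain ⟨hS1, hS2⟩ := hS H hg hM
  have hS0 : 0 ≤ S := le_trans (Finset.sum_nonneg fun _ _ => mul_nonneg hk.le sobSq_nonneg)
    (hS2 (m + 2) le_rfl)
  have hH2 : ∀ n ≥ m + N + 3, SobBound L₁ L₂ 4 (a n) B := by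
    intro n hn
    refine ⟨hS1 n (by omega), ?_⟩
    obtain ⟨p, rfl⟩ : ∃ p, n = p + N + 1 := ⟨n - N - 1, by omega⟩
    have hw := (H.window_sum_extrap (i := 4) (m := p) (fun n hn => hS1 n (by omega))
      (hS2 p (by omega))).2
    rw [← Finset.mul_sum] at hw
    have hX : ∑ j ∈ Finset.range N, bdfEnergy L₁ L₂ 4 0 (a (p + j)) (a (p + j + 1)) ≤
        6 * S / k := by
      rw [le_div_iff₀ hk]; linarith
    have hG : ∑ _j ∈ Finset.range N, 160 * k * c * M / μ ≤
        320 * c * M / (μ * decayRate L₁ L₂ μ) := by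
      rw [Finset.sum_const, Finset.card_range, nsmul_eq_mul]
      calc N * (160 * k * c * M / μ) = (N * k) * (160 * c * M / μ) := by ring
        _ ≤ 2 / decayRate L₁ L₂ μ * (160 * c * M / μ) := by
          have := H.window_le
          gcongr
        _ = _ := by field_simp; ring
    have := uniform_gronwall (x := fun j => bdfEnergy L₁ L₂ 4 0 (a (p + j)) (a (p + j + 1)))
      (g := fun _ => 160 * k * c * M / μ) (h := 2 * k / μ * Φ₁) H.window_pos
      (by positivity) (fun j => by positivity) (fun j => bdfEnergy_nonneg le_rfl)
      (fun j _ => H.sob_two_step (n := p + j) (hM _ (by omega)) (hM _ (by omega)) (hS1 _ (by omega))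
        (hS1 _ (by omega)) (hg1 _)) hX hG
    have h1 : sobSq L₁ L₂ 4 (a (p + N + 1)) ≤
      2 * bdfEnergy L₁ L₂ 4 0 (a (p + N)) (a (p + N + 1)) := sobSq_le_bdfEnergy le_rfl
    have h2 := H.div_window_le (S := 6 * S) (by positivity)
    have h3 : N * (2 * k / μ * Φ₁) ≤ 4 / (μ * decayRate L₁ L₂ μ) * Φ₁ := by
      calc N * (2 * k / μ * Φ₁) = (N * k) * (2 / μ * Φ₁) := by ring
        _ ≤ 2 / decayRate L₁ L₂ μ * (2 / μ * Φ₁) := by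
          have := H.window_le
          gcongr
        _ = _ := by field_simp; ring
    have h4 := mul_le_mul_of_nonneg_right (add_le_add h2 h3)
      (Real.exp_nonneg (320 * c * M / (μ * decayRate L₁ L₂ μ)))
    rw [hBdef]
    linarith
  refine ⟨hH2, fun n hn => ?_⟩
  have hBn : 0 ≤ B := (hH2 _ le_rfl).nonneg
  obtain ⟨p, rfl⟩ : ∃ p, n = p + N := ⟨n - N, by omega⟩
  have h0 := hB₀ H hg hM p (by omega)
  have h1 : k * B₀ ≤ k * |B₀| := by gcongr; exact le_abs_self _
  have := contraction_le (x := incSq L₁ L₂ a)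
    (c := k ^ 2 * (24 / 9 * (Φ₀ + 100 * c * M ^ 2 + μ ^ 2 * B)))
    (X := k * |B₀|) (by positivity) p (fun j => by
      have hΩ := (hM (p + j) (by omega)).extrap (hM (p + j + 1) (by omega))
      obtain ⟨j1, j2⟩ := H.jac_le (extrap_zero (H.zero (p + j)) (H.zero (p + j + 1))) hΩ.1
      have hw4 := hH2 (p + j + 2) (by omega)
      have h5 := increment_step' (H.sob_zero (p + j)) (H.sob_zero (p + j + 1))
        (H.sob_zero (p + j + 2)) hw4.1 (hg _).1 j1 (H.step (p + j))
      have h6 : embConst L₁ L₂ * poincareRoot L₁ L₂ *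
          sobSq L₁ L₂ 2 (extrap (a (p + j)) (a (p + j + 1))) ^ 2 ≤ c * (10 * M) ^ 2 := by
        have := sobSq_nonneg (L₁ := L₁) (L₂ := L₂) (n := 2)
          (a := extrap (a (p + j)) (a (p + j + 1)))
        gcongr
        exact hΩ.2
      have h7 : sobSq L₁ L₂ 0 (g (p + j + 1)) + sobSq L₁ L₂ 0 (jac L₁ L₂
          (extrap (a (p + j)) (a (p + j + 1))) (extrap (a (p + j)) (a (p + j + 1)))) +
          μ ^ 2 * sobSq L₁ L₂ 4 (a (p + j + 2)) ≤ Φ₀ + 100 * c * M ^ 2 + μ ^ 2 * B := by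
        have h8 := (hg (p + j + 1)).2
        have h9 : μ ^ 2 * sobSq L₁ L₂ 4 (a (p + j + 2)) ≤ μ ^ 2 * B := by
          have := hw4.2
          gcongr
        linarith
      have h10 := mul_le_mul_of_nonneg_left h7 (show 0 ≤ 24 * k ^ 2 by positivity)
      have h11 : 0 ≤ incSq L₁ L₂ a (p + j) := sobSq_nonneg
      have h12 : 9 * incSq L₁ L₂ a (p + j + 1) ≤ 2 * incSq L₁ L₂ a (p + j) +
        24 * k ^ 2 * (Φ₀ + 100 * c * M ^ 2 + μ ^ 2 * B) := h5.trans (add_le_add_right h10 _)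
      linarith) (by positivity) (h0.trans h1) H.window_pos
  have h2 := H.div_window_le' (X := k * |B₀|) (by positivity)
  linarith

end Increments

/-! ### Trigonometric test functions -/

section Modes

variable {L₁ L₂ : ℝ}

/-- The phase `k_κ · p`. -/
def phase (L₁ L₂ : ℝ) (κ : ℤ × ℤ) (p : ℝ × ℝ) : ℝ :=
  2 * Real.pi * κ.1 / L₁ * p.1 + 2 * Real.pi * κ.2 / L₂ * p.2

theorem expMode_eq_exp_phase (κ : ℤ × ℤ) (p : ℝ × ℝ) :
    expMode L₁ L₂ κ p = Complex.exp ((phase L₁ L₂ κ p : ℝ) * Complex.I) := by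
  unfold expMode phase
  congr 3
  ring

theorem expMode_eq (κ : ℤ × ℤ) (p : ℝ × ℝ) :
    expMode L₁ L₂ κ p =
      (Real.cos (phase L₁ L₂ κ p) : ℂ) + (Real.sin (phase L₁ L₂ κ p) : ℂ) * Complex.I := by
  rw [expMode_eq_exp_phase, Complex.exp_mul_I, Complex.ofReal_cos, Complex.ofReal_sin]

theorem hasFDerivAt_phase (κ : ℤ × ℤ) (p : ℝ × ℝ) :
    HasFDerivAt (phase L₁ L₂ κ)
      ((2 * Real.pi * κ.1 / L₁) • ContinuousLinearMap.fst ℝ ℝ ℝ +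
        (2 * Real.pi * κ.2 / L₂) • ContinuousLinearMap.snd ℝ ℝ ℝ) p :=
  ((hasFDerivAt_fst (𝕜 := ℝ) (p := p)).const_mul _).add
    ((hasFDerivAt_snd (𝕜 := ℝ) (p := p)).const_mul _)

theorem contDiff_phase (κ : ℤ × ℤ) {n : WithTop ℕ∞} : ContDiff ℝ n (phase L₁ L₂ κ) := by
  unfold phase
  fun_prop

theorem phase_add_fst (hL₁ : 0 < L₁) (κ : ℤ × ℤ) (p : ℝ × ℝ) :
    phase L₁ L₂ κ (p + (L₁, 0)) = phase L₁ L₂ κ p + κ.1 * (2 * Real.pi) := by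
  simp only [phase, Prod.fst_add, Prod.snd_add, add_zero]
  field_simp
  ring

theorem phase_add_snd (hL₂ : 0 < L₂) (κ : ℤ × ℤ) (p : ℝ × ℝ) :
    phase L₁ L₂ κ (p + (0, L₂)) = phase L₁ L₂ κ p + κ.2 * (2 * Real.pi) := by
  simp only [phase, Prod.fst_add, Prod.snd_add, add_zero]
  field_simp
  ring

/-- The test function `cos (k_κ · p)`. -/
def cosMode (hL₁ : 0 < L₁) (hL₂ : 0 < L₂) (κ : ℤ × ℤ) : TestFn L₁ L₂ :=
  ⟨fun p => Real.cos (phase L₁ L₂ κ p), Real.contDiff_cos.comp (contDiff_phase κ), fun p => by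
    simp only [phase_add_fst hL₁, phase_add_snd hL₂, Real.cos_add_int_mul_two_pi, and_self]⟩

/-- The test function `sin (k_κ · p)`. -/
def sinMode (hL₁ : 0 < L₁) (hL₂ : 0 < L₂) (κ : ℤ × ℤ) : TestFn L₁ L₂ :=
  ⟨fun p => Real.sin (phase L₁ L₂ κ p), Real.contDiff_sin.comp (contDiff_phase κ), fun p => by
    simp only [phase_add_fst hL₁, phase_add_snd hL₂, Real.sin_add_int_mul_two_pi, and_self]⟩

variable (hL₁ : 0 < L₁) (hL₂ : 0 < L₂) (κ : ℤ × ℤ)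

theorem hasFDerivAt_trig (r s : ℝ) (p : ℝ × ℝ) :
    HasFDerivAt (fun p => r * Real.cos (phase L₁ L₂ κ p) + s * Real.sin (phase L₁ L₂ κ p))
      ((s * Real.cos (phase L₁ L₂ κ p) - r * Real.sin (phase L₁ L₂ κ p)) •
        ((2 * Real.pi * κ.1 / L₁) • ContinuousLinearMap.fst ℝ ℝ ℝ +
        (2 * Real.pi * κ.2 / L₂) • ContinuousLinearMap.snd ℝ ℝ ℝ)) p := by
  have h := hasFDerivAt_phase (L₁ := L₁) (L₂ := L₂) κ p
  refine ((h.cos.const_mul r).add (h.sin.const_mul s)).congr_fderiv ?_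
  ext <;> simp <;> ring

theorem pdx_trig (r s : ℝ) :
    pdx (fun p => r * Real.cos (phase L₁ L₂ κ p) + s * Real.sin (phase L₁ L₂ κ p)) =
      fun p => (2 * Real.pi * κ.1 / L₁ * s) * Real.cos (phase L₁ L₂ κ p) +
        (-(2 * Real.pi * κ.1 / L₁ * r)) * Real.sin (phase L₁ L₂ κ p) := by
  ext p
  rw [pdx, (hasFDerivAt_trig κ r s p).fderiv]
  simp
  ring

theorem pdy_trig (r s : ℝ) :
    pdy (fun p => r * Real.cos (phase L₁ L₂ κ p) + s * Real.sin (phase L₁ L₂ κ p)) =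
      fun p => (2 * Real.pi * κ.2 / L₂ * s) * Real.cos (phase L₁ L₂ κ p) +
        (-(2 * Real.pi * κ.2 / L₂ * r)) * Real.sin (phase L₁ L₂ κ p) := by
  ext p
  rw [pdy, (hasFDerivAt_trig κ r s p).fderiv]
  simp
  ring

theorem cosMode_eq : (cosMode hL₁ hL₂ κ).1 =
    fun p => 1 * Real.cos (phase L₁ L₂ κ p) + 0 * Real.sin (phase L₁ L₂ κ p) := by
  ext p
  simp [cosMode]

theorem sinMode_eq : (sinMode hL₁ hL₂ κ).1 =
    fun p => 0 * Real.cos (phase L₁ L₂ κ p) + 1 * Real.sin (phase L₁ L₂ κ p) := by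
  ext p
  simp [sinMode]

theorem pdx_cosMode (p : ℝ × ℝ) : pdx (cosMode hL₁ hL₂ κ).1 p =
    -(2 * Real.pi * κ.1 / L₁) * (sinMode hL₁ hL₂ κ).1 p := by
  rw [cosMode_eq, pdx_trig, sinMode_eq]
  ring

theorem pdy_cosMode (p : ℝ × ℝ) : pdy (cosMode hL₁ hL₂ κ).1 p =
    -(2 * Real.pi * κ.2 / L₂) * (sinMode hL₁ hL₂ κ).1 p := by
  rw [cosMode_eq, pdy_trig, sinMode_eq]
  ring

theorem pdx_sinMode (p : ℝ × ℝ) : pdx (sinMode hL₁ hL₂ κ).1 p =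
    2 * Real.pi * κ.1 / L₁ * (cosMode hL₁ hL₂ κ).1 p := by
  rw [sinMode_eq, pdx_trig, cosMode_eq]
  ring

theorem pdy_sinMode (p : ℝ × ℝ) : pdy (sinMode hL₁ hL₂ κ).1 p =
    2 * Real.pi * κ.2 / L₂ * (cosMode hL₁ hL₂ κ).1 p := by
  rw [sinMode_eq, pdy_trig, cosMode_eq]
  ring

theorem lapl_cosMode (p : ℝ × ℝ) : lapl (cosMode hL₁ hL₂ κ).1 p =
    -waveSq L₁ L₂ κ * (cosMode hL₁ hL₂ κ).1 p := by
  rw [cosMode_eq, lapl, pdx_trig, pdx_trig, pdy_trig, pdy_trig, waveSq]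
  ring

theorem lapl_sinMode (p : ℝ × ℝ) : lapl (sinMode hL₁ hL₂ κ).1 p =
    -waveSq L₁ L₂ κ * (sinMode hL₁ hL₂ κ).1 p := by
  rw [sinMode_eq, lapl, pdx_trig, pdx_trig, pdy_trig, pdy_trig, waveSq]
  ring

end Modes

/-! ### Fourier coefficients of square integrable functions -/

instance isFiniteMeasure_cell (L₁ L₂ : ℝ) : IsFiniteMeasure (volume.restrict (cell L₁ L₂)) := by
  refine ⟨?_⟩
  rw [Measure.restrict_apply_univ, cell, Measure.volume_eq_prod, Measure.prod_prod]
  simp only [Real.volume_Ioc]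
  finiteness

section Coefficients

variable {L₁ L₂ : ℝ} {g h : ℝ × ℝ → ℝ}

theorem PerL2.integrable (hg : PerL2 L₁ L₂ g) : Integrable g (volume.restrict (cell L₁ L₂)) :=
  hg.2.integrable (by norm_num)

theorem PerL2.lin (hg : PerL2 L₁ L₂ g) (hh : PerL2 L₁ L₂ h) (r s : ℝ) :
    PerL2 L₁ L₂ fun p => r * g p - s * h p :=
  ⟨fun p => by simp [(hg.1 p).1, (hg.1 p).2, (hh.1 p).1, (hh.1 p).2],
    (hg.2.const_mul r).sub (hh.2.const_mul s)⟩

theorem PerL2.ofReal (hg : PerL2 L₁ L₂ g) :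
    MemLp (fun p => (g p : ℂ)) 2 (volume.restrict (cell L₁ L₂)) := hg.2.ofReal

theorem MemLp.mul_expMode {F : ℝ × ℝ → ℂ} {q : ENNReal}
    (hF : MemLp F q (volume.restrict (cell L₁ L₂))) (κ : ℤ × ℤ) :
    MemLp (fun p => F p * expMode L₁ L₂ κ p) q (volume.restrict (cell L₁ L₂)) := by
  refine hF.of_le (hF.1.mul
    (contDiff_expMode L₁ L₂ κ (n := 0)).continuous.aestronglyMeasurable) ?_
  filter_upwards with p
  rw [norm_mul, norm_expMode, mul_one]

theorem cfourierCf_lin {F G : ℝ × ℝ → ℂ}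
    (hF : MemLp F 1 (volume.restrict (cell L₁ L₂)))
    (hG : MemLp G 1 (volume.restrict (cell L₁ L₂))) (r s : ℂ) (κ : ℤ × ℤ) :
    cfourierCf L₁ L₂ (fun p => r * F p - s * G p) κ =
      r * cfourierCf L₁ L₂ F κ - s * cfourierCf L₁ L₂ G κ := by
  have h1 := ((memLp_one_iff_integrable.1 (MemLp.mul_expMode hF (-κ))).const_mul r)
  have h2 := ((memLp_one_iff_integrable.1 (MemLp.mul_expMode hG (-κ))).const_mul s)
  have h3 : ∫ p in cell L₁ L₂, (r * F p - s * G p) * expMode L₁ L₂ (-κ) p =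
      r * (∫ p in cell L₁ L₂, F p * expMode L₁ L₂ (-κ) p) -
        s * ∫ p in cell L₁ L₂, G p * expMode L₁ L₂ (-κ) p := by
    rw [← integral_const_mul, ← integral_const_mul, ← integral_sub h1 h2]
    refine integral_congr_ae (Filter.Eventually.of_forall fun p => ?_)
    simp only
    ring
  rw [cfourierCf, h3, cfourierCf, cfourierCf]
  ring

theorem fourierCf_lin (hg : PerL2 L₁ L₂ g) (hh : PerL2 L₁ L₂ h) (r s : ℝ) (κ : ℤ × ℤ) :
    fourierCf L₁ L₂ (fun p => r * g p - s * h p) κ =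
      r * fourierCf L₁ L₂ g κ - s * fourierCf L₁ L₂ h κ := by
  simp only [fourierCf_eq_cfourierCf]
  rw [← cfourierCf_lin (memLp_one_iff_integrable.2 (hg.ofReal.integrable (by norm_num)))
    (memLp_one_iff_integrable.2 (hh.ofReal.integrable (by norm_num)))]
  push_cast
  rfl

theorem fourierCf_zero (g : ℝ × ℝ → ℝ) :
    fourierCf L₁ L₂ g 0 = ((L₁ * L₂)⁻¹ * cellInt L₁ L₂ g : ℝ) := by
  rw [fourierCf_eq_cfourierCf, cfourierCf]
  simp only [neg_zero, expMode_zero, mul_one]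
  rw [integral_complex_ofReal, cellInt]
  push_cast
  rfl

theorem fourierCf_neg (g : ℝ × ℝ → ℝ) (κ : ℤ × ℤ) :
    fourierCf L₁ L₂ g (-κ) = (starRingEnd ℂ) (fourierCf L₁ L₂ g κ) := by
  rw [fourierCf_eq_cfourierCf, fourierCf_eq_cfourierCf, cfourierCf, cfourierCf, map_mul,
    Complex.conj_ofReal, ← integral_conj]
  congr 2
  ext p
  rw [map_mul, conj_expMode, Complex.conj_ofReal]

theorem hasSum_l2Sq (hL₁ : 0 < L₁) (hL₂ : 0 < L₂) (hg : PerL2 L₁ L₂ g) :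
    HasSum (fun κ => ‖fourierCf L₁ L₂ g κ‖ ^ 2) ((L₁ * L₂)⁻¹ * l2Sq L₁ L₂ g) := by
  have h := hasSum_cfourierCf hL₁ hL₂ hg.ofReal hg.ofReal
  rw [← Complex.hasSum_ofReal]
  convert! h using 1
  · ext κ
    rw [← fourierCf_eq_cfourierCf, Complex.conj_mul']
    push_cast
    rfl
  · rw [l2Sq, cellInt, Complex.ofReal_mul, ← integral_complex_ofReal]
    congr 3
    ext p
    rw [Complex.conj_ofReal]
    push_cast
    ring

theorem sobSummable_zero (hL₁ : 0 < L₁) (hL₂ : 0 < L₂) (hg : PerL2 L₁ L₂ g) :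
    SobSummable L₁ L₂ 0 (fourierCf L₁ L₂ g) := by
  simpa [SobSummable] using (hasSum_l2Sq hL₁ hL₂ hg).summable

theorem l2Sq_eq (hL₁ : 0 < L₁) (hL₂ : 0 < L₂) (hg : PerL2 L₁ L₂ g) :
    l2Sq L₁ L₂ g = L₁ * L₂ * sobSq L₁ L₂ 0 (fourierCf L₁ L₂ g) := by
  have h := (hasSum_l2Sq hL₁ hL₂ hg).tsum_eq
  simp only [sobSq, pow_zero, one_mul, h]
  field_simp

theorem gNormSq_eq (hL₁ : 0 < L₁) (hL₂ : 0 < L₂) (hg : PerL2 L₁ L₂ g) (hh : PerL2 L₁ L₂ h)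
    (a : ℝ) : gNormSq L₁ L₂ a g h =
      L₁ * L₂ * bdfEnergy L₁ L₂ 0 a (fourierCf L₁ L₂ g) (fourierCf L₁ L₂ h) := by
  have h1 := l2Sq_eq hL₁ hL₂ (hh.lin hg 2 1)
  have h2 : fourierCf L₁ L₂ (fun p => 2 * h p - 1 * g p) =
      extrap (fourierCf L₁ L₂ g) (fourierCf L₁ L₂ h) := by
    ext κ
    rw [fourierCf_lin hh hg, extrap]
    push_cast
    ring
  have h3 : l2Sq L₁ L₂ (fun p => 2 * h p - 1 * g p) =
      4 * l2Sq L₁ L₂ h - 4 * cellInt L₁ L₂ (fun p => g p * h p) + l2Sq L₁ L₂ g := by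
    have i1 := hh.2.integrable_sq.const_mul 4
    have i2 : Integrable (fun p => 4 * (g p * h p)) (volume.restrict (cell L₁ L₂)) :=
      (hg.2.integrable_mul hh.2).const_mul 4
    simp only [l2Sq, cellInt]
    rw [← integral_const_mul, ← integral_const_mul, ← integral_sub i1 i2]
    have i3 : Integrable (fun p => 4 * h p ^ 2 - 4 * (g p * h p))
      (volume.restrict (cell L₁ L₂)) := i1.sub i2
    rw [← integral_add i3 hg.2.integrable_sq]
    refine integral_congr_ae (Filter.Eventually.of_forall fun p => ?_)
    simp only
    ring
  rw [h2] at h1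
  have h4 := l2Sq_eq hL₁ hL₂ hh
  rw [gNormSq, bdfEnergy]
  linear_combination (1/2) * h1 + (1/2 + a / 2) * h4 - (1/2) * h3

theorem waveSq_rpow (n : ℕ) (κ : ℤ × ℤ) :
    waveSq L₁ L₂ κ ^ ((n : ℝ) / 2) = waveNum L₁ L₂ κ ^ n := by
  have h := waveNum_nonneg (L₁ := L₁) (L₂ := L₂) κ
  rw [← waveNum_sq, ← Real.rpow_natCast _ 2, ← Real.rpow_mul h, ← Real.rpow_natCast]
  congr 1
  push_cast
  ring

theorem memH_iff {s : ℝ} (n : ℕ) (hs : s = (n : ℝ) / 2) :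
    MemH L₁ L₂ s g ↔ PerL2 L₁ L₂ g ∧ SobSummable L₁ L₂ n (fourierCf L₁ L₂ g) := by
  subst hs
  simp only [MemH, waveSq_rpow, SobSummable]

theorem hNorm_eq {s : ℝ} (n : ℕ) (hs : s = (n : ℝ) / 2) :
    hNorm L₁ L₂ s g = √(L₁ * L₂ * sobSq L₁ L₂ n (fourierCf L₁ L₂ g)) := by
  subst hs
  simp only [hNorm, waveSq_rpow, sobSq]

theorem HBound.sobBound (hL₁ : 0 < L₁) (hL₂ : 0 < L₂) {s B : ℝ} (n : ℕ) (hs : s = (n : ℝ) / 2)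
    (hg : HBound L₁ L₂ s g B) :
    SobBound L₁ L₂ n (fourierCf L₁ L₂ g) (B ^ 2 / (L₁ * L₂)) := by
  refine ⟨((memH_iff n hs).1 hg.1).2, ?_⟩
  have h := hg.2
  rw [hNorm_eq n hs] at h
  rw [le_div_iff₀ (by positivity), mul_comm]
  exact (Real.sqrt_le_left ((Real.sqrt_nonneg _).trans h)).1 h

theorem SobBound.hBound (hL₁ : 0 < L₁) (hL₂ : 0 < L₂) {s B : ℝ} (n : ℕ) (hs : s = (n : ℝ) / 2)
    (hp : PerL2 L₁ L₂ g) (hg : SobBound L₁ L₂ n (fourierCf L₁ L₂ g) B) :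
    HBound L₁ L₂ s g √(L₁ * L₂ * B) := by
  refine ⟨(memH_iff n hs).2 ⟨hp, hg.1⟩, ?_⟩
  rw [hNorm_eq n hs]
  have := hg.2
  gcongr

end Coefficients

/-! ### Weak formulations in terms of Fourier coefficients -/

section Weak

variable {L₁ L₂ : ℝ} {g h : ℝ × ℝ → ℝ} (hL₁ : 0 < L₁) (hL₂ : 0 < L₂)

/-- The Fourier coefficient of a distribution. -/
def distCf (f : TestFn L₁ L₂ →ₗ[ℝ] ℝ) (κ : ℤ × ℤ) : ℂ :=
  ((L₁ * L₂)⁻¹ : ℝ) * ((f (cosMode hL₁ hL₂ κ) : ℂ) - f (sinMode hL₁ hL₂ κ) * Complex.I)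

theorem mul_distCf (f : TestFn L₁ L₂ →ₗ[ℝ] ℝ) (κ : ℤ × ℤ) :
    ((L₁ * L₂ : ℝ) : ℂ) * distCf hL₁ hL₂ f κ =
      (f (cosMode hL₁ hL₂ κ) : ℂ) - f (sinMode hL₁ hL₂ κ) * Complex.I := by
  have : ((L₁ * L₂ : ℝ) : ℂ) ≠ 0 := by exact_mod_cast (mul_pos hL₁ hL₂).ne'
  rw [distCf, Complex.ofReal_inv, mul_inv_cancel_left₀ this]

theorem continuous_cosMode (κ : ℤ × ℤ) : Continuous (cosMode hL₁ hL₂ κ).1 :=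
  (cosMode hL₁ hL₂ κ).2.1.continuous

theorem continuous_sinMode (κ : ℤ × ℤ) : Continuous (sinMode hL₁ hL₂ κ).1 :=
  (sinMode hL₁ hL₂ κ).2.1.continuous

theorem integrable_mul_cosMode (hg : Integrable g (volume.restrict (cell L₁ L₂))) (κ : ℤ × ℤ) :
    Integrable (fun p => g p * (cosMode hL₁ hL₂ κ).1 p) (volume.restrict (cell L₁ L₂)) :=
  hg.mul_bdd (c := 1) (continuous_cosMode hL₁ hL₂ κ).aestronglyMeasurable
    (Filter.Eventually.of_forall fun _ => by
      simpa [cosMode] using Real.abs_cos_le_one _)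

theorem integrable_mul_sinMode (hg : Integrable g (volume.restrict (cell L₁ L₂))) (κ : ℤ × ℤ) :
    Integrable (fun p => g p * (sinMode hL₁ hL₂ κ).1 p) (volume.restrict (cell L₁ L₂)) :=
  hg.mul_bdd (c := 1) (continuous_sinMode hL₁ hL₂ κ).aestronglyMeasurable
    (Filter.Eventually.of_forall fun _ => by
      simpa [sinMode] using Real.abs_sin_le_one _)

theorem mul_fourierCf (hg : Integrable g (volume.restrict (cell L₁ L₂))) (κ : ℤ × ℤ) :
    ((L₁ * L₂ : ℝ) : ℂ) * fourierCf L₁ L₂ g κ =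
      (cellInt L₁ L₂ (fun p => g p * (cosMode hL₁ hL₂ κ).1 p) : ℂ) -
        cellInt L₁ L₂ (fun p => g p * (sinMode hL₁ hL₂ κ).1 p) * Complex.I := by
  have : ((L₁ * L₂ : ℝ) : ℂ) ≠ 0 := by exact_mod_cast (mul_pos hL₁ hL₂).ne'
  rw [fourierCf_eq_cfourierCf, cfourierCf, Complex.ofReal_inv, mul_inv_cancel_left₀ this, cellInt,
    cellInt, ← integral_complex_ofReal, ← integral_complex_ofReal, ← integral_mul_const,
    ← integral_sub (integrable_mul_cosMode hL₁ hL₂ hg κ).ofReal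
      ((integrable_mul_sinMode hL₁ hL₂ hg κ).ofReal.mul_const _)]
  refine integral_congr_ae (Filter.Eventually.of_forall fun p => ?_)
  simp only
  rw [← conj_expMode, expMode_eq]
  simp only [cosMode, sinMode, map_add, map_mul, Complex.conj_ofReal, Complex.conj_I]
  push_cast
  ring

theorem distCf_of_represents {f : TestFn L₁ L₂ →ₗ[ℝ] ℝ} (hf : Represents L₁ L₂ g f) :
    distCf hL₁ hL₂ f = fourierCf L₁ L₂ g := by
  ext κ
  have : ((L₁ * L₂ : ℝ) : ℂ) ≠ 0 := by exact_mod_cast (mul_pos hL₁ hL₂).ne'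
  apply mul_left_cancel₀ this
  rw [mul_distCf, mul_fourierCf hL₁ hL₂ hf.1.integrable, hf.2, hf.2]

theorem cellInt_const_mul (c : ℝ) (g : ℝ × ℝ → ℝ) :
    cellInt L₁ L₂ (fun p => c * g p) = c * cellInt L₁ L₂ g := integral_const_mul c g

/-- The coefficients `-i k_κ |k_κ|⁻² ω̂_κ` of the gradient of the streamfunction, including the mode
`κ = 0`, where both sides vanish. -/
theorem IsStreamfunction.fourierCf_grad (hL₁ : 0 < L₁) (hL₂ : 0 < L₂) {ω ψ ψx ψy : ℝ × ℝ → ℝ}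
    (hω : PerL2 L₁ L₂ ω) (H : IsStreamfunction L₁ L₂ ω ψ ψx ψy) (κ : ℤ × ℤ) :
    fourierCf L₁ L₂ ψx κ = -(Complex.I * (2 * Real.pi * κ.1 / L₁ : ℝ) *
      ((waveNum L₁ L₂ κ ^ 2)⁻¹ : ℝ) * fourierCf L₁ L₂ ω κ) ∧
    fourierCf L₁ L₂ ψy κ = -(Complex.I * (2 * Real.pi * κ.2 / L₂ : ℝ) *
      ((waveNum L₁ L₂ κ ^ 2)⁻¹ : ℝ) * fourierCf L₁ L₂ ω κ) := by
  have hV : ((L₁ * L₂ : ℝ) : ℂ) ≠ 0 := by exact_mod_cast (mul_pos hL₁ hL₂).ne'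
  have e0 := mul_fourierCf hL₁ hL₂ H.perL2.integrable κ
  have ex := mul_fourierCf hL₁ hL₂ H.perL2_x.integrable κ
  have ey := mul_fourierCf hL₁ hL₂ H.perL2_y.integrable κ
  have ew := mul_fourierCf hL₁ hL₂ hω.integrable κ
  have x1 := H.weak_x (cosMode hL₁ hL₂ κ)
  have x2 := H.weak_x (sinMode hL₁ hL₂ κ)
  have y1 := H.weak_y (cosMode hL₁ hL₂ κ)
  have y2 := H.weak_y (sinMode hL₁ hL₂ κ)
  have l1 := H.laplace (cosMode hL₁ hL₂ κ)
  have l2 := H.laplace (sinMode hL₁ hL₂ κ)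
  simp only [pdx_cosMode, pdx_sinMode, pdy_cosMode, pdy_sinMode, lapl_cosMode, lapl_sinMode,
    mul_left_comm (ψ _), cellInt_const_mul] at x1 x2 y1 y2 l1 l2
  have c1 := congrArg (Complex.ofReal) x1
  have c2 := congrArg (Complex.ofReal) x2
  have c3 := congrArg (Complex.ofReal) y1
  have c4 := congrArg (Complex.ofReal) y2
  have c5 := congrArg (Complex.ofReal) l1
  have c6 := congrArg (Complex.ofReal) l2
  simp only [Complex.ofReal_mul, Complex.ofReal_neg] at c1 c2 c3 c4 c5 c6
  have fx : fourierCf L₁ L₂ ψx κ =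
      Complex.I * (2 * Real.pi * κ.1 / L₁ : ℝ) * fourierCf L₁ L₂ ψ κ := by
    apply mul_left_cancel₀ hV
    rw [ex, mul_left_comm, e0]
    linear_combination c1 - Complex.I * c2 +
      Complex.ofReal (2 * Real.pi * κ.1 / L₁) *
      Complex.ofReal (cellInt L₁ L₂ fun p => ψ p * (sinMode hL₁ hL₂ κ).1 p) * Complex.I_sq
  have fy : fourierCf L₁ L₂ ψy κ =
      Complex.I * (2 * Real.pi * κ.2 / L₂ : ℝ) * fourierCf L₁ L₂ ψ κ := by
    apply mul_left_cancel₀ hV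
    rw [ey, mul_left_comm, e0]
    linear_combination c3 - Complex.I * c4 +
      Complex.ofReal (2 * Real.pi * κ.2 / L₂) *
      Complex.ofReal (cellInt L₁ L₂ fun p => ψ p * (sinMode hL₁ hL₂ κ).1 p) * Complex.I_sq
  have fw : fourierCf L₁ L₂ ω κ = -(waveNum L₁ L₂ κ ^ 2 : ℝ) * fourierCf L₁ L₂ ψ κ := by
    apply mul_left_cancel₀ hV
    rw [ew, mul_left_comm, e0, waveNum_sq]
    linear_combination - c5 + Complex.I * c6
  rcases eq_or_ne κ 0 with rfl | hκ
  · simp [fx, fy]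
  · have hm : ((waveNum L₁ L₂ κ ^ 2 : ℝ) : ℂ) ≠ 0 := by
      exact_mod_cast (pow_pos (waveNum_pos hL₁ hL₂ hκ) 2).ne'
    rw [fx, fy, fw, Complex.ofReal_inv]
    constructor <;> field_simp

theorem cfourierCf_mul_expMode (F : ℝ × ℝ → ℂ) (κ l : ℤ × ℤ) :
    cfourierCf L₁ L₂ (fun p => F p * expMode L₁ L₂ (-κ) p) l = cfourierCf L₁ L₂ F (κ + l) := by
  rw [cfourierCf, cfourierCf]
  congr 2
  ext p
  rw [mul_assoc, ← expMode_add, neg_add]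

/-- The Fourier coefficients of a product of two square integrable functions are the convolution
of their Fourier coefficients. -/
theorem hasSum_fourierCf_mul (hL₁ : 0 < L₁) (hL₂ : 0 < L₂) (hg : PerL2 L₁ L₂ g)
    (hh : PerL2 L₁ L₂ h) (κ : ℤ × ℤ) :
    HasSum (fun j => fourierCf L₁ L₂ h j * fourierCf L₁ L₂ g (κ - j))
      (fourierCf L₁ L₂ (fun p => g p * h p) κ) := by
  have key := hasSum_cfourierCf hL₁ hL₂ hh.ofReal (MemLp.mul_expMode hg.ofReal (-κ))
  rw [← (Equiv.neg (ℤ × ℤ)).hasSum_iff] at key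
  convert! key using 1
  · ext j
    simp only [Function.comp, Equiv.neg_apply]
    rw [cfourierCf_mul_expMode, ← fourierCf_eq_cfourierCf, ← fourierCf_eq_cfourierCf,
      fourierCf_neg, Complex.conj_conj, sub_eq_add_neg]
  · rw [fourierCf_eq_cfourierCf, cfourierCf]
    congr 2
    ext p
    rw [Complex.conj_ofReal]
    push_cast
    ring

/-- The pairing of the Jacobian with the trigonometric test functions is the convolution `jac`. The
pair `(X, Y)` stands for the gradient of the streamfunction and `u` for its Laplacian. -/
theorem jacPair_modes {X Y W : ℝ × ℝ → ℝ} (hX : PerL2 L₁ L₂ X) (hY : PerL2 L₁ L₂ Y)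
    (hW : PerL2 L₁ L₂ W) {u : Coeffs}
    (eX : ∀ j, fourierCf L₁ L₂ X j = -(Complex.I * (2 * Real.pi * j.1 / L₁ : ℝ) *
      ((waveNum L₁ L₂ j ^ 2)⁻¹ : ℝ) * u j))
    (eY : ∀ j, fourierCf L₁ L₂ Y j = -(Complex.I * (2 * Real.pi * j.2 / L₂ : ℝ) *
      ((waveNum L₁ L₂ j ^ 2)⁻¹ : ℝ) * u j)) (κ : ℤ × ℤ) :
    (jacPair L₁ L₂ X Y W (cosMode hL₁ hL₂ κ).1 : ℂ) -
        jacPair L₁ L₂ X Y W (sinMode hL₁ hL₂ κ).1 * Complex.I =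
      (L₁ * L₂ : ℝ) * jac L₁ L₂ u (fourierCf L₁ L₂ W) κ := by
  set h : ℝ × ℝ → ℝ := fun p => 2 * Real.pi * κ.2 / L₂ * X p - 2 * Real.pi * κ.1 / L₁ * Y p
    with hdef
  have hh : PerL2 L₁ L₂ h := hX.lin hY _ _
  have eh : ∀ j, fourierCf L₁ L₂ h j = -(Complex.I *
      ((waveCross L₁ L₂ j κ / waveNum L₁ L₂ j ^ 2 : ℝ) : ℂ) * u j) := by
    intro j
    rw [hdef, fourierCf_lin hX hY, eX, eY, waveCross, div_eq_mul_inv _ (waveNum L₁ L₂ j ^ 2)]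
    push_cast
    ring
  have hc : jacPair L₁ L₂ X Y W (cosMode hL₁ hL₂ κ).1 =
      cellInt L₁ L₂ fun p => (W p * h p) * (sinMode hL₁ hL₂ κ).1 p := by
    rw [jacPair, ← neg_one_mul, ← cellInt_const_mul]
    congr 1
    ext p
    rw [pdx_cosMode, pdy_cosMode, hdef]
    ring
  have hs : jacPair L₁ L₂ X Y W (sinMode hL₁ hL₂ κ).1 =
      -cellInt L₁ L₂ fun p => (W p * h p) * (cosMode hL₁ hL₂ κ).1 p := by
    rw [jacPair]
    congr 2
    ext p
    rw [pdx_sinMode, pdy_sinMode, hdef]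
    ring
  have e := mul_fourierCf hL₁ hL₂ (hW.2.integrable_mul hh.2) κ
  have e2 := (hasSum_fourierCf_mul hL₁ hL₂ hW hh κ).mul_left Complex.I
  have e3 : jac L₁ L₂ u (fourierCf L₁ L₂ W) κ =
      Complex.I * fourierCf L₁ L₂ (fun p => W p * h p) κ := by
    rw [← e2.tsum_eq, jac]
    refine tsum_congr fun j => ?_
    rw [eh]
    linear_combination ((waveCross L₁ L₂ j κ / waveNum L₁ L₂ j ^ 2 : ℝ) : ℂ) * u j *
      fourierCf L₁ L₂ W (κ - j) * Complex.I_sq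
  simp only [Pi.mul_apply] at e
  rw [hc, hs, e3, Complex.ofReal_neg]
  have e' : ((L₁ * L₂ : ℝ) : ℂ) * fourierCf L₁ L₂ (fun p => W p * h p) κ = _ := e
  rw [mul_left_comm, e']
  linear_combination Complex.ofReal
    (cellInt L₁ L₂ fun p => (W p * h p) * (sinMode hL₁ hL₂ κ).1 p) * Complex.I_sq

theorem fourierCf_extrap {u v : ℝ × ℝ → ℝ} (hu : PerL2 L₁ L₂ u) (hv : PerL2 L₁ L₂ v) :
    fourierCf L₁ L₂ (fun p => 2 * v p - u p) =
      extrap (fourierCf L₁ L₂ u) (fourierCf L₁ L₂ v) := by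
  ext κ
  have := fourierCf_lin hv hu 2 1 κ
  simp only [one_mul, Complex.ofReal_one] at this
  rw [this, extrap]
  push_cast
  ring

theorem PerL2.extrap {u v : ℝ × ℝ → ℝ} (hu : PerL2 L₁ L₂ u) (hv : PerL2 L₁ L₂ v) :
    PerL2 L₁ L₂ (fun p => 2 * v p - u p) := by
  simpa using hv.lin hu 2 1

end Weak

section Trajectory

variable {L₁ L₂ μ k : ℝ} (hL₁ : 0 < L₁) (hL₂ : 0 < L₂)
  {f : ℕ → (TestFn L₁ L₂ →ₗ[ℝ] ℝ)} {ω : ℕ → ℝ × ℝ → ℝ}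

/-- The scheme, mode by mode: it is the weak formulation tested with `cos (k_κ · p)` and
`sin (k_κ · p)`. -/
theorem IsSolution.isStep (hk : 0 < k) (H : IsSolution L₁ L₂ μ k f ω) (n : ℕ) :
    IsStep L₁ L₂ μ k (fourierCf L₁ L₂ (ω n)) (fourierCf L₁ L₂ (ω (n + 1)))
      (fourierCf L₁ L₂ (ω (n + 2)))
      (jac L₁ L₂ (extrap (fourierCf L₁ L₂ (ω n)) (fourierCf L₁ L₂ (ω (n + 1))))
        (extrap (fourierCf L₁ L₂ (ω n)) (fourierCf L₁ L₂ (ω (n + 1)))))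
      (distCf hL₁ hL₂ (f (n + 1))) := by
  obtain ⟨ψ, ψx, ψy, hψ, hs⟩ := H.scheme
  intro κ
  have hV : ((L₁ * L₂ : ℝ) : ℂ) ≠ 0 := by exact_mod_cast (mul_pos hL₁ hL₂).ne'
  have hk' : (k : ℂ) ≠ 0 := by exact_mod_cast hk.ne'
  have p0 := H.perL2 n
  have p1 := H.perL2 (n + 1)
  have p2 := H.perL2 (n + 2)
  have hx := (hψ n).perL2_x.extrap (hψ (n + 1)).perL2_x
  have hy := (hψ n).perL2_y.extrap (hψ (n + 1)).perL2_y
  have ej := jacPair_modes hL₁ hL₂ hx hy (p0.extrap p1)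
    (u := extrap (fourierCf L₁ L₂ (ω n)) (fourierCf L₁ L₂ (ω (n + 1))))
    (fun j => by
      rw [fourierCf_extrap (hψ n).perL2_x (hψ (n + 1)).perL2_x, extrap, extrap,
        ((hψ n).fourierCf_grad hL₁ hL₂ p0 j).1, ((hψ (n + 1)).fourierCf_grad hL₁ hL₂ p1 j).1]
      ring)
    (fun j => by
      rw [fourierCf_extrap (hψ n).perL2_y (hψ (n + 1)).perL2_y, extrap, extrap,
        ((hψ n).fourierCf_grad hL₁ hL₂ p0 j).2, ((hψ (n + 1)).fourierCf_grad hL₁ hL₂ p1 j).2]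
      ring) κ
  rw [fourierCf_extrap p0 p1] at ej
  set D : ℝ × ℝ → ℝ := fun p => (3 * ω (n + 2) p - 4 * ω (n + 1) p + ω n p) / (2 * k) with hD
  have hD' : D = fun p =>
      (2 * k)⁻¹ * (3 * ω (n + 2) p - 4 * ω (n + 1) p) - (-(2 * k)⁻¹) * ω n p := by
    ext p
    rw [hD]
    ring
  have hDp : PerL2 L₁ L₂ D := by
    rw [hD']
    exact (p2.lin p1 3 4).lin p0 _ _
  have eD := mul_fourierCf hL₁ hL₂ hDp.integrable κ
  have eD2 : fourierCf L₁ L₂ D κ = (2 * k : ℂ)⁻¹ * (3 * fourierCf L₁ L₂ (ω (n + 2)) κ -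
      4 * fourierCf L₁ L₂ (ω (n + 1)) κ + fourierCf L₁ L₂ (ω n) κ) := by
    rw [hD', fourierCf_lin (p2.lin p1 3 4) p0, fourierCf_lin p2 p1]
    push_cast
    ring
  have ew := mul_fourierCf hL₁ hL₂ p2.integrable κ
  have ef := mul_distCf hL₁ hL₂ (f (n + 1)) κ
  have s1 := hs n (cosMode hL₁ hL₂ κ)
  have s2 := hs n (sinMode hL₁ hL₂ κ)
  simp only [lapl_cosMode, lapl_sinMode, mul_left_comm (ω _ _), cellInt_const_mul] at s1 s2
  have c1 := congrArg (Complex.ofReal) s1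
  have c2 := congrArg (Complex.ofReal) s2
  simp only [Complex.ofReal_mul, Complex.ofReal_neg, Complex.ofReal_add] at c1 c2
  rw [eD2] at eD
  have hw : ((waveSq L₁ L₂ κ : ℝ) : ℂ) = (waveNum L₁ L₂ κ : ℂ) ^ 2 := by
    rw [← waveNum_sq]
    push_cast
    rfl
  rw [hw] at c1 c2
  have key : ((L₁ * L₂ : ℝ) : ℂ) * ((2 * k : ℂ)⁻¹ * (3 * fourierCf L₁ L₂ (ω (n + 2)) κ -
      4 * fourierCf L₁ L₂ (ω (n + 1)) κ + fourierCf L₁ L₂ (ω n) κ) +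
      jac L₁ L₂ (extrap (fourierCf L₁ L₂ (ω n)) (fourierCf L₁ L₂ (ω (n + 1))))
        (extrap (fourierCf L₁ L₂ (ω n)) (fourierCf L₁ L₂ (ω (n + 1)))) κ +
      μ * (waveNum L₁ L₂ κ : ℂ) ^ 2 * fourierCf L₁ L₂ (ω (n + 2)) κ) =
      ((L₁ * L₂ : ℝ) : ℂ) * distCf hL₁ hL₂ (f (n + 1)) κ := by
    rw [ef]
    linear_combination eD - ej + c1 - Complex.I * c2 + μ * (waveNum L₁ L₂ κ : ℂ) ^ 2 * ew
  have key' := mul_left_cancel₀ hV key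
  rw [← key']
  field_simp

end Trajectory

/-! ### The forcing in terms of Fourier coefficients -/

section Forcing

variable {L₁ L₂ : ℝ} (hL₁ : 0 < L₁) (hL₂ : 0 < L₂)

theorem integral_exp_period {L : ℝ} (hL : 0 < L) {n : ℤ} (hn : n ≠ 0) :
    ∫ x in Set.Ioc 0 L, Complex.exp ((2 * Real.pi * n / L : ℝ) * Complex.I * x) = 0 := by
  have hL' : (L : ℂ) ≠ 0 := by exact_mod_cast hL.ne'
  have hc : ((2 * Real.pi * n / L : ℝ) : ℂ) * Complex.I ≠ 0 := by
    refine mul_ne_zero ?_ Complex.I_ne_zero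
    have : (n : ℝ) ≠ 0 := by exact_mod_cast hn
    exact_mod_cast (div_ne_zero (mul_ne_zero (by positivity) this) hL.ne')
  rw [← intervalIntegral.integral_of_le hL.le, integral_exp_mul_complex hc,
    show ((2 * Real.pi * n / L : ℝ) : ℂ) * Complex.I * L = n * (2 * Real.pi * Complex.I) by
      push_cast
      field_simp, Complex.exp_int_mul_two_pi_mul_I]
  simp

theorem integral_expMode {κ : ℤ × ℤ} (hL₁ : 0 < L₁) (hL₂ : 0 < L₂) (hκ : κ ≠ 0) :
    ∫ p in cell L₁ L₂, expMode L₁ L₂ κ p = 0 := by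
  have h : ∀ p : ℝ × ℝ, expMode L₁ L₂ κ p =
      Complex.exp ((2 * Real.pi * κ.1 / L₁ : ℝ) * Complex.I * p.1) *
        Complex.exp ((2 * Real.pi * κ.2 / L₂ : ℝ) * Complex.I * p.2) := by
    intro p
    rw [expMode_eq_exp_phase, phase, ← Complex.exp_add]
    congr 1
    push_cast
    ring
  simp only [h]
  rw [cell, Measure.volume_eq_prod, setIntegral_prod_mul
    (fun x : ℝ => Complex.exp ((2 * Real.pi * κ.1 / L₁ : ℝ) * Complex.I * x))
    (fun x : ℝ => Complex.exp ((2 * Real.pi * κ.2 / L₂ : ℝ) * Complex.I * x))]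
  by_cases h1 : κ.1 = 0
  · have h2 : κ.2 ≠ 0 := fun h2 => hκ (Prod.ext h1 h2)
    rw [integral_exp_period hL₂ h2, mul_zero]
  · rw [integral_exp_period hL₁ h1, zero_mul]

theorem integrable_expMode (κ : ℤ × ℤ) :
    Integrable (expMode L₁ L₂ κ) (volume.restrict (cell L₁ L₂)) := by
  simpa using memLp_one_iff_integrable.1 (MemLp.mul_expMode (L₁ := L₁) (L₂ := L₂)
    (memLp_const (1 : ℂ)) κ)

/-- Parseval's identity for trigonometric polynomials. -/
theorem integral_norm_sq_trigPoly (hL₁ : 0 < L₁) (hL₂ : 0 < L₂) (S : Finset (ℤ × ℤ))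
    (b : Coeffs) :
    ∫ p in cell L₁ L₂, ‖∑ κ ∈ S, b κ * expMode L₁ L₂ κ p‖ ^ 2 =
      L₁ * L₂ * ∑ κ ∈ S, ‖b κ‖ ^ 2 := by
  have hv : ∫ p in cell L₁ L₂, expMode L₁ L₂ 0 p = (L₁ * L₂ : ℝ) := by
    simp only [expMode_zero]
    rw [integral_const, Measure.real, Measure.restrict_apply_univ, cell, Measure.volume_eq_prod,
      Measure.prod_prod, Real.volume_Ioc, Real.volume_Ioc, sub_zero, sub_zero,
      ← ENNReal.ofReal_mul hL₁.le, ENNReal.toReal_ofReal (by positivity), Complex.real_smul,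
      mul_one]
  have e : ∀ p, ((‖∑ κ ∈ S, b κ * expMode L₁ L₂ κ p‖ ^ 2 : ℝ) : ℂ) =
      ∑ κ ∈ S, ∑ l ∈ S, (starRingEnd ℂ) (b κ) * b l * expMode L₁ L₂ (l - κ) p := by
    intro p
    rw [Complex.ofReal_pow, ← Complex.conj_mul', map_sum, Finset.sum_mul_sum]
    refine Finset.sum_congr rfl fun κ _ => Finset.sum_congr rfl fun l _ => ?_
    rw [map_mul, conj_expMode, sub_eq_add_neg, expMode_add]
    ring
  have e2 : ((∫ p in cell L₁ L₂, ‖∑ κ ∈ S, b κ * expMode L₁ L₂ κ p‖ ^ 2 : ℝ) : ℂ) =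
      ((L₁ * L₂ * ∑ κ ∈ S, ‖b κ‖ ^ 2 : ℝ) : ℂ) := by
    rw [← integral_complex_ofReal]
    simp only [e]
    rw [integral_finsetSum _ fun κ _ => integrable_finsetSum _ fun l _ =>
      (integrable_expMode (l - κ)).const_mul _, Complex.ofReal_mul, Complex.ofReal_sum,
      Finset.mul_sum]
    refine Finset.sum_congr rfl fun κ hκ => ?_
    rw [integral_finsetSum _ fun l _ => (integrable_expMode (l - κ)).const_mul _,
      Finset.sum_eq_single_of_mem κ hκ]
    · rw [integral_const_mul, sub_self, hv, Complex.conj_mul', mul_comm, Complex.ofReal_pow]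
    · intro l _ hl
      rw [integral_const_mul, integral_expMode hL₁ hL₂ (sub_ne_zero.2 hl), mul_zero]
  exact_mod_cast e2

/-- The trigonometric polynomial `Re ∑ b_κ exp(i k_κ · p)`. -/
def trigPoly (S : Finset (ℤ × ℤ)) (b : Coeffs) : TestFn L₁ L₂ :=
  ∑ κ ∈ S, ((b κ).re • cosMode hL₁ hL₂ κ - (b κ).im • sinMode hL₁ hL₂ κ)

theorem hasFDerivAt_trigPoly (S : Finset (ℤ × ℤ)) (b : Coeffs) (p : ℝ × ℝ) :
    HasFDerivAt (trigPoly hL₁ hL₂ S b).1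
      (∑ κ ∈ S, (-(b κ).im * Real.cos (phase L₁ L₂ κ p) -
          (b κ).re * Real.sin (phase L₁ L₂ κ p)) •
        ((2 * Real.pi * κ.1 / L₁) • ContinuousLinearMap.fst ℝ ℝ ℝ +
          (2 * Real.pi * κ.2 / L₂) • ContinuousLinearMap.snd ℝ ℝ ℝ)) p := by
  have h := HasFDerivAt.fun_sum (u := S) fun κ _ =>
    hasFDerivAt_trig (L₁ := L₁) (L₂ := L₂) κ (b κ).re (-(b κ).im) p
  convert! h using 1
  ext p
  simp [trigPoly, cosMode, sinMode, sub_eq_add_neg]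

theorem pdx_trigPoly (S : Finset (ℤ × ℤ)) (b : Coeffs) (p : ℝ × ℝ) :
    pdx (trigPoly hL₁ hL₂ S b).1 p =
      (∑ κ ∈ S, Complex.I * (2 * Real.pi * κ.1 / L₁ : ℝ) * b κ * expMode L₁ L₂ κ p).re := by
  rw [pdx, (hasFDerivAt_trigPoly hL₁ hL₂ S b p).fderiv, Complex.re_sum,
    sum_apply]
  refine Finset.sum_congr rfl fun κ _ => ?_
  rw [expMode_eq]
  simp [-Complex.ofReal_cos, -Complex.ofReal_sin, -Complex.ofReal_div, -Complex.ofReal_mul]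
  ring

theorem pdy_trigPoly (S : Finset (ℤ × ℤ)) (b : Coeffs) (p : ℝ × ℝ) :
    pdy (trigPoly hL₁ hL₂ S b).1 p =
      (∑ κ ∈ S, Complex.I * (2 * Real.pi * κ.2 / L₂ : ℝ) * b κ * expMode L₁ L₂ κ p).re := by
  rw [pdy, (hasFDerivAt_trigPoly hL₁ hL₂ S b p).fderiv, Complex.re_sum,
    sum_apply]
  refine Finset.sum_congr rfl fun κ _ => ?_
  rw [expMode_eq]
  simp [-Complex.ofReal_cos, -Complex.ofReal_sin, -Complex.ofReal_div, -Complex.ofReal_mul]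
  ring

theorem integrable_norm_sq_trigPoly (S : Finset (ℤ × ℤ)) (b : Coeffs) :
    Integrable (fun p => ‖∑ κ ∈ S, b κ * expMode L₁ L₂ κ p‖ ^ 2)
      (volume.restrict (cell L₁ L₂)) := by
  refine MemLp.integrable_norm_pow ?_ two_ne_zero
  refine memLp_finsetSum _ fun κ _ => ?_
  exact MemLp.mul_expMode (memLp_const (b κ)) κ

theorem cellInt_grad_trigPoly_le (S : Finset (ℤ × ℤ)) (b : Coeffs) :
    cellInt L₁ L₂ (fun p => pdx (trigPoly hL₁ hL₂ S b).1 p ^ 2 +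
      pdy (trigPoly hL₁ hL₂ S b).1 p ^ 2) ≤
      L₁ * L₂ * ∑ κ ∈ S, waveNum L₁ L₂ κ ^ 2 * ‖b κ‖ ^ 2 := by
  have h1 := integral_norm_sq_trigPoly hL₁ hL₂ S
    fun κ => Complex.I * (2 * Real.pi * κ.1 / L₁ : ℝ) * b κ
  have h2 := integral_norm_sq_trigPoly hL₁ hL₂ S
    fun κ => Complex.I * (2 * Real.pi * κ.2 / L₂ : ℝ) * b κ
  have i1 := integrable_norm_sq_trigPoly (L₁ := L₁) (L₂ := L₂) S
    fun κ => Complex.I * (2 * Real.pi * κ.1 / L₁ : ℝ) * b κ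
  have i2 := integrable_norm_sq_trigPoly (L₁ := L₁) (L₂ := L₂) S
    fun κ => Complex.I * (2 * Real.pi * κ.2 / L₂ : ℝ) * b κ
  have hre : ∀ z : ℂ, z.re ^ 2 ≤ ‖z‖ ^ 2 := fun z => by
    rw [← sq_abs z.re]
    gcongr
    exact Complex.abs_re_le_norm z
  calc _ ≤ _ := integral_mono_of_nonneg (Filter.Eventually.of_forall fun p => by positivity)
        (i1.add i2) (Filter.Eventually.of_forall fun p => by
          simp only [pdx_trigPoly, pdy_trigPoly]
          exact add_le_add (hre _) (hre _))
    _ = _ := by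
      simp only [Pi.add_apply]
      rw [integral_add i1 i2, h1, h2, ← mul_add, ← Finset.sum_add_distrib]
      congr 1
      refine Finset.sum_congr rfl fun κ _ => ?_
      simp only [norm_mul, Complex.norm_I, one_mul, Complex.norm_real, mul_pow, Real.norm_eq_abs,
        sq_abs]
      rw [waveNum_sq, waveSq]
      ring

theorem map_trigPoly (f : TestFn L₁ L₂ →ₗ[ℝ] ℝ) (S : Finset (ℤ × ℤ)) (b : Coeffs) :
    f (trigPoly hL₁ hL₂ S b) =
      L₁ * L₂ * ∑ κ ∈ S, (b κ * (starRingEnd ℂ) (distCf hL₁ hL₂ f κ)).re := by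
  have hV : L₁ * L₂ ≠ 0 := (mul_pos hL₁ hL₂).ne'
  rw [trigPoly, map_sum, Finset.mul_sum]
  refine Finset.sum_congr rfl fun κ _ => ?_
  rw [map_sub, map_smul, map_smul, distCf]
  simp [-Complex.ofReal_mul, -Complex.ofReal_inv, -mul_inv_rev]
  field_simp

/-- The norm of `H⁻¹`, defined by duality with test functions, bounds the norm of the coefficients
of order `-1`: test with the trigonometric polynomials with coefficients `|k_κ|⁻² f̂_κ`. -/
theorem HNegBound.sum_le {f : TestFn L₁ L₂ →ₗ[ℝ] ℝ} {B : ℝ} (hf : HNegBound L₁ L₂ f B)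
    (S : Finset (ℤ × ℤ)) :
    ∑ κ ∈ S, (waveNum L₁ L₂ κ ^ 2)⁻¹ * ‖distCf hL₁ hL₂ f κ‖ ^ 2 ≤ B ^ 2 / (L₁ * L₂) := by
  have hV : 0 < L₁ * L₂ := mul_pos hL₁ hL₂
  set b : Coeffs := fun κ => ((waveNum L₁ L₂ κ ^ 2)⁻¹ : ℝ) * distCf hL₁ hL₂ f κ with hb
  set X := ∑ κ ∈ S, (waveNum L₁ L₂ κ ^ 2)⁻¹ * ‖distCf hL₁ hL₂ f κ‖ ^ 2 with hX
  have hX0 : 0 ≤ X := Finset.sum_nonneg fun κ _ => by positivity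
  have h1 : f (trigPoly hL₁ hL₂ S b) = L₁ * L₂ * X := by
    rw [map_trigPoly]
    congr 1
    refine Finset.sum_congr rfl fun κ _ => ?_
    rw [hb, mul_assoc, Complex.mul_conj', ← Complex.ofReal_pow, Complex.re_ofReal_mul,
      Complex.ofReal_re]
  have h2 : cellInt L₁ L₂ (fun p => pdx (trigPoly hL₁ hL₂ S b).1 p ^ 2 +
      pdy (trigPoly hL₁ hL₂ S b).1 p ^ 2) ≤ L₁ * L₂ * X := by
    refine (cellInt_grad_trigPoly_le hL₁ hL₂ S b).trans_eq ?_
    congr 1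
    refine Finset.sum_congr rfl fun κ _ => ?_
    rcases eq_or_ne (waveNum L₁ L₂ κ) 0 with h0 | h0
    · simp [h0]
    · rw [hb, norm_mul, Complex.norm_real, mul_pow, Real.norm_eq_abs, sq_abs]
      field_simp
  have h3 := hf (trigPoly hL₁ hL₂ S b)
  rw [h1, abs_of_nonneg (by positivity)] at h3
  have h4 : L₁ * L₂ * X ≤ |B| * √(L₁ * L₂ * X) :=
    h3.trans (mul_le_mul (le_abs_self B) (Real.sqrt_le_sqrt h2) (Real.sqrt_nonneg _)
      (abs_nonneg _))
  have h5 : √(L₁ * L₂ * X) ≤ |B| := by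
    rcases (Real.sqrt_nonneg (L₁ * L₂ * X)).eq_or_lt with h0 | h0
    · rw [← h0]
      exact abs_nonneg _
    · refine le_of_mul_le_mul_right ?_ h0
      rwa [Real.mul_self_sqrt (by positivity)]
  rw [le_div_iff₀ hV, ← sq_abs B, mul_comm]
  exact (Real.sqrt_le_left (abs_nonneg _)).1 h5

theorem HNegBound.dual {f : TestFn L₁ L₂ →ₗ[ℝ] ℝ} {B : ℝ} (hf : HNegBound L₁ L₂ f B) :
    DualSummable L₁ L₂ (distCf hL₁ hL₂ f) ∧
      dualSq L₁ L₂ (distCf hL₁ hL₂ f) ≤ B ^ 2 / (L₁ * L₂) := by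
  have h := summable_of_sum_le (fun κ => by positivity) (hf.sum_le hL₁ hL₂)
  exact ⟨h, h.tsum_le_of_sum_le (hf.sum_le hL₁ hL₂)⟩

theorem distCf_sub (f f' : TestFn L₁ L₂ →ₗ[ℝ] ℝ) :
    distCf hL₁ hL₂ (f - f') = fun κ => distCf hL₁ hL₂ f κ - distCf hL₁ hL₂ f' κ := by
  ext κ
  simp only [distCf, LinearMap.sub_apply]
  push_cast
  ring

/-- A distribution in `H⁻¹` has zero mean. -/
theorem HNegBound.distCf_zero {f : TestFn L₁ L₂ →ₗ[ℝ] ℝ} {B : ℝ} (hf : HNegBound L₁ L₂ f B) :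
    distCf hL₁ hL₂ f 0 = 0 := by
  have h1 := hf (cosMode hL₁ hL₂ 0)
  have h2 := hf (sinMode hL₁ hL₂ 0)
  simp [pdx_cosMode, pdy_cosMode, pdx_sinMode, pdy_sinMode, cellInt] at h1 h2
  simp [distCf, h1, h2]

theorem ForceL2Bound.sobBound {f : TestFn L₁ L₂ →ₗ[ℝ] ℝ} {B : ℝ}
    (hf : ForceL2Bound L₁ L₂ f B) :
    SobBound L₁ L₂ 0 (distCf hL₁ hL₂ f) (B ^ 2 / (L₁ * L₂)) := by
  obtain ⟨g, hg, hB⟩ := hf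
  rw [distCf_of_represents hL₁ hL₂ hg]
  refine ⟨sobSummable_zero hL₁ hL₂ hg.1, ?_⟩
  rw [l2Norm, l2Sq_eq hL₁ hL₂ hg.1] at hB
  rw [le_div_iff₀ (by positivity), mul_comm]
  exact (Real.sqrt_le_left ((Real.sqrt_nonneg _).trans hB)).1 hB

theorem ForceH1Bound.sobBound {f : TestFn L₁ L₂ →ₗ[ℝ] ℝ} {B : ℝ}
    (hf : ForceH1Bound L₁ L₂ f B) :
    SobBound L₁ L₂ 2 (distCf hL₁ hL₂ f) (B ^ 2 / (L₁ * L₂)) := by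
  obtain ⟨g, hg, hB⟩ := hf
  rw [distCf_of_represents hL₁ hL₂ hg]
  exact hB.sobBound hL₁ hL₂ 2 (by norm_num)

theorem IsSolution.isTrajectory {μ k R : ℝ} {f : ℕ → (TestFn L₁ L₂ →ₗ[ℝ] ℝ)}
    {ω : ℕ → ℝ × ℝ → ℝ} {F : ℝ} (hμ : 0 < μ) (hk : 0 < k) (H : IsSolution L₁ L₂ μ k f ω)
    (hf : ∀ n, HNegBound L₁ L₂ (f n) F) (h0 : HBound L₁ L₂ (1 / 2) (ω 0) R)
    (h1 : HBound L₁ L₂ (1 / 2) (ω 1) R) :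
    IsTrajectory L₁ L₂ μ k (fun n => fourierCf L₁ L₂ (ω n)) fun n => distCf hL₁ hL₂ (f n) where
  pos₁ := hL₁
  pos₂ := hL₂
  μ_pos := hμ
  k_pos := hk
  zero n := by rw [fourierCf_zero, H.mean_zero, mul_zero, Complex.ofReal_zero]
  conj n κ := fourierCf_neg _ _
  sob_zero n := sobSummable_zero hL₁ hL₂ (H.perL2 n)
  sob_one_init := ⟨(h0.sobBound hL₁ hL₂ 1 (by norm_num)).1, (h1.sobBound hL₁ hL₂ 1 (by norm_num)).1⟩
  dual n := ((hf n).dual hL₁ hL₂).1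
  step n := H.isStep hL₁ hL₂ hk n

/-- The squared `L²` norm of an increment. -/
theorem l2Sq_increment {μ k : ℝ} {f : ℕ → (TestFn L₁ L₂ →ₗ[ℝ] ℝ)}
    {ω : ℕ → ℝ × ℝ → ℝ} (hL₁ : 0 < L₁) (hL₂ : 0 < L₂) (H : IsSolution L₁ L₂ μ k f ω) (n : ℕ) :
    l2Sq L₁ L₂ (fun p => ω (n + 1) p - ω n p) =
      L₁ * L₂ * incSq L₁ L₂ (fun n => fourierCf L₁ L₂ (ω n)) n := by
  have h := l2Sq_eq hL₁ hL₂ ((H.perL2 (n + 1)).lin (H.perL2 n) 1 1)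
  have e : fourierCf L₁ L₂ (fun p => 1 * ω (n + 1) p - 1 * ω n p) =
      fun κ => fourierCf L₁ L₂ (ω (n + 1)) κ - fourierCf L₁ L₂ (ω n) κ := by
    ext κ
    rw [fourierCf_lin (H.perL2 (n + 1)) (H.perL2 n)]
    simp
  rw [e] at h
  simpa only [one_mul, incSq] using h

end Forcing

/-! ### Bounds for large times -/

section LargeTimes

variable {L₁ L₂ μ k : ℝ} {N : ℕ} {a g : ℕ → Coeffs}

/-- The time after which an initial energy `E` has decayed to size `1`, at a rate which is half the
decay rate; one further time step is accounted for. -/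
def settleTime (L₁ L₂ μ E : ℝ) : ℝ :=
  2 / decayRate L₁ L₂ μ * Real.log (1 + E) + 1 / decayRate L₁ L₂ μ

theorem settleTime_pos (hL₁ : 0 < L₁) (hμ : 0 < μ) {E : ℝ} (hE : 0 ≤ E) :
    0 < settleTime L₁ L₂ μ E := by
  have h1 := decayRate_pos (L₂ := L₂) hL₁ hμ
  have h2 := Real.log_nonneg (show 1 ≤ 1 + E by linarith)
  unfold settleTime
  positivity

theorem SobBound.mono {n : ℕ} {u : Coeffs} {B B' : ℝ} (h : SobBound L₁ L₂ n u B) (hB : B ≤ B') :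
    SobBound L₁ L₂ n u B' := ⟨h.1, h.2.trans hB⟩

theorem SobBound.of_add_two (hL₁ : 0 < L₁) (hL₂ : 0 < L₂) {n : ℕ} {u : Coeffs} {B : ℝ}
    (hu : u 0 = 0) (h : SobBound L₁ L₂ (n + 2) u B) :
    SobBound L₁ L₂ n u (poincareRoot L₁ L₂ ^ 2 * B) := by
  have h1 : SobSummable L₁ L₂ (n + 1) u := SobSummable.of_succ hL₁ hL₂ hu h.1
  refine ⟨h1.of_succ hL₁ hL₂ hu, (sobSq_le_succ hL₁ hL₂ hu h1).trans ?_⟩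
  have hr := (poincareRoot_pos (L₂ := L₂) hL₁).le
  have h2 := (sobSq_le_succ hL₁ hL₂ hu h.1).trans (mul_le_mul_of_nonneg_left h.2 hr)
  exact (mul_le_mul_of_nonneg_left h2 hr).trans_eq (by ring)

theorem SobBound.dualSq_le (hL₁ : 0 < L₁) (hL₂ : 0 < L₂) {u : Coeffs} {B : ℝ} (hu : u 0 = 0)
    (h : SobBound L₁ L₂ 0 u B) : dualSq L₁ L₂ u ≤ poincareRoot L₁ L₂ ^ 2 * B :=
  (PeriodicNS.dualSq_le hL₁ hL₂ hu h.1).trans (mul_le_mul_of_nonneg_left h.2 (by positivity))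

namespace IsStable

/-- After the settling time, the bound for the energy depends on the forcing only. -/
theorem energy_le_of_settleTime_le (H : IsStable L₁ L₂ μ k N a g) {E Φ : ℝ}
    (hE : bdfEnergy L₁ L₂ 0 (decayRate L₁ L₂ μ * k) (a 0) (a 1) ≤ E)
    (hΦ : ∀ n, dualSq L₁ L₂ (g n) ≤ Φ) {n : ℕ} (hn : settleTime L₁ L₂ μ E ≤ n * k) :
    bdfEnergy L₁ L₂ 0 (decayRate L₁ L₂ μ * k) (a n) (a (n + 1)) ≤
      1 + 8 * Φ / (μ * decayRate L₁ L₂ μ) := by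
  have hν := H.rate_pos
  have hk := H.k_pos
  have hE0 : 0 ≤ E := (bdfEnergy_nonneg (by positivity)).trans hE
  have ht := settleTime_pos (L₂ := L₂) H.pos₁ H.μ_pos hE0
  obtain ⟨j, rfl⟩ : ∃ j, n = j + 1 := by
    refine Nat.exists_eq_succ_of_ne_zero ?_
    rintro rfl
    rw [Nat.cast_zero, zero_mul] at hn
    linarith
  have h1 := H.energy_decay H.rate_mul_le hΦ j fun i _ => H.small i
  have h2 : 0 ≤ μ * k * sobSq L₁ L₂ 2 (a (j + 2)) :=
    mul_nonneg (mul_nonneg H.μ_pos.le hk.le) sobSq_nonneg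
  have h3 : Real.exp (-(decayRate L₁ L₂ μ * j * k / 2)) * (1 + E) ≤ 1 := by
    rw [Real.exp_neg, inv_mul_le_one₀ (Real.exp_pos _), ← Real.log_le_iff_le_exp (by linarith)]
    have h4 : 2 / decayRate L₁ L₂ μ * Real.log (1 + E) ≤ j * k := by
      have := H.step_le
      rw [settleTime] at hn
      push_cast at hn
      linarith
    have h5 := mul_le_mul_of_nonneg_left h4 (show 0 ≤ decayRate L₁ L₂ μ / 2 by positivity)
    calc Real.log (1 + E) =
          decayRate L₁ L₂ μ / 2 * (2 / decayRate L₁ L₂ μ * Real.log (1 + E)) := by field_simp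
      _ ≤ _ := h5
      _ = _ := by ring
  have h4 := mul_le_mul_of_nonneg_left hE
    (Real.exp_nonneg (-(decayRate L₁ L₂ μ * j * k / 2)))
  have h5 := Real.exp_nonneg (-(decayRate L₁ L₂ μ * j * k / 2))
  linarith

/-- A time step takes at most the time `1 / ν` and a window at most `2 / ν`. -/
theorem index_le (H : IsStable L₁ L₂ μ k N a g) {T : ℝ} (hT : 0 ≤ T) {p q n : ℕ}
    (h : T + (1 + 2 * p + q) / decayRate L₁ L₂ μ ≤ n * k) : ⌈T / k⌉₊ + p * N + q ≤ n := by
  have hk := H.k_pos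
  have h1 := mul_le_mul_of_nonneg_right (Nat.ceil_lt_add_one (div_nonneg hT hk.le)).le hk.le
  rw [add_mul, div_mul_cancel₀ _ hk.ne', one_mul] at h1
  have h2 := mul_le_mul_of_nonneg_left H.window_le (Nat.cast_nonneg (α := ℝ) p)
  have h3 := mul_le_mul_of_nonneg_left H.step_le (Nat.cast_nonneg (α := ℝ) q)
  have h4 := H.step_le
  have h5 : (1 + 2 * p + q) / decayRate L₁ L₂ μ = 1 / decayRate L₁ L₂ μ +
      p * (2 / decayRate L₁ L₂ μ) + q * (1 / decayRate L₁ L₂ μ) := by ring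
  have h6 : ((⌈T / k⌉₊ + p * N + q : ℕ) : ℝ) * k ≤ n * k := by
    push_cast
    linarith
  exact_mod_cast le_of_mul_le_mul_right h6 hk

end IsStable

/-- Bound in `H¹` one time window after the energy has settled. -/
theorem exists_sob_one_le (L₁ L₂ μ Φ₀ : ℝ) : ∃ M, ∀ {k : ℝ} {N : ℕ} {a g : ℕ → Coeffs},
    IsStable L₁ L₂ μ k N a g → (∀ n, g n 0 = 0) → (∀ n, SobBound L₁ L₂ 0 (g n) Φ₀) →
    ∀ E, bdfEnergy L₁ L₂ 0 (decayRate L₁ L₂ μ * k) (a 0) (a 1) ≤ E →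
    ∀ n ≥ ⌈settleTime L₁ L₂ μ E / k⌉₊ + N + 3, SobBound L₁ L₂ 2 (a n) M := by
  refine ⟨2 * sobOneBound L₁ L₂ μ ((1 + 8 * (poincareRoot L₁ L₂ ^ 2 * Φ₀) /
      (μ * decayRate L₁ L₂ μ) + 12 * (poincareRoot L₁ L₂ ^ 2 * Φ₀) /
      (μ * decayRate L₁ L₂ μ)) / μ) Φ₀, ?_⟩
  intro k N a g H hg0 hg E hE n hn
  obtain ⟨p, rfl⟩ := Nat.exists_eq_add_of_le' (show N + 3 ≤ n by omega)
  have hp : settleTime L₁ L₂ μ E ≤ p * k := by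
    rw [← div_le_iff₀ H.k_pos]
    exact (Nat.le_ceil _).trans (by exact_mod_cast (by omega))
  have hΦ := fun n => (hg n).dualSq_le H.pos₁ H.pos₂ (hg0 n)
  have h1 := H.dissipation_window (m := p) hΦ (H.energy_le_of_settleTime_le hE hΦ hp)
  have h2 := H.sob_one_window (m := p + 2) (fun n => (hg n).1) (fun n => (hg n).2)
    (fun n hn => by
      obtain ⟨q, rfl⟩ := Nat.exists_eq_add_of_le' (show 2 ≤ n by omega)
      exact H.sob_two q) h1
  refine ⟨H.sob_two (p + N + 1), ?_⟩
  have h3 := (sobSq_le_bdfEnergy le_rfl).trans (mul_le_mul_of_nonneg_left h2 zero_le_two)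
  convert! h3 using 3
  omega

/-- Bound in `H¹` for all times, for initial data in `H¹`. -/
theorem exists_sob_one_all (L₁ L₂ μ Q Φ₀ : ℝ) : ∃ M, ∀ {k : ℝ} {N : ℕ} {a g : ℕ → Coeffs},
    IsStable L₁ L₂ μ k N a g → (∀ n, g n 0 = 0) → (∀ n, SobBound L₁ L₂ 0 (g n) Φ₀) →
    SobBound L₁ L₂ 2 (a 0) Q → SobBound L₁ L₂ 2 (a 1) Q → ∀ n, SobBound L₁ L₂ 2 (a n) M := by
  set Φ := poincareRoot L₁ L₂ ^ 2 * Φ₀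
  set K := 6 * poincareRoot L₁ L₂ * (poincareRoot L₁ L₂ * Q) + 8 * Φ / (μ * decayRate L₁ L₂ μ)
    with hK
  have hall := @IsStable.sob_one_all L₁ L₂ μ
  set C := 6 * Q * Real.exp (40 * (embConst L₁ L₂ *
        poincareRoot L₁ L₂) * (2 * Q / decayRate L₁ L₂ μ +
        (K + 12 * Φ / (μ * decayRate L₁ L₂ μ)) / μ) / μ) +
      sobOneBound L₁ L₂ μ (2 * Q / decayRate L₁ L₂ μ +
        (K + 12 * Φ / (μ * decayRate L₁ L₂ μ)) / μ) Φ₀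
  refine ⟨Q + 2 * C, ?_⟩
  intro k N a g H hg0 hg h0 h1 n
  have hν := H.rate_pos
  have hk := H.k_pos
  have hμ := H.μ_pos
  have hr := (poincareRoot_pos (L₂ := L₂) H.pos₁).le
  have hΦ := fun n => (hg n).dualSq_le H.pos₁ H.pos₂ (hg0 n)
  have hΦ0 : 0 ≤ 8 * Φ / (μ * decayRate L₁ L₂ μ) := by
    have := dualSq_nonneg.trans (hΦ 0)
    positivity
  have hE := energy_init_le H.toIsTrajectory H.rate_mul_le
    ((sobSq_le_succ H.pos₁ H.pos₂ (H.zero 0) h0.1).trans (mul_le_mul_of_nonneg_left h0.2 hr))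
    ((sobSq_le_succ H.pos₁ H.pos₂ (H.zero 1) h1.1).trans (mul_le_mul_of_nonneg_left h1.2 hr))
  have hKn : ∀ n, bdfEnergy L₁ L₂ 0 (decayRate L₁ L₂ μ * k) (a n) (a (n + 1)) ≤ K := by
    rintro (_ | j)
    · linarith
    · have e1 := H.energy_decay H.rate_mul_le hΦ j fun i _ => H.small i
      have e2 : 0 ≤ μ * k * sobSq L₁ L₂ 2 (a (j + 2)) := mul_nonneg (by positivity) sobSq_nonneg
      have e3 : Real.exp (-(decayRate L₁ L₂ μ * j * k / 2)) ≤ 1 :=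
        Real.exp_le_one_iff.mpr (neg_nonpos.mpr (by positivity))
      have e4 : 0 ≤ bdfEnergy L₁ L₂ 0 (decayRate L₁ L₂ μ * k) (a 0) (a 1) :=
        bdfEnergy_nonneg (by positivity)
      have e5 := mul_le_mul_of_nonneg_right e3 e4
      linarith
  have hC : ∀ n, bdfEnergy L₁ L₂ 2 0 (a n) (a (n + 1)) ≤ C :=
    hall H hΦ (fun n => (hg n).1) (fun n => (hg n).2) hKn h0.1 h1.1 h0.2 h1.2
  have hC0 : 0 ≤ C := (bdfEnergy_nonneg le_rfl).trans (hC 0)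
  have hQ := h0.nonneg
  rcases n with _ | n
  · exact h0.mono (by linarith)
  · refine ⟨?_, ?_⟩
    · rcases n with _ | n
      · exact h1.1
      · exact H.sob_two n
    · have e1 := (sobSq_le_bdfEnergy (u := a n) (L₁ := L₁) (L₂ := L₂) (n := 2) (v := a (n + 1))
        le_rfl).trans (mul_le_mul_of_nonneg_left (hC n) zero_le_two)
      linarith

/-- Bounds for large times, with forcing in `L²`. The time `15 / ν = (1 + 2 * 3 + 8) / ν` is enough
for rounding, three windows and eight steps. -/
theorem exists_late_bounds_one (L₁ L₂ μ Φ₀ : ℝ) : ∃ (M B : ℝ) (B' : ℝ → ℝ),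
    ∀ {k : ℝ} {N : ℕ} {a g : ℕ → Coeffs},
    IsStable L₁ L₂ μ k N a g → (∀ n, g n 0 = 0) → (∀ n, SobBound L₁ L₂ 0 (g n) Φ₀) →
    ∀ E, bdfEnergy L₁ L₂ 0 (decayRate L₁ L₂ μ * k) (a 0) (a 1) ≤ E →
    ∀ n : ℕ, settleTime L₁ L₂ μ E + 15 / decayRate L₁ L₂ μ ≤ n * k →
      SobBound L₁ L₂ 2 (a n) M ∧ incSq L₁ L₂ a n ≤ k * B ∧
      ∀ D, (∀ n, dualSq L₁ L₂ (fun κ => g (n + 1) κ - g n κ) ≤ D * k ^ 2) →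
        incSq L₁ L₂ a n ≤ k ^ 2 * B' D := by
  obtain ⟨M, hM⟩ := exists_sob_one_le L₁ L₂ μ Φ₀
  obtain ⟨B, hB⟩ := exists_incSq_le L₁ L₂ μ M Φ₀
  obtain ⟨B', hB'⟩ := exists_incSq_le_sq L₁ L₂ μ M Φ₀
  refine ⟨M, B, B', ?_⟩
  intro k N a g H hg0 hg E hE n hn
  have hE0 : 0 ≤ E :=
    (bdfEnergy_nonneg (mul_nonneg H.rate_pos.le H.k_pos.le)).trans hE
  have hi := H.index_le (settleTime_pos (L₂ := L₂) H.pos₁ H.μ_pos hE0).le (p := 3) (q := 8)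
    (n := n) (by norm_num; exact hn)
  exact ⟨hM H hg0 hg E hE n (by omega), hB H hg (hM H hg0 hg E hE) n (by omega),
    fun D hD => hB' H hg (hM H hg0 hg E hE) D hD n (by omega)⟩

/-- Bounds for large times, with forcing in `H¹`. -/
theorem exists_late_bounds_two (L₁ L₂ μ Φ₁ : ℝ) : ∃ M B : ℝ,
    ∀ {k : ℝ} {N : ℕ} {a g : ℕ → Coeffs},
    IsStable L₁ L₂ μ k N a g → (∀ n, g n 0 = 0) → (∀ n, SobBound L₁ L₂ 2 (g n) Φ₁) →
    ∀ E, bdfEnergy L₁ L₂ 0 (decayRate L₁ L₂ μ * k) (a 0) (a 1) ≤ E →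
    ∀ n : ℕ, settleTime L₁ L₂ μ E + 15 / decayRate L₁ L₂ μ ≤ n * k →
      SobBound L₁ L₂ 4 (a n) M ∧ incSq L₁ L₂ a n ≤ k ^ 2 * B := by
  obtain ⟨M₁, hM₁⟩ := exists_sob_one_le L₁ L₂ μ (poincareRoot L₁ L₂ ^ 2 * Φ₁)
  obtain ⟨M, B, hB⟩ := exists_sob_two_le L₁ L₂ μ M₁ (poincareRoot L₁ L₂ ^ 2 * Φ₁) Φ₁
  refine ⟨M, B, ?_⟩
  intro k N a g H hg0 hg E hE n hn
  have hE0 : 0 ≤ E :=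
    (bdfEnergy_nonneg (mul_nonneg H.rate_pos.le H.k_pos.le)).trans hE
  have hi := H.index_le (settleTime_pos (L₂ := L₂) H.pos₁ H.μ_pos hE0).le (p := 3) (q := 8)
    (n := n) (by norm_num; exact hn)
  have hg' := fun n => SobBound.of_add_two H.pos₁ H.pos₂ (hg0 n) (hg n)
  obtain ⟨h1, h2⟩ := hB H hg' hg (hM₁ H hg0 hg' E hE)
  exact ⟨h1 n (by omega), h2 n (by omega)⟩

end LargeTimes

/-! ### From coefficients back to functions -/

section Increments

variable {L₁ L₂ : ℝ}

theorem l2Norm_increment_le (hL₁ : 0 < L₁) (hL₂ : 0 < L₂) {μ k B : ℝ} (hk : 0 < k)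
    {f : ℕ → (TestFn L₁ L₂ →ₗ[ℝ] ℝ)} {ω : ℕ → ℝ × ℝ → ℝ} (H : IsSolution L₁ L₂ μ k f ω) {n : ℕ}
    (h : incSq L₁ L₂ (fun n => fourierCf L₁ L₂ (ω n)) n ≤ k ^ 2 * B) :
    l2Norm L₁ L₂ (fun p => ω (n + 1) p - ω n p) ≤ k * √(L₁ * L₂ * B) := by
  rw [l2Norm, l2Sq_increment hL₁ hL₂ H]
  calc √(L₁ * L₂ * incSq L₁ L₂ (fun n => fourierCf L₁ L₂ (ω n)) n)
      ≤ √(k ^ 2 * (L₁ * L₂ * B)) := by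
        refine Real.sqrt_le_sqrt ?_
        exact (mul_le_mul_of_nonneg_left h (by positivity)).trans_eq (by ring)
    _ = k * √(L₁ * L₂ * B) := by rw [Real.sqrt_mul (sq_nonneg k), Real.sqrt_sq hk.le]

end Increments

end PeriodicNS

end

open PeriodicNS in
theorem mainTheorem3 (L₁ L₂ : ℝ) (hL₁ : 0 < L₁) (hL₂ : 0 < L₂) :
    ∃ c : ℝ, 0 < c ∧ ∀ μ : ℝ, 0 < μ →
    ∃ (k₀ : ℝ → ℝ → ℝ)
      (M₀ : ℝ → ℝ) (t₀ : ℝ → ℝ → ℝ)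
      (M₁' : ℝ → ℝ → ℝ) (M₁ : ℝ → ℝ) (t₁ : ℝ → ℝ → ℝ)
      (M₂ : ℝ → ℝ) (t₂ : ℝ → ℝ → ℝ)
      (Mhalf : ℝ → ℝ) (Mδ : ℝ → ℝ) (Mδ' : ℝ → ℝ → ℝ),
      (∀ R F, 0 < k₀ R F ∧ k₀ R F ≤ 1 / PeriodicNS.decayRate L₁ L₂ μ) ∧
      ∀ (R F k : ℝ) (f : ℕ → (PeriodicNS.TestFn L₁ L₂ →ₗ[ℝ] ℝ)) (ω : ℕ → ℝ × ℝ → ℝ),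
        0 < k → k ≤ k₀ R F →
        (∀ n, PeriodicNS.HNegBound L₁ L₂ (f n) F) →
        PeriodicNS.HBound L₁ L₂ (1 / 2) (ω 0) R →
        PeriodicNS.HBound L₁ L₂ (1 / 2) (ω 1) R →
        PeriodicNS.IsSolution L₁ L₂ μ k f ω →
        -- uniform bound in `L²` for all times
        (∀ n : ℕ, PeriodicNS.MemH L₁ L₂ 1 (ω (n + 2)) ∧
          PeriodicNS.gNormSq L₁ L₂ (PeriodicNS.decayRate L₁ L₂ μ * k) (ω (n + 1)) (ω (n + 2))
              + μ * k * PeriodicNS.hNorm L₁ L₂ 1 (ω (n + 2)) ^ 2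
            ≤ Real.exp (-(PeriodicNS.decayRate L₁ L₂ μ * n * k / 2)) *
                PeriodicNS.gNormSq L₁ L₂ (PeriodicNS.decayRate L₁ L₂ μ * k) (ω 0) (ω 1)
              + c / μ ^ 2 * F ^ 2) ∧
        -- bound in `L²` independent of the initial data, for large times
        (∀ n : ℕ, t₀ R F ≤ n * k → PeriodicNS.l2Norm L₁ L₂ (ω n) ≤ M₀ F) ∧
        -- forcing bounded in `L²`
        (∀ F₀ : ℝ, (∀ n, PeriodicNS.ForceL2Bound L₁ L₂ (f n) F₀) →
          -- bound in `H¹` for all times, if the initial data are in `H¹`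
          (∀ R₁ : ℝ, PeriodicNS.HBound L₁ L₂ 1 (ω 0) R₁ → PeriodicNS.HBound L₁ L₂ 1 (ω 1) R₁ →
            ∀ n : ℕ, PeriodicNS.HBound L₁ L₂ 1 (ω n) (M₁' R₁ F₀)) ∧
          -- bound in `H¹` independent of the initial data, for large times
          (∀ n : ℕ, t₁ R F₀ ≤ n * k → PeriodicNS.HBound L₁ L₂ 1 (ω n) (M₁ F₀)) ∧
          -- the increments are of order `k^{1/2}` for large times
          (∀ n : ℕ, t₁ R F₀ ≤ n * k →
            PeriodicNS.l2Sq L₁ L₂ (fun p => ω (n + 1) p - ω n p) ≤ k * Mhalf F₀) ∧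
          -- the increments are of order `k` for large times, if those of the forcing are
          (∀ D : ℝ, (∀ n, PeriodicNS.HNegBound L₁ L₂ (f (n + 1) - f n) (D * k)) →
            ∀ n : ℕ, t₁ R F₀ ≤ n * k →
              PeriodicNS.l2Norm L₁ L₂ (fun p => ω (n + 1) p - ω n p) ≤ k * Mδ' F₀ D)) ∧
        -- forcing bounded in `H¹`
        (∀ F₁ : ℝ, (∀ n, PeriodicNS.ForceH1Bound L₁ L₂ (f n) F₁) →
          -- bound in `H²` independent of the initial data, for large times
          (∀ n : ℕ, t₂ R F₁ ≤ n * k → PeriodicNS.HBound L₁ L₂ 2 (ω n) (M₂ F₁)) ∧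
          -- the increments are of order `k` for large times
          (∀ n : ℕ, t₂ R F₁ ≤ n * k →
            PeriodicNS.l2Norm L₁ L₂ (fun p => ω (n + 1) p - ω n p) ≤ k * Mδ F₁)) := by
  have hV : 0 < L₁ * L₂ := mul_pos hL₁ hL₂
  -- the source in the energy estimate, `8 / (μ ν)` with `ν = μ / (2 c₀)`
  refine ⟨16 * poincareConst L₁ L₂, by
    have := poincareRoot_pos (L₂ := L₂) hL₁
    rw [← poincareRoot_sq]
    positivity, ?_⟩
  intro μ hμ
  have hν := decayRate_pos (L₂ := L₂) hL₁ hμ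
  choose M₁' hM₁' using exists_sob_one_all L₁ L₂ μ
  choose M₁ B B' hlate₁ using exists_late_bounds_one L₁ L₂ μ
  choose M₂ B₂ hlate₂ using exists_late_bounds_two L₁ L₂ μ
  have hsq : ∀ x : ℝ, 0 ≤ x ^ 2 / (L₁ * L₂) := fun x => by positivity
  -- The initial energy is at most this multiple of the squared `H^{1/2}` norm of the initial data.
  set E : ℝ → ℝ := fun R => 6 * poincareRoot L₁ L₂ * (R ^ 2 / (L₁ * L₂)) with hEdef
  refine ⟨fun R F => maxStep L₁ L₂ μ (R ^ 2 / (L₁ * L₂)) (F ^ 2 / (L₁ * L₂)),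
    fun F => √(L₁ * L₂ * (2 * (1 + 8 * (F ^ 2 / (L₁ * L₂)) / (μ * decayRate L₁ L₂ μ)))),
    fun R _ => settleTime L₁ L₂ μ (E R) + 1 / decayRate L₁ L₂ μ,
    fun R₁ F₀ => √(L₁ * L₂ * M₁' (R₁ ^ 2 / (L₁ * L₂)) (F₀ ^ 2 / (L₁ * L₂))),
    fun F₀ => √(L₁ * L₂ * M₁ (F₀ ^ 2 / (L₁ * L₂))),
    fun R _ => settleTime L₁ L₂ μ (E R) + 15 / decayRate L₁ L₂ μ,
    fun F₁ => √(L₁ * L₂ * M₂ (F₁ ^ 2 / (L₁ * L₂))),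
    fun R _ => settleTime L₁ L₂ μ (E R) + 15 / decayRate L₁ L₂ μ,
    fun F₀ => L₁ * L₂ * B (F₀ ^ 2 / (L₁ * L₂)),
    fun F₁ => √(L₁ * L₂ * B₂ (F₁ ^ 2 / (L₁ * L₂))),
    fun F₀ D => √(L₁ * L₂ * B' (F₀ ^ 2 / (L₁ * L₂)) (D ^ 2 / (L₁ * L₂))),
    fun R F => ⟨maxStep_pos hL₁ hμ (hsq R) (hsq F),
      (min_le_left _ _).trans (min_le_right _ _)⟩, ?_⟩
  intro R F k f ω hk hk₀ hf h0 h1 H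
  set a : ℕ → Coeffs := fun n => fourierCf L₁ L₂ (ω n) with ha
  set g : ℕ → Coeffs := fun n => distCf hL₁ hL₂ (f n) with hg
  have T : IsTrajectory L₁ L₂ μ k a g := H.isTrajectory hL₁ hL₂ hμ hk hf h0 h1
  have hΦ : ∀ n, dualSq L₁ L₂ (g n) ≤ F ^ 2 / (L₁ * L₂) := fun n => ((hf n).dual hL₁ hL₂).2
  have hg0 : ∀ n, g n 0 = 0 := fun n => (hf n).distCf_zero hL₁ hL₂
  have hb0 := (h0.sobBound hL₁ hL₂ 1 (by norm_num)).2
  have hb1 := (h1.sobBound hL₁ hL₂ 1 (by norm_num)).2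
  obtain ⟨hνk, hsmall⟩ := T.small hk₀ hΦ hb0 hb1
  obtain ⟨N, hN, hN1, hN2⟩ := exists_window hν hk hνk
  have S : IsStable L₁ L₂ μ k N a g := ⟨T, hνk, hsmall, hN, hN1, hN2⟩
  have hE : bdfEnergy L₁ L₂ 0 (decayRate L₁ L₂ μ * k) (a 0) (a 1) ≤ E R :=
    energy_init_le T hνk hb0 hb1
  refine ⟨fun n => ⟨?_, ?_⟩, fun n hn => ?_, fun F₀ hF₀ => ?_, fun F₁ hF₁ => ?_⟩
  · exact (memH_iff 2 (by norm_num)).2 ⟨H.perL2 _, S.sob_two n⟩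
  · have e1 := mul_le_mul_of_nonneg_left (T.energy_decay hνk hΦ n fun j _ => hsmall j) hV.le
    rw [gNormSq_eq hL₁ hL₂ (H.perL2 _) (H.perL2 _), gNormSq_eq hL₁ hL₂ (H.perL2 _) (H.perL2 _),
      hNorm_eq 2 (by norm_num), Real.sq_sqrt (mul_nonneg hV.le sobSq_nonneg)]
    have e2 : L₁ * L₂ * (8 * (F ^ 2 / (L₁ * L₂)) / (μ * decayRate L₁ L₂ μ)) =
        16 * poincareConst L₁ L₂ / μ ^ 2 * F ^ 2 := by
      have : 0 < poincareConst L₁ L₂ := by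
        rw [← poincareRoot_sq]
        exact pow_pos (poincareRoot_pos hL₁) 2
      rw [decayRate]
      field_simp
      ring
    rw [mul_add, mul_add (L₁ * L₂), e2] at e1
    linarith
  · have hn0 : 0 < (n : ℝ) * k := by
      have := settleTime_pos (L₂ := L₂) hL₁ hμ ((bdfEnergy_nonneg (by positivity)).trans hE)
      exact (by positivity : (0 : ℝ) < _).trans_le hn
    obtain ⟨j, rfl⟩ : ∃ j, n = j + 1 := by
      refine Nat.exists_eq_succ_of_ne_zero ?_
      rintro rfl
      simp at hn0
    have e1 := S.step_le
    push_cast at hn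
    have e2 := S.energy_le_of_settleTime_le hE hΦ (n := j) (by linarith)
    rw [l2Norm, l2Sq_eq hL₁ hL₂ (H.perL2 _)]
    refine Real.sqrt_le_sqrt (mul_le_mul_of_nonneg_left ?_ hV.le)
    exact (sobSq_le_bdfEnergy (by positivity)).trans (mul_le_mul_of_nonneg_left e2 zero_le_two)
  · have hg' : ∀ n, SobBound L₁ L₂ 0 (g n) (F₀ ^ 2 / (L₁ * L₂)) :=
      fun n => (hF₀ n).sobBound hL₁ hL₂
    have hl := hlate₁ _ S hg0 hg' (E R) hE
    refine ⟨fun R₁ i0 i1 n => ?_, fun n hn => ?_, fun n hn => ?_, fun D hD n hn => ?_⟩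
    · exact (hM₁' _ _ S hg0 hg' (i0.sobBound hL₁ hL₂ 2 (by norm_num))
        (i1.sobBound hL₁ hL₂ 2 (by norm_num)) n).hBound hL₁ hL₂ 2 (by norm_num) (H.perL2 n)
    · exact (hl n hn).1.hBound hL₁ hL₂ 2 (by norm_num) (H.perL2 n)
    · rw [l2Sq_increment hL₁ hL₂ H]
      exact (mul_le_mul_of_nonneg_left (hl n hn).2.1 hV.le).trans_eq (by ring)
    · refine l2Norm_increment_le hL₁ hL₂ hk H ((hl n hn).2.2 _ fun m => ?_)
      have e1 := ((hD m).dual hL₁ hL₂).2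
      rw [distCf_sub] at e1
      exact e1.trans_eq (by ring)
  · have hg' : ∀ n, SobBound L₁ L₂ 2 (g n) (F₁ ^ 2 / (L₁ * L₂)) :=
      fun n => (hF₁ n).sobBound hL₁ hL₂
    have hl := hlate₂ _ S hg0 hg' (E R) hE
    exact ⟨fun n hn => (hl n hn).1.hBound hL₁ hL₂ 4 (by norm_num) (H.perL2 n),
      fun n hn => l2Norm_increment_le hL₁ hL₂ hk H (hl n hn).2⟩
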